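/- \textbf{Setting.} Let $G$ be a finitely generated amenable group. For a generating $k$-tuple $S=(s_1,\dots,s_k)$ put $S^*=\{e,s_1^{\pm1},\dots,s_k^{\pm1}\}$, let $|\cdot|$ be the word length with respect to $S^*$ and $\mathbf u$ the uniform probability measure on $S^*$. For a symmetric probability measure $\phi$ on $G$ let $$\mathcal E_\phi(f,f)=\tfrac12\sum_{x,y\in G}|f(xy)-f(x)|^2\phi(y),\qquad \Lambda_\phi(v)=\inf\{\mathcal E_\phi(f,f):\ |\mathrm{support}(f)|\le v,\ \|f\|_2=1\}\quad (v\ge1),$$ and for $\rho:[0,\infty)\to[1,\infty)$ let $W(\rho,\phi)=\sup_{s>0}s\,\phi(\{g:\rho(|g|)>s\})$ and $$\widetilde{\boldsymbol\Lambda}_{G,\rho}(v)=\sup\{\Lambda_\phi(v):\ \phi \text{ a symmetric probability measure with } W(\rho,\phi)\le 2\rho(0)\}.$$ For monotone functions, $f_1\simeq f_2$ means $c_1f_1(c_2t)\le f_2(t)\le c_3f_1(c_4t)$ on the common domain, for some $c_i\in(0,\infty)$. Let $\ell:[0,\infty)\to[1,\infty)$ be continuous, increasing and slowly varying at infinity,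 with $\int_0^\infty\frac{ds}{(1+s)\ell(s)}<\infty$ and $\ell(t^a)\simeq\ell(t)$ for every $a>0$. Let $\rho:[0,\infty)\to[1,\infty)$ be continuous and increasing with $\rho(t)\simeq\left(\int_t^\infty\frac{ds}{(1+s)\ell(s)}\right)^{-1}$. (Increasing means non-decreasing.) Say that $\psi$ is \emph{associated with} $\ell$ if $\psi$ is a complete Bernstein function (that is, $\psi(s)=s^2\int_0^\infty e^{-ts}g(t)\,dt$ for $s>0$ with $g(s)=a+bs+\int_{(0,\infty)}(1-e^{-st})\,\nu(dt)$, $a,b\ge0$, $\int_{(0,\infty)}\min(1,t)\,\nu(dt)<\infty$) with $\psi(0^+)=0$, $\psi(1)=1$ and $\psi(s)\sim c_0\int_0^s\frac{dr}{r\,\ell(1/r)}$ as $s\to0^+$ for some $c_0>0$. For such $\psi$ let $\mathbf u_\psi=\sum_{n\ge1}c(\psi,n)\,\mathbf u^{(n)}$, where $1-\psi(1-x)=\sum_{n\ge1}c(\psi,n)x^n$ is the Taylor series at $0$ and $\mathbf u^{(n)}$ is the $n$-fold convolution power. Since $\rho(t)\to\infty$ as $t\to\infty$, the quantity $1/\rho(1/x)$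 is read as $0$ at $x=0$ (this matters only when $G$ is finite). \textbf{Theorem.} \begin{enumerate} \item A complete Bernstein function associated with $\ell$ exists. \item For every $\psi$ associated with $\ell$ there are constants $c,C\in(0,\infty)$ depending only on $G$, $|S^*|$, $\rho$ and $\psi$ such that, for every generating tuple $S$ with the given value of $|S^*|$, $\mathbf u_\psi$ is a symmetric probability measure, $W(\rho,\mathbf u_\psi)\le C$, and $$\frac{c}{\rho(1/\Lambda_{\mathbf u}(v))}\le\Lambda_{\mathbf u_\psi}(v)\le\frac{C}{\rho(1/\Lambda_{\mathbf u}(v))}\qquad(v\ge1).$$ \item There is a constant $C\in(0,\infty)$ depending only on $G$, $|S^*|$ and $\rho$ such that every symmetric probability measure $\phi$ on $G$ with $W(\rho,\phi)\le K$ satisfies $$\Lambda_\phi(v)\le\frac{CK}{\rho(1/\Lambda_{\mathbf u}(v))}\qquad(v\ge1).$$ \item In particular $\widetilde{\boldsymbol\Lambda}_{G,\rho}\simeq 1/\rho(1/\Lambda_G)$; more precisely, for every generating tuple $S$ and every symmetric probability measure $\mu$ on $G$ with finite generating support (so that $\Lambda_\mu$ represents the class $\Lambda_G$) there are $c,C\in(0,\infty)$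 with $$\frac{c}{\rho(1/\Lambda_\mu(v))}\le\widetilde{\boldsymbol\Lambda}_{G,\rho}(v)\le\frac{C}{\rho(1/\Lambda_\mu(v))}\qquad(v\ge1).$$ \end{enumerate} -/

import Mathlib

open Set Filter Topology MeasureTheory

noncomputable section

namespace Profile

section Relations

/-- Equivalence `f₁ ≃ f₂` of monotone functions on a domain `D`: equality up to positive
multiplicative constants outside and inside the argument. -/
def SimeqOn (D : Set ℝ) (f₁ f₂ : ℝ → ℝ) : Prop :=
  ∃ c₁ c₂ c₃ c₄ : ℝ, 0 < c₁ ∧ 0 < c₂ ∧ 0 < c₃ ∧ 0 < c₄ ∧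
    ∀ t ∈ D, (c₂ * t ∈ D → c₁ * f₁ (c₂ * t) ≤ f₂ t) ∧ (c₄ * t ∈ D → f₂ t ≤ c₃ * f₁ (c₄ * t))

/-- `f` is slowly varying at infinity. -/
def SlowlyVarying (f : ℝ → ℝ) : Prop :=
  ∀ a : ℝ, 0 < a → Tendsto (fun t => f (a * t) / f t) atTop (𝓝 1)

end Relations

section Bernstein

/-- Bernstein functions, through the Lévy–Khintchine formula on `(0, ∞)`. -/
def IsBernstein (f : ℝ → ℝ) : Prop :=
  ∃ (a b : ℝ) (ν : Measure ℝ), 0 ≤ a ∧ 0 ≤ b ∧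
    (∫⁻ t in Ioi (0 : ℝ), ENNReal.ofReal (min 1 t) ∂ν) < ⊤ ∧
    ∀ s : ℝ, 0 < s → f s = a + b * s + ∫ t in Ioi (0 : ℝ), (1 - Real.exp (-(s * t))) ∂ν

/-- Complete Bernstein functions: `f s = s² ∫₀^∞ e^{-ts} g(t) dt` with `g` Bernstein. -/
def IsCompleteBernstein (f : ℝ → ℝ) : Prop :=
  ∃ g : ℝ → ℝ, IsBernstein g ∧
    ∀ s : ℝ, 0 < s → f s = s ^ 2 * ∫ t in Ioi (0 : ℝ), Real.exp (-(t * s)) * g t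

/-- The coefficients `c(f, n)` of the Taylor series of `x ↦ 1 - f (1 - x)` at `0`. -/
def subordCoeff (f : ℝ → ℝ) (n : ℕ) : ℝ :=
  iteratedDeriv n (fun x : ℝ => 1 - f (1 - x)) 0 / (n.factorial : ℝ)

end Bernstein

section Moment

/-- Admissible `ℓ : [0, ∞) → [1, ∞)`: continuous, increasing, slowly varying, with
`∫₀^∞ ds / ((1 + s) ℓ(s)) < ∞` and `ℓ(t^a) ≃ ℓ(t)` for every `a > 0`. -/
structure IsAdmissible (ℓ : ℝ → ℝ) : Prop where
  continuousOn : ContinuousOn ℓ (Ici 0)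
  monotoneOn : MonotoneOn ℓ (Ici 0)
  one_le : ∀ t ∈ Ici (0 : ℝ), 1 ≤ ℓ t
  slowlyVarying : SlowlyVarying ℓ
  integrableOn : IntegrableOn (fun s => 1 / ((1 + s) * ℓ s)) (Ioi 0)
  rpow_simeq : ∀ a : ℝ, 0 < a → SimeqOn (Ici 0) (fun t => ℓ (t ^ a)) ℓ

/-- `ρ : [0, ∞) → [1, ∞)` is continuous, increasing and
`ρ(t) ≃ (∫_t^∞ ds / ((1 + s) ℓ(s)))⁻¹`. -/
structure IsMomentFunction (ρ ℓ : ℝ → ℝ) : Prop where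
  continuousOn : ContinuousOn ρ (Ici 0)
  monotoneOn : MonotoneOn ρ (Ici 0)
  one_le : ∀ t ∈ Ici (0 : ℝ), 1 ≤ ρ t
  simeq : SimeqOn (Ici 0) ρ (fun t => (∫ s in Ioi t, 1 / ((1 + s) * ℓ s))⁻¹)

/-- `ψ` is a complete Bernstein function associated with `ℓ`: `ψ(0) = 0`, `ψ(1) = 1` and
`ψ(s) ∼ c ∫₀^s dr / (r ℓ(1/r))` as `s → 0` for some `c > 0`. -/
structure IsAssociated (ℓ ψ : ℝ → ℝ) : Prop where
  completeBernstein : IsCompleteBernstein ψ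
  map_zero : Tendsto ψ (𝓝[>] 0) (𝓝 0)
  map_one : ψ 1 = 1
  equivalent : ∃ c : ℝ, 0 < c ∧
    Asymptotics.IsEquivalent (𝓝[>] 0) ψ (fun s => c * ∫ r in (0 : ℝ)..s, 1 / (r * ℓ (1 / r)))

/-- The function `x ↦ 1 / ρ(1 / x)` on `[0, ∞)`, with value `1 / ρ(∞) = 0` at `x = 0`. -/
def recipAt (ρ : ℝ → ℝ) (x : ℝ) : ℝ :=
  if x = 0 then 0 else 1 / ρ (1 / x)

end Moment

section Groups

variable {G : Type*} [Group G]

/-- Amenability of a discrete group: there is a left-invariant finitely additive probability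
measure defined on all subsets. -/
def IsAmenable (G : Type*) [Group G] : Prop :=
  ∃ m : Set G → ℝ, (∀ A, 0 ≤ m A) ∧ m univ = 1 ∧
    (∀ A B, Disjoint A B → m (A ∪ B) = m A + m B) ∧
    ∀ (g : G) (A : Set G), m ((fun x => g * x) '' A) = m A

/-- The `k`-tuple `S` generates `G`. -/
def Generates {k : ℕ} (S : Fin k → G) : Prop :=
  Subgroup.closure (range S) = ⊤

/-- The symmetric set `S* = {e, s₁^{±1}, …, s_k^{±1}}`. -/
def symSet {k : ℕ} (S : Fin k → G) : Set G :=
  {1} ∪ range S ∪ range (fun i => (S i)⁻¹)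

/-- The word length of `g` with respect to `S*`. -/
def wordLength {k : ℕ} (S : Fin k → G) (g : G) : ℕ :=
  sInf {m : ℕ | ∃ w : List G, w.length = m ∧ (∀ σ ∈ w, σ ∈ symSet S) ∧ w.prod = g}

/-- The uniform probability on `S*`. -/
def unif {k : ℕ} (S : Fin k → G) : G → ℝ :=
  (symSet S).indicator (fun _ => 1 / ((symSet S).ncard : ℝ))

/-- Symmetric probability measures on the discrete group `G`, given by their weights. -/
structure IsSymmProb (φ : G → ℝ) : Prop where
  nonneg : ∀ g, 0 ≤ φ g
  hasSum : HasSum φ 1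
  symm : ∀ g, φ g⁻¹ = φ g

/-- Convolution of functions on `G`. -/
def conv (f h : G → ℝ) : G → ℝ :=
  fun x => ∑' y : G, f y * h (y⁻¹ * x)

/-- Convolution powers `φ^{(n)}`, with `φ^{(0)} = δ_e`. -/
def convPow (φ : G → ℝ) : ℕ → G → ℝ
  | 0 => ({1} : Set G).indicator (fun _ => 1)
  | n + 1 => conv (convPow φ n) φ

/-- The subordinated measure `φ_ψ = ∑_{n ≥ 1} c(ψ, n) φ^{(n)}`. -/
def subord (ψ : ℝ → ℝ) (φ : G → ℝ) : G → ℝ :=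
  fun g => ∑' n : ℕ, subordCoeff ψ (n + 1) * convPow φ (n + 1) g

/-- The weak moment `W(ρ, φ) = sup_{s > 0} s φ({g : ρ(|g|) > s})`, an extended real. -/
def weakMoment {k : ℕ} (S : Fin k → G) (ρ : ℝ → ℝ) (φ : G → ℝ) : ENNReal :=
  ⨆ (s : ℝ) (_ : 0 < s),
    ENNReal.ofReal s * ∑' g : {g : G // s < ρ (wordLength S g)}, ENNReal.ofReal (φ g)

/-- The Dirichlet form of `φ`. -/
def dirichlet (φ : G → ℝ) (f₁ f₂ : G → ℝ) : ℝ :=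
  1 / 2 * ∑' p : G × G, (f₁ (p.1 * p.2) - f₁ p.1) * (f₂ (p.1 * p.2) - f₂ p.1) * φ p.2

/-- The lowest Dirichlet eigenvalue `λ_φ(Ω)` of a finite nonempty set `Ω`. -/
def lowEig (φ : G → ℝ) (Ω : Finset G) : ℝ :=
  sInf {x : ℝ | ∃ f : G → ℝ, Function.support f ⊆ (Ω : Set G) ∧
    ∑ g ∈ Ω, f g ^ 2 = 1 ∧ x = dirichlet φ f f}

/-- The spectral profile `Λ_φ(v)`, for `v ≥ 1`. -/
def spectralProfile (φ : G → ℝ) (v : ℝ) : ℝ :=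
  sInf {x : ℝ | ∃ Ω : Finset G, Ω.Nonempty ∧ (Ω.card : ℝ) ≤ v ∧ x = lowEig φ Ω}

/-- The extremal profile: the supremum of `Λ_φ(v)` over all symmetric probability measures `φ`
with `W(ρ, φ) ≤ 2 ρ(0)`. -/
def extremalProfile {k : ℕ} (S : Fin k → G) (ρ : ℝ → ℝ) (v : ℝ) : ℝ :=
  sSup {x : ℝ | ∃ φ : G → ℝ, IsSymmProb φ ∧
    weakMoment S ρ φ ≤ ENNReal.ofReal (2 * ρ 0) ∧ x = spectralProfile φ v}

end Groups

end Profile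

end

/-!
Everything is deduced from comparisons of Dirichlet forms on finitely supported functions; the
profile enters only through `E(f) ≥ Λ(v) ‖f‖²` for `f` carried by at most `v` points, and `E` is
half the average over `y` of the squared displacement `‖f(· y) - f‖²`.

*Upper bound.* Displacements grow at most quadratically with the word length and never exceed
`4 ‖f‖²`. If the simple random walk has energy `λ` on `f`, jumps of length at most `λ ^ (-1/4)`
contribute a multiple of `√λ`, and longer ones at most four times their probability, which the weak
moment bounds by a multiple of `1 / ρ(λ ^ (-1/4))`. Since `ρ(t²)` is bounded by a multiple of
`ρ(t)`, both terms are `O(1 / ρ(1/λ))` (`energy_le_of_weakMoment`).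

*The subordinated measure.* A complete Bernstein function with `ψ(0+) = 0` has a Stieltjes
representation `ψ(s) = a s + ∫ s u / (s + u) dκ(u)`; expanding in powers of `1 - s` shows that the
coefficients `c(ψ, n)` are the weights of a probability measure on the positive integers
(`subordCoeff_spec`). As `ψ(s)` is comparable to `1 / ρ(1/s)`, an elementary Tauberian argument
shows that the tails of this measure are comparable to `1 / ρ(n)` (`tailWeight_le`,
`exists_le_tailWeight`). The upper bound of the tails gives the weak moment.

*Lower bound.* It remains to see that `‖f‖² - ⟨f, U^m f⟩ ≥ 1/4` for unit vectors `f` on at most `v`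
points and `m` of order `1 / Λ(v)`, where `U` is the walk operator. If the `ℓ²` norm of `U^j f` has
not dropped by then, the walk has small energy at some intermediate time; cutting off the small
values of that `U^j f` leaves a function on at most `8 v` points, so that the energy is at least of
order `Λ(8 v)` (`quarter_le_energy_convPow`). In an infinite group `Λ(v) ≤ C Λ(8 v)`
(`exists_profile_le_eight`). To prove this, let `f` be an almost minimizer at volume `w` whose
energy is far below `Λ(19 w / 20)`, truncated so that `‖f‖_∞² ≤ 20 / (19 w)`. On average the
products of `f` with its left translates `x ↦ f(g⁻¹ x)` have Rayleigh quotients at most a constant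
times that of `f`, so almost all of their mass belongs to those `g` for which the support `Ω` meets
`g Ω` in more than `19 w / 20` points. These `g` form a symmetric set with product set less than
half as large again; hence they lie in a finite subgroup, and `f` is nearly carried by one of its
cosets (`exists_coset_of_gap`). Some generator moves that coset off itself, so the energy of `f` is
not small (`le_energy_of_coset`). For a finite group the lower bound follows from a spectral gap
for functions with a zero.

*Existence of `ψ`.* The Stieltjes transform of the density `1 / (u ℓ(1/u))` on `(0, 1]` differs
from `∫₀^s dr / (r ℓ(1/r))` by `O(1 / ℓ(1/s))`, which is smaller by a factor `log(1/s)`, because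
`ℓ` changes by a bounded factor between `1/s` and `1/s²`
(`IsAdmissible.stieltjesInt_isEquivalent`).

*Extremal profile.* Mixing the subordinated measure with a point mass at the identity multiplies
its profile by at least a constant and makes its weak moment at most `2 ρ(0)`
(`exists_extremalProfile_bounds`).
-/

noncomputable section

namespace Profile

/-! ### Displacements, energies and the variational description of the profile -/

section FinSupp

variable {α : Type*}

/-- The squared `ℓ²` norm of a function. -/
def nsq (f : α → ℝ) : ℝ := ∑' x, f x ^ 2

/-- Finitely supported functions. -/
abbrev FinSupp (f : α → ℝ) : Prop := (Function.support f).Finite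

theorem FinSupp.of_zero {f F : α → ℝ} (hf : FinSupp f) (h : ∀ x, f x = 0 → F x = 0) :
    FinSupp F :=
  hf.subset fun x hx hfx => hx (h x hfx)

theorem FinSupp.summable {f : α → ℝ} (hf : FinSupp f) : Summable f :=
  summable_of_hasFiniteSupport hf

theorem FinSupp.summable_of_zero {f F : α → ℝ} (hf : FinSupp f) (h : ∀ x, f x = 0 → F x = 0) :
    Summable F :=
  (hf.of_zero h).summable

theorem nsq_nonneg (f : α → ℝ) : 0 ≤ nsq f := tsum_nonneg fun _ => sq_nonneg _

theorem FinSupp.summable_sq {f : α → ℝ} (hf : FinSupp f) : Summable fun x => f x ^ 2 :=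
  hf.summable_of_zero fun x hx => by simp [hx]

theorem sq_le_nsq {f : α → ℝ} (hf : FinSupp f) (x : α) : f x ^ 2 ≤ nsq f :=
  hf.summable_sq.le_tsum x fun _ _ => sq_nonneg _

theorem nsq_smul (a : ℝ) (f : α → ℝ) : nsq (fun x => a * f x) = a ^ 2 * nsq f := by
  unfold nsq
  rw [← tsum_mul_left]
  exact tsum_congr fun x => by ring

theorem nsq_eq_sum {f : α → ℝ} {Ω : Finset α} (h : Function.support f ⊆ (Ω : Set α)) :
    nsq f = ∑ g ∈ Ω, f g ^ 2 :=
  tsum_eq_sum fun x hx => by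
    have : f x = 0 := by
      by_contra h0
      exact hx (Finset.mem_coe.1 (h h0))
    simp [this]

end FinSupp

section Energy

variable {G : Type*} [Group G]

/-- The squared `ℓ²` distance between `f` and its right translate by `y`. -/
def disp (f : G → ℝ) (y : G) : ℝ := ∑' x, (f (x * y) - f x) ^ 2

theorem FinSupp.translate {f : G → ℝ} (hf : FinSupp f) (y : G) :
    FinSupp fun x => f (x * y) :=
  (hf.preimage ((Equiv.mulRight y).injective.injOn)).subset fun _ hx => hx

theorem FinSupp.translate_left {f : G → ℝ} (hf : FinSupp f) (y : G) :
    FinSupp fun x => f (y * x) :=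
  (hf.preimage ((Equiv.mulLeft y).injective.injOn)).subset fun _ hx => hx

theorem tsum_translate (F : G → ℝ) (y : G) : ∑' x, F (x * y) = ∑' x, F x :=
  (Equiv.mulRight y).tsum_eq F

theorem tsum_translate_left (F : G → ℝ) (y : G) : ∑' x, F (y * x) = ∑' x, F x :=
  (Equiv.mulLeft y).tsum_eq F

theorem disp_nonneg (f : G → ℝ) (y : G) : 0 ≤ disp f y := tsum_nonneg fun _ => sq_nonneg _

theorem FinSupp.diff {f : G → ℝ} (hf : FinSupp f) (y : G) :
    FinSupp fun x => f (x * y) - f x :=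
  (Set.Finite.union (hf.translate y) hf).subset (Function.support_sub _ _)

theorem FinSupp.summable_disp {f : G → ℝ} (hf : FinSupp f) (y : G) :
    Summable fun x => (f (x * y) - f x) ^ 2 :=
  (hf.diff y).summable_sq

theorem nsq_translate (f : G → ℝ) (y : G) : nsq (fun x => f (x * y)) = nsq f :=
  tsum_translate (fun x => f x ^ 2) y

@[simp] theorem disp_one (f : G → ℝ) : disp f 1 = 0 := by simp [disp]

theorem disp_le_four {f : G → ℝ} (hf : FinSupp f) (y : G) : disp f y ≤ 4 * nsq f := by
  have h1 := (hf.translate y).summable_sq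
  have h2 := hf.summable_sq
  calc disp f y ≤ ∑' x, (2 * f (x * y) ^ 2 + 2 * f x ^ 2) :=
        (hf.summable_disp y).tsum_le_tsum
          (fun x => by nlinarith [sq_nonneg (f (x * y) + f x)])
          ((h1.mul_left 2).add (h2.mul_left 2))
    _ = 2 * nsq (fun x => f (x * y)) + 2 * nsq f := by
        rw [(h1.mul_left 2).tsum_add (h2.mul_left 2), tsum_mul_left, tsum_mul_left]; rfl
    _ = 4 * nsq f := by rw [nsq_translate]; ring

theorem disp_mul_le {f : G → ℝ} (hf : FinSupp f) (y z : G) {m : ℝ} (hm : 0 < m) :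
    disp f (y * z) ≤ (1 + m) * disp f y + (1 + 1 / m) * disp f z := by
  have h1 := hf.summable_disp y
  have h2 : Summable fun x => (f (x * y * z) - f (x * y)) ^ 2 :=
    ((hf.diff z).translate y).summable_sq
  have e2 : ∑' x, (f (x * y * z) - f (x * y)) ^ 2 = disp f z :=
    tsum_translate (fun x => (f (x * z) - f x) ^ 2) y
  calc disp f (y * z)
      ≤ ∑' x, ((1 + m) * (f (x * y) - f x) ^ 2
          + (1 + 1 / m) * (f (x * y * z) - f (x * y)) ^ 2) := by
        refine (hf.summable_disp _).tsum_le_tsum (fun x => ?_)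
          ((h1.mul_left _).add (h2.mul_left _))
        rw [← mul_assoc]
        set a := f (x * y) - f x
        set b := f (x * y * z) - f (x * y)
        have : f (x * y * z) - f x = a + b := by simp only [a, b]; ring
        rw [this]
        have h : (1 + m) * a ^ 2 + (1 + 1 / m) * b ^ 2 - (a + b) ^ 2 = (m * a - b) ^ 2 / m := by
          field_simp; ring
        have : 0 ≤ (m * a - b) ^ 2 / m := by positivity
        linarith
    _ = _ := by
        rw [(h1.mul_left _).tsum_add (h2.mul_left _), tsum_mul_left, tsum_mul_left, e2]; rfl

/-- Displacements grow at most quadratically along words. -/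
theorem disp_prod_le {f : G → ℝ} (hf : FinSupp f) {A : Set G} {D : ℝ}
    (hD : ∀ s ∈ A, disp f s ≤ D) (w : List G) (hw : ∀ s ∈ w, s ∈ A) :
    disp f w.prod ≤ (w.length : ℝ) ^ 2 * D := by
  induction w with
  | nil => simp
  | cons s w ih =>
    have ih := ih fun t ht => hw t (List.mem_cons_of_mem _ ht)
    have hs := hD s (hw s List.mem_cons_self)
    rcases Nat.eq_zero_or_pos w.length with h0 | h0
    · rw [List.length_eq_zero_iff] at h0
      simpa [h0] using hs
    · have hm : (0 : ℝ) < w.length := by exact_mod_cast h0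
      rw [List.prod_cons, List.length_cons]
      refine (disp_mul_le hf s w.prod hm).trans ?_
      push_cast
      have h1 : (1 + (w.length : ℝ)) * disp f s ≤ (1 + w.length) * D := by gcongr
      have h2 : (1 + 1 / (w.length : ℝ)) * disp f w.prod
          ≤ (1 + 1 / (w.length : ℝ)) * ((w.length : ℝ) ^ 2 * D) := by gcongr
      have h3 : (1 + 1 / (w.length : ℝ)) * ((w.length : ℝ) ^ 2 * D)
          = (w.length ^ 2 + w.length) * D := by field_simp
      nlinarith

/-- Half the average squared displacement: the Dirichlet form of a finitely supported function. -/
def energy (φ f : G → ℝ) : ℝ := 1 / 2 * ∑' y, φ y * disp f y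

theorem summable_mul_disp {φ f : G → ℝ} (hφ : ∀ g, 0 ≤ φ g) (hs : Summable φ) (hf : FinSupp f) :
    Summable fun y => φ y * disp f y :=
  Summable.of_nonneg_of_le (fun y => mul_nonneg (hφ y) (disp_nonneg f y))
    (fun y => mul_le_mul_of_nonneg_left (disp_le_four hf y) (hφ y)) (hs.mul_right (4 * nsq f))

theorem dirichlet_eq_energy {φ f : G → ℝ} (hφ : ∀ g, 0 ≤ φ g) (hs : Summable φ)
    (hf : FinSupp f) : dirichlet φ f f = energy φ f := by
  unfold dirichlet energy
  congr 1
  have h : ∑' p : G × G, (f (p.1 * p.2) - f p.1) * (f (p.1 * p.2) - f p.1) * φ p.2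
      = ∑' p : G × G, φ p.1 * (f (p.2 * p.1) - f p.2) ^ 2 := by
    refine ((Equiv.prodComm G G).tsum_eq _).symm.trans (tsum_congr fun p => ?_)
    simp only [Equiv.prodComm_apply, Prod.fst_swap, Prod.snd_swap]
    ring
  rw [h]
  have hsum : Summable fun p : G × G => φ p.1 * (f (p.2 * p.1) - f p.2) ^ 2 := by
    have h0 : 0 ≤ fun p : G × G => φ p.1 * (f (p.2 * p.1) - f p.2) ^ 2 :=
      fun p => mul_nonneg (hφ p.1) (sq_nonneg (f (p.2 * p.1) - f p.2))
    refine (summable_prod_of_nonneg h0).2 ⟨fun y => (hf.summable_disp y).mul_left (φ y), ?_⟩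
    refine (summable_mul_disp hφ hs hf).congr fun y => ?_
    exact tsum_mul_left.symm
  rw [hsum.tsum_prod]
  exact tsum_congr fun y => tsum_mul_left (a := φ y) (f := fun x => (f (x * y) - f x) ^ 2)

theorem dirichlet_nonneg {φ : G → ℝ} (hφ : ∀ g, 0 ≤ φ g) (f : G → ℝ) : 0 ≤ dirichlet φ f f :=
  mul_nonneg (by norm_num) (tsum_nonneg fun p => mul_nonneg (mul_self_nonneg _) (hφ _))

theorem energy_nonneg {φ : G → ℝ} (hφ : ∀ g, 0 ≤ φ g) (f : G → ℝ) : 0 ≤ energy φ f :=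
  mul_nonneg (by norm_num) (tsum_nonneg fun _ => mul_nonneg (hφ _) (disp_nonneg _ _))

theorem energy_le_two {φ f : G → ℝ} (hφ : IsSymmProb φ) (hf : FinSupp f) :
    energy φ f ≤ 2 * nsq f := by
  have h := (summable_mul_disp hφ.nonneg hφ.hasSum.summable hf).tsum_le_tsum
    (fun y => mul_le_mul_of_nonneg_left (disp_le_four hf y) (hφ.nonneg y))
    (hφ.hasSum.summable.mul_right (4 * nsq f))
  rw [tsum_mul_right, hφ.hasSum.tsum_eq] at h
  unfold energy
  linarith

theorem energy_mono {φ f g : G → ℝ} (hφ : ∀ g, 0 ≤ φ g) (hs : Summable φ) (hf : FinSupp f)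
    (hg : FinSupp g) (h : ∀ y, φ y ≠ 0 → disp g y ≤ disp f y) : energy φ g ≤ energy φ f := by
  refine mul_le_mul_of_nonneg_left ?_ (by norm_num)
  refine (summable_mul_disp hφ hs hg).tsum_le_tsum (fun y => ?_) (summable_mul_disp hφ hs hf)
  by_cases h0 : φ y = 0
  · simp [h0]
  · exact mul_le_mul_of_nonneg_left (h y h0) (hφ y)

/-- Normal contractions do not increase displacements. -/
theorem disp_contraction {f g : G → ℝ} (hf : FinSupp f) (hg : FinSupp g)
    (h : ∀ x y, |g x - g y| ≤ |f x - f y|) (y : G) : disp g y ≤ disp f y :=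
  (hg.summable_disp y).tsum_le_tsum (fun _ => sq_le_sq.2 (h _ _)) (hf.summable_disp y)

theorem energy_contraction {φ f g : G → ℝ} (hφ : ∀ g, 0 ≤ φ g) (hs : Summable φ)
    (hf : FinSupp f) (hg : FinSupp g) (h : ∀ x y, |g x - g y| ≤ |f x - f y|) :
    energy φ g ≤ energy φ f :=
  energy_mono hφ hs hf hg fun y _ => disp_contraction hf hg h y

theorem disp_smul (a : ℝ) (f : G → ℝ) (y : G) : disp (fun x => a * f x) y = a ^ 2 * disp f y := by
  unfold disp
  rw [← tsum_mul_left]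
  exact tsum_congr fun x => by ring

theorem energy_smul (a : ℝ) (φ f : G → ℝ) :
    energy φ (fun x => a * f x) = a ^ 2 * energy φ f := by
  unfold energy
  simp_rw [disp_smul]
  rw [show (fun y => φ y * (a ^ 2 * disp f y)) = fun y => a ^ 2 * (φ y * disp f y) by
    funext y; ring, tsum_mul_left]
  ring

/-- The profile bounds Rayleigh quotients from below. -/
theorem profile_mul_nsq_le {φ f : G → ℝ} (hφ : IsSymmProb φ) {v : ℝ}
    (hf : FinSupp f) (hv : (f.support.ncard : ℝ) ≤ v) :
    spectralProfile φ v * nsq f ≤ energy φ f := by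
  rcases (nsq_nonneg f).eq_or_lt with h0 | h0
  · rw [← h0, mul_zero]; exact energy_nonneg hφ.nonneg f
  set a := (Real.sqrt (nsq f))⁻¹ with ha
  have ha2 : a ^ 2 = (nsq f)⁻¹ := by rw [ha, inv_pow, Real.sq_sqrt h0.le]
  set Ω := hf.toFinset with hΩ
  have hsupp : Function.support f ⊆ (Ω : Set G) := by simp [hΩ]
  have hsupp' : Function.support (fun x => a * f x) ⊆ (Ω : Set G) := fun x hx =>
    hsupp fun h => hx (by simp [h])
  have hne : Ω.Nonempty := by
    rw [Finset.nonempty_iff_ne_empty]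
    intro h
    rw [nsq_eq_sum hsupp, h] at h0
    simp at h0
  have hlow : lowEig φ Ω ≤ energy φ f / nsq f := by
    refine csInf_le ⟨0, ?_⟩ ⟨fun x => a * f x, hsupp', ?_, ?_⟩
    · rintro x ⟨g, -, -, rfl⟩
      exact dirichlet_nonneg hφ.nonneg g
    · rw [← nsq_eq_sum hsupp', nsq_smul, ha2, inv_mul_cancel₀ h0.ne']
    · rw [dirichlet_eq_energy hφ.nonneg hφ.hasSum.summable
        (hf.of_zero fun x hx => by simp [hx]), energy_smul, ha2]
      field_simp
  have hprof : spectralProfile φ v ≤ lowEig φ Ω := by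
    refine csInf_le ⟨0, ?_⟩ ⟨Ω, hne, ?_, rfl⟩
    · rintro x ⟨Ω', -, -, rfl⟩
      refine Real.sInf_nonneg ?_
      rintro x ⟨g, -, -, rfl⟩
      exact dirichlet_nonneg hφ.nonneg g
    · rwa [hΩ, ← Set.ncard_eq_toFinset_card _ hf]
  rw [← le_div_iff₀ h0]
  exact hprof.trans hlow

/-- A lower bound for all Rayleigh quotients is a lower bound for the profile. -/
theorem le_profile {φ : G → ℝ} (hφ : IsSymmProb φ) {v a : ℝ} (hv : 1 ≤ v)
    (h : ∀ f : G → ℝ, FinSupp f → (f.support.ncard : ℝ) ≤ v → nsq f = 1 → a ≤ energy φ f) :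
    a ≤ spectralProfile φ v := by
  classical
  refine le_csInf ⟨_, {1}, by simp, by simp [hv], rfl⟩ ?_
  rintro x ⟨Ω, ⟨g₀, hg₀⟩, hcard, rfl⟩
  refine le_csInf ⟨_, Pi.single g₀ 1, ?_, ?_, rfl⟩ ?_
  · exact (Pi.support_single_subset).trans (by simpa using hg₀)
  · rw [Finset.sum_eq_single g₀]
    · simp
    · intro b _ hb; simp [hb]
    · exact fun h => absurd hg₀ h
  · rintro x ⟨f, hsupp, hnorm, rfl⟩
    have hf : FinSupp f := Ω.finite_toSet.subset hsupp
    rw [dirichlet_eq_energy hφ.nonneg hφ.hasSum.summable hf]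
    refine h f hf (le_trans ?_ hcard) (by rw [nsq_eq_sum hsupp, hnorm])
    have := Set.ncard_le_ncard hsupp Ω.finite_toSet
    rw [Set.ncard_coe_finset] at this
    exact_mod_cast this

theorem exists_energy_lt {φ : G → ℝ} (hφ : IsSymmProb φ) {v a : ℝ} (hv : 1 ≤ v)
    (h : spectralProfile φ v < a) :
    ∃ f : G → ℝ, FinSupp f ∧ (f.support.ncard : ℝ) ≤ v ∧ nsq f = 1 ∧ energy φ f < a := by
  by_contra! hcon
  exact absurd (le_profile hφ hv hcon) (not_le.2 h)

theorem profile_nonneg {φ : G → ℝ} (hφ : IsSymmProb φ) {v : ℝ} (hv : 1 ≤ v) :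
    0 ≤ spectralProfile φ v :=
  le_profile hφ hv fun f _ _ _ => energy_nonneg hφ.nonneg f

theorem profile_le_two {φ : G → ℝ} (hφ : IsSymmProb φ) {v : ℝ} (hv : 1 ≤ v) :
    spectralProfile φ v ≤ 2 := by
  classical
  have hsub : Function.support (Pi.single (1 : G) (1 : ℝ)) ⊆ ({1} : Set G) :=
    Pi.support_single_subset
  have hfin : FinSupp (Pi.single (1 : G) (1 : ℝ)) := (Set.finite_singleton _).subset hsub
  have hn : nsq (Pi.single (1 : G) (1 : ℝ)) = 1 := by
    rw [nsq_eq_sum (Ω := {1}) (by simp)]; simp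
  have h := profile_mul_nsq_le hφ (v := v) hfin (by
    refine le_trans ?_ hv
    have := Set.ncard_le_ncard hsub
    rw [Set.ncard_singleton] at this
    exact_mod_cast this)
  have := energy_le_two hφ hfin
  rw [hn] at h this
  linarith

/-- Comparison of energies gives comparison of profiles. -/
theorem profile_le_mul {φ φ' : G → ℝ} (hφ : IsSymmProb φ) (hφ' : IsSymmProb φ') {A v : ℝ}
    (hA : 0 < A) (hv : 1 ≤ v) (h : ∀ f : G → ℝ, FinSupp f → energy φ f ≤ A * energy φ' f) :
    spectralProfile φ v ≤ A * spectralProfile φ' v := by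
  rw [← div_le_iff₀' hA]
  refine le_profile hφ' hv fun f hf hv' hn => ?_
  rw [div_le_iff₀' hA]
  have := profile_mul_nsq_le hφ hf hv'
  rw [hn, mul_one] at this
  exact this.trans (h f hf)

theorem profile_antitone {φ : G → ℝ} (hφ : IsSymmProb φ) {v w : ℝ} (hv : 1 ≤ v) (hvw : v ≤ w) :
    spectralProfile φ w ≤ spectralProfile φ v :=
  le_profile hφ hv fun f hf hc hn => by
    simpa only [hn, mul_one] using profile_mul_nsq_le hφ hf (hc.trans hvw)

end Energy

/-! ### Functions that grow slower than powers -/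

section Moderate

/-- Non-decreasing functions `ρ : [0, ∞) → [1, ∞)` tending to infinity that are insensitive to
squaring the variable, up to a constant factor. -/
structure IsModerate (ρ : ℝ → ℝ) : Prop where
  monotoneOn : MonotoneOn ρ (Ici 0)
  one_le : ∀ t ∈ Ici (0 : ℝ), 1 ≤ ρ t
  sq_le : ∃ C : ℝ, ∀ t : ℝ, 0 ≤ t → ρ (t ^ 2) ≤ C * ρ t
  tendsto : Tendsto ρ atTop atTop

variable {ρ : ℝ → ℝ}

theorem IsModerate.pos (h : IsModerate ρ) {t : ℝ} (ht : 0 ≤ t) : 0 < ρ t :=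
  one_pos.trans_le (h.one_le t ht)

theorem IsModerate.mono (h : IsModerate ρ) {s t : ℝ} (hs : 0 ≤ s) (hst : s ≤ t) : ρ s ≤ ρ t :=
  h.monotoneOn hs (hs.trans hst) hst

theorem IsModerate.exists_sq_le (h : IsModerate ρ) :
    ∃ C : ℝ, 1 ≤ C ∧ ∀ t : ℝ, 0 ≤ t → ρ (t ^ 2) ≤ C * ρ t := by
  obtain ⟨C, hC⟩ := h.sq_le
  exact ⟨max 1 C, le_max_left _ _, fun t ht => (hC t ht).trans
    (mul_le_mul_of_nonneg_right (le_max_right _ _) (h.pos ht).le)⟩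

theorem IsModerate.mul_le (h : IsModerate ρ) {A : ℝ} (hA : 0 < A) :
    ∃ B : ℝ, 1 ≤ B ∧ ∀ t : ℝ, 0 ≤ t → ρ (A * t) ≤ B * ρ t := by
  obtain ⟨C, hC1, hC⟩ := h.exists_sq_le
  have hA2 : 0 ≤ A ^ 2 := by positivity
  refine ⟨max C (ρ (A ^ 2)), hC1.trans (le_max_left _ _), fun t ht => ?_⟩
  rcases le_total A t with hAt | hAt
  · calc ρ (A * t) ≤ ρ (t ^ 2) := h.mono (by positivity) (by nlinarith)
      _ ≤ C * ρ t := hC t ht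
      _ ≤ _ := mul_le_mul_of_nonneg_right (le_max_left _ _) (h.pos ht).le
  · calc ρ (A * t) ≤ ρ (A ^ 2) := h.mono (by positivity) (by nlinarith)
      _ ≤ ρ (A ^ 2) * ρ t := le_mul_of_one_le_right (h.pos hA2).le (h.one_le t ht)
      _ ≤ _ := mul_le_mul_of_nonneg_right (le_max_right _ _) (h.pos ht).le

theorem IsModerate.pow_four_le (h : IsModerate ρ) :
    ∃ C : ℝ, 1 ≤ C ∧ ∀ t : ℝ, 0 ≤ t → ρ (t ^ 4) ≤ C * ρ t := by
  obtain ⟨C, hC1, hC⟩ := h.exists_sq_le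
  refine ⟨C * C, one_le_mul_of_one_le_of_one_le hC1 hC1, fun t ht => ?_⟩
  have h1 := hC (t ^ 2) (by positivity)
  rw [← pow_mul] at h1
  have h2 := mul_le_mul_of_nonneg_left (hC t ht) (zero_le_one.trans hC1)
  rw [mul_assoc]
  exact h1.trans h2

/-- A function that is monotone and insensitive to squaring grows at most linearly. -/
theorem le_mul_self_of_sq_le {F : ℝ → ℝ} (hF : MonotoneOn F (Ici 1))
    (hpos : ∀ t, 1 ≤ t → 0 ≤ F t) {C : ℝ} (hC1 : 1 ≤ C)
    (hC : ∀ t, 1 ≤ t → F (t ^ 2) ≤ C * F t) :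
    ∃ A : ℝ, 0 ≤ A ∧ ∀ t, 1 ≤ t → F t ≤ A * t := by
  set B := (C + 1) ^ 2 with hB
  have hB1 : 1 ≤ B := by nlinarith
  have hB2 : 2 ≤ B := by nlinarith
  refine ⟨F B, hpos B hB1, fun t ht => ?_⟩
  have key : ∀ k : ℕ, ∀ t, 1 ≤ t → t ≤ B ^ 2 ^ k → F t ≤ F B * t := by
    intro k
    induction k with
    | zero =>
      intro t ht htB
      have := hF ht hB1 (by simpa using htB)
      nlinarith [hpos B hB1]
    | succ k ih =>
      intro t ht htB
      rcases le_total t B with h | h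
      · have := hF ht hB1 h
        nlinarith [hpos B hB1]
      have hs : Real.sqrt t ^ 2 = t := Real.sq_sqrt (by linarith)
      have hsC : C + 1 ≤ Real.sqrt t := Real.le_sqrt_of_sq_le h
      have h1 : 1 ≤ Real.sqrt t := by linarith
      have h2 : Real.sqrt t ≤ B ^ 2 ^ k := by
        refine Real.sqrt_le_iff.2 ⟨by positivity, htB.trans ?_⟩
        rw [pow_succ 2 k, pow_mul]
      have h3 := hC _ h1
      rw [hs] at h3
      have h4 := ih _ h1 h2
      calc F t ≤ C * F (Real.sqrt t) := h3
        _ ≤ C * (F B * Real.sqrt t) := by gcongr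
        _ = F B * (C * Real.sqrt t) := by ring
        _ ≤ F B * (Real.sqrt t * Real.sqrt t) := by
            gcongr
            · exact hpos B hB1
            · linarith
        _ = F B * t := by rw [← sq, hs]
  obtain ⟨k, hk⟩ := pow_unbounded_of_one_lt t (by linarith : 1 < B)
  exact key k t ht (hk.le.trans (pow_le_pow_right₀ hB1 (Nat.lt_two_pow_self).le))

/-- Values down to `1 / 2` are allowed because Rayleigh quotients are at most `2`. -/
theorem IsModerate.le_sqrt (h : IsModerate ρ) :
    ∃ C : ℝ, 0 < C ∧ ∀ t : ℝ, 1 / 2 ≤ t → ρ t ≤ C * Real.sqrt t := by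
  obtain ⟨C, hC1, hC⟩ := h.exists_sq_le
  obtain ⟨A, hA0, hA⟩ := le_mul_self_of_sq_le (F := ρ)
    (h.monotoneOn.mono (Ici_subset_Ici.2 zero_le_one)) (fun t ht => (h.pos (by linarith)).le) hC1
    (fun t ht => hC t (by linarith))
  have hr1 := h.pos (zero_le_one (α := ℝ))
  refine ⟨C * A + 2 * ρ 1, by positivity, fun t ht => ?_⟩
  have hs0 := Real.sqrt_nonneg t
  have hs2 : Real.sqrt t ^ 2 = t := Real.sq_sqrt (by linarith)
  rcases le_total 1 t with h1 | h1
  · have hs1 : 1 ≤ Real.sqrt t := Real.one_le_sqrt.2 h1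
    have h3 := hC _ hs0
    rw [hs2] at h3
    have h4 : C * ρ (Real.sqrt t) ≤ C * (A * Real.sqrt t) := by
      gcongr; exact hA _ hs1
    nlinarith
  · have h2 : ρ t ≤ ρ 1 := h.mono (by linarith) h1
    have hs1 : 1 / 2 ≤ Real.sqrt t := Real.le_sqrt_of_sq_le (by linarith)
    have : 0 ≤ C * A := by positivity
    nlinarith [mul_nonneg this hs0]

theorem recipAt_of_pos {x : ℝ} (hx : 0 < x) : recipAt ρ x = 1 / ρ (1 / x) := by
  simp [recipAt, hx.ne']

theorem IsModerate.recipAt_nonneg (h : IsModerate ρ) {x : ℝ} (hx : 0 ≤ x) :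
    0 ≤ recipAt ρ x := by
  unfold recipAt
  split_ifs
  · exact le_rfl
  · exact one_div_nonneg.2 (h.pos (by positivity)).le

theorem IsModerate.recipAt_le_one (h : IsModerate ρ) {x : ℝ} (hx : 0 ≤ x) :
    recipAt ρ x ≤ 1 := by
  unfold recipAt
  split_ifs
  · exact zero_le_one
  · exact div_le_one_of_le₀ (h.one_le _ (show 0 ≤ 1 / x by positivity))
      (h.pos (by positivity)).le

theorem IsModerate.recipAt_mono (h : IsModerate ρ) {x y : ℝ} (hx : 0 ≤ x) (hxy : x ≤ y) :
    recipAt ρ x ≤ recipAt ρ y := by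
  rcases hx.eq_or_lt with rfl | hx
  · simpa [recipAt] using h.recipAt_nonneg hxy
  rw [recipAt_of_pos hx, recipAt_of_pos (hx.trans_le hxy)]
  have : 0 < y := hx.trans_le hxy
  exact one_div_le_one_div_of_le (h.pos (by positivity))
    (h.mono (by positivity) (one_div_le_one_div_of_le hx hxy))

theorem IsModerate.recipAt_mul_le (h : IsModerate ρ) {A : ℝ} (hA : 0 < A) :
    ∃ B : ℝ, 1 ≤ B ∧ ∀ x : ℝ, 0 ≤ x → recipAt ρ (A * x) ≤ B * recipAt ρ x := by
  obtain ⟨B, hB1, hB⟩ := h.mul_le hA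
  refine ⟨B, hB1, fun x hx => ?_⟩
  rcases hx.eq_or_lt with rfl | hx
  · simp [recipAt]
  have hy : 0 ≤ 1 / (A * x) := by positivity
  have hh := hB (1 / (A * x)) hy
  rw [show A * (1 / (A * x)) = 1 / x by field_simp] at hh
  rw [recipAt_of_pos hx, recipAt_of_pos (by positivity), ← mul_div_assoc, mul_one,
    div_le_div_iff₀ (h.pos hy) (h.pos (by positivity)), one_mul]
  exact hh

theorem IsModerate.tendsto_recip (h : IsModerate ρ) :
    Tendsto (fun x => 1 / ρ (1 / x)) (𝓝[>] 0) (𝓝 0) := by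
  have h1 : Tendsto (fun x : ℝ => 1 / x) (𝓝[>] 0) atTop := by
    simpa using tendsto_inv_nhdsGT_zero (𝕜 := ℝ)
  refine (h.tendsto.comp h1).inv_tendsto_atTop.congr fun x => ?_
  simp

end Moderate

/-! ### Word length and comparison of Dirichlet forms -/

section Comparison

variable {G : Type*} [Group G] {k : ℕ} {S : Fin k → G}

theorem symSet_finite (S : Fin k → G) : (symSet S).Finite :=
  ((finite_singleton _).union (finite_range _)).union (finite_range _)

theorem one_mem_symSet (S : Fin k → G) : (1 : G) ∈ symSet S := Or.inl (Or.inl rfl)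

theorem inv_mem_symSet {s : G} (hs : s ∈ symSet S) : s⁻¹ ∈ symSet S := by
  rcases hs with (hs | ⟨i, rfl⟩) | ⟨i, rfl⟩
  · rw [mem_singleton_iff.1 hs, inv_one]; exact one_mem_symSet S
  · exact Or.inr ⟨i, rfl⟩
  · exact Or.inl (Or.inr ⟨i, by simp⟩)

theorem symSet_ncard_pos (S : Fin k → G) : 0 < (symSet S).ncard :=
  (Set.ncard_pos (symSet_finite S)).2 ⟨1, one_mem_symSet S⟩

theorem unif_of_mem {s : G} (hs : s ∈ symSet S) : unif S s = 1 / ((symSet S).ncard : ℝ) :=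
  indicator_of_mem hs _

theorem unif_of_notMem {s : G} (hs : s ∉ symSet S) : unif S s = 0 :=
  indicator_of_notMem hs _

theorem tsum_unif_mul (S : Fin k → G) (F : G → ℝ) :
    ∑' g, unif S g * F g
      = (∑ s ∈ (symSet_finite S).toFinset, F s) / ((symSet S).ncard : ℝ) := by
  rw [tsum_eq_sum (s := (symSet_finite S).toFinset), Finset.sum_div]
  · refine Finset.sum_congr rfl fun s hs => ?_
    rw [unif_of_mem (by simpa using hs)]; ring
  · intro s hs
    rw [unif_of_notMem (by simpa using hs), zero_mul]

theorem isSymmProb_unif (S : Fin k → G) : IsSymmProb (unif S) where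
  nonneg g := indicator_nonneg (fun _ _ => by positivity) g
  hasSum := by
    have hs : Summable (unif S) := FinSupp.summable
      ((symSet_finite S).subset fun g hg => by
        by_contra h; exact hg (unif_of_notMem h))
    have h := tsum_unif_mul S fun _ => (1 : ℝ)
    simp only [mul_one, Finset.sum_const, nsmul_eq_mul] at h
    rw [← Set.ncard_eq_toFinset_card _ (symSet_finite S),
      div_self (by exact_mod_cast (symSet_ncard_pos S).ne')] at h
    exact h ▸ hs.hasSum
  symm g := by
    by_cases h : g ∈ symSet S
    · rw [unif_of_mem h, unif_of_mem (inv_mem_symSet h)]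
    · rw [unif_of_notMem h, unif_of_notMem fun h' => h (by simpa using inv_mem_symSet h')]

theorem mul_disp_le_energy {φ f : G → ℝ} (hφ : IsSymmProb φ) (hf : FinSupp f) (y : G) :
    φ y * disp f y ≤ 2 * energy φ f := by
  have := (summable_mul_disp hφ.nonneg hφ.hasSum.summable hf).le_tsum y
    fun z _ => mul_nonneg (hφ.nonneg z) (disp_nonneg f z)
  unfold energy
  linarith

theorem disp_le_energy_unif {f : G → ℝ} (hf : FinSupp f) {s : G} (hs : s ∈ symSet S) :
    disp f s ≤ 2 * (symSet S).ncard * energy (unif S) f := by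
  have h := mul_disp_le_energy (isSymmProb_unif S) hf s
  have hn : (0 : ℝ) < (symSet S).ncard := by exact_mod_cast symSet_ncard_pos S
  rw [unif_of_mem hs, div_mul_eq_mul_div, one_mul, div_le_iff₀ hn] at h
  linarith

/-- In a group generated by a symmetric set, every element is a product of elements of the set. -/
theorem exists_word {A : Set G} (hA : ∀ a ∈ A, a⁻¹ ∈ A) (hgen : Subgroup.closure A = ⊤) (g : G) :
    ∃ w : List G, (∀ σ ∈ w, σ ∈ A) ∧ w.prod = g := by
  have hg : g ∈ Subgroup.closure A := hgen ▸ Subgroup.mem_top g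
  rw [← Subgroup.mem_toSubmonoid, Subgroup.closure_toSubmonoid] at hg
  have : A ∪ A⁻¹ = A := union_eq_left.2 fun a ha => by
    simpa using hA _ (Set.mem_inv.1 ha)
  rw [this] at hg
  exact Submonoid.exists_list_of_mem_closure hg

theorem closure_symSet (hS : Generates S) : Subgroup.closure (symSet S) = ⊤ :=
  top_le_iff.1 (hS ▸ Subgroup.closure_mono fun _ hx => Or.inl (Or.inr hx))

theorem exists_word_wordLength (hS : Generates S) (g : G) :
    ∃ w : List G, w.length = wordLength S g ∧ (∀ σ ∈ w, σ ∈ symSet S) ∧ w.prod = g := by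
  have hne : {m : ℕ | ∃ w : List G, w.length = m ∧ (∀ σ ∈ w, σ ∈ symSet S) ∧ w.prod = g}.Nonempty :=
    let ⟨w, hw, hp⟩ := exists_word (fun _ => inv_mem_symSet) (closure_symSet hS) g
    ⟨w.length, w, rfl, hw, hp⟩
  exact Nat.sInf_mem hne

theorem wordLength_le {g : G} {w : List G} (hw : ∀ σ ∈ w, σ ∈ symSet S) (hp : w.prod = g) :
    wordLength S g ≤ w.length :=
  Nat.sInf_le ⟨w, rfl, hw, hp⟩

theorem disp_le_wordLength (hS : Generates S) {f : G → ℝ} (hf : FinSupp f) (g : G) :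
    disp f g ≤ (wordLength S g : ℝ) ^ 2 * (2 * (symSet S).ncard * energy (unif S) f) := by
  obtain ⟨w, hl, hw, rfl⟩ := exists_word_wordLength hS g
  rw [← hl]
  exact disp_prod_le hf (fun s hs => disp_le_energy_unif hf hs) w hw

/-- Two symmetric probability measures, the first finitely supported and the second with finite
generating support, have comparable energies. -/
theorem energy_le_mul_energy {φ μ : G → ℝ} (hφ : IsSymmProb φ) (hφs : FinSupp φ)
    (hμ : IsSymmProb μ) (hμs : FinSupp μ) (hgen : Subgroup.closure (Function.support μ) = ⊤) :
    ∃ A : ℝ, 0 < A ∧ ∀ f : G → ℝ, FinSupp f → energy φ f ≤ A * energy μ f := by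
  have hword := exists_word (A := Function.support μ)
    (fun a ha => by simpa [Function.mem_support, hμ.symm] using ha) hgen
  choose w hw hwp using hword
  set B := ∑ s ∈ hμs.toFinset, 2 / μ s with hB
  have hB0 : 0 ≤ B := Finset.sum_nonneg fun s _ => div_nonneg zero_le_two (hμ.nonneg s)
  have hdisp : ∀ f : G → ℝ, FinSupp f → ∀ s ∈ Function.support μ, disp f s ≤ B * energy μ f := by
    intro f hf s hs
    have hpos : 0 < μ s := lt_of_le_of_ne (hμ.nonneg s) (Ne.symm hs)
    have h1 := mul_disp_le_energy hμ hf s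
    have h2 : 2 / μ s ≤ B := Finset.single_le_sum
      (f := fun s => 2 / μ s) (fun s _ => div_nonneg zero_le_two (hμ.nonneg s)) (by simpa using hs)
    calc disp f s ≤ 2 / μ s * energy μ f := by
          rw [div_mul_eq_mul_div, le_div_iff₀ hpos]; linarith
      _ ≤ _ := mul_le_mul_of_nonneg_right h2 (energy_nonneg hμ.nonneg f)
  set D := ∑ y ∈ hφs.toFinset, φ y * ((w y).length : ℝ) ^ 2 with hD
  have hD0 : 0 ≤ D := Finset.sum_nonneg fun y _ => mul_nonneg (hφ.nonneg y) (by positivity)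
  refine ⟨1 / 2 * (D * B) + 1, by positivity, fun f hf => ?_⟩
  have hE := energy_nonneg hμ.nonneg f
  have : ∑' y, φ y * disp f y ≤ D * (B * energy μ f) := by
    rw [tsum_eq_sum (s := hφs.toFinset) fun y hy => by
      have : φ y = 0 := by simpa using hy
      rw [this, zero_mul], hD, Finset.sum_mul]
    refine Finset.sum_le_sum fun y _ => ?_
    rw [mul_assoc]
    refine mul_le_mul_of_nonneg_left ?_ (hφ.nonneg y)
    have := disp_prod_le hf (hdisp f hf) (w y) (hw y)
    rwa [hwp] at this
  unfold energy at this ⊢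
  unfold energy at hE
  nlinarith

end Comparison

/-! ### Weak moments and the upper bound for the profile -/

section Upper

variable {G : Type*} [Group G] {k : ℕ} {S : Fin k → G} {ρ : ℝ → ℝ}

/-- The mass that `φ` gives to `{g : ρ(|g|) > s}`. -/
def tailMass (S : Fin k → G) (ρ : ℝ → ℝ) (φ : G → ℝ) (s : ℝ) : ℝ :=
  ∑' g, indicator {g | s < ρ (wordLength S g)} φ g

theorem weakMoment_term {φ : G → ℝ} (hφ : IsSymmProb φ) {s : ℝ} (hs : 0 < s) :
    ENNReal.ofReal s * ∑' g : {g : G // s < ρ (wordLength S g)}, ENNReal.ofReal (φ g)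
      = ENNReal.ofReal (s * tailMass S ρ φ s) := by
  have h1 : ∑' g : {g : G // s < ρ (wordLength S g)}, ENNReal.ofReal (φ g)
      = ∑' g, indicator {g | s < ρ (wordLength S g)} (fun g => ENNReal.ofReal (φ g)) g :=
    tsum_subtype {g | s < ρ (wordLength S g)} fun g => ENNReal.ofReal (φ g)
  rw [h1, ENNReal.ofReal_mul hs.le, tailMass, ENNReal.ofReal_tsum_of_nonneg
    (fun g => indicator_nonneg (fun g _ => hφ.nonneg g) g) (hφ.hasSum.summable.indicator _)]
  congr 1
  refine tsum_congr fun g => ?_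
  by_cases hg : g ∈ {g | s < ρ (wordLength S g)}
  · simp [indicator_of_mem hg]
  · simp [indicator_of_notMem hg]

theorem weakMoment_le {φ : G → ℝ} (hφ : IsSymmProb φ) {K : ℝ}
    (h : ∀ s, 0 < s → s * tailMass S ρ φ s ≤ K) : weakMoment S ρ φ ≤ ENNReal.ofReal K :=
  iSup₂_le fun s hs => by
    rw [weakMoment_term hφ hs]
    exact ENNReal.ofReal_le_ofReal (h s hs)

theorem ofReal_tailMass_le {φ : G → ℝ} (hφ : IsSymmProb φ) {K : ℝ}
    (h : weakMoment S ρ φ ≤ ENNReal.ofReal K) {s : ℝ} (hs : 0 < s) :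
    ENNReal.ofReal (s * tailMass S ρ φ s) ≤ ENNReal.ofReal K := by
  rw [← weakMoment_term hφ hs]
  exact (le_iSup₂ (f := fun (s : ℝ) (_ : 0 < s) => ENNReal.ofReal s *
    ∑' g : {g : G // s < ρ (wordLength S g)}, ENNReal.ofReal (φ g)) s hs).trans h

/-- As `ρ ≥ 1`, the weak moment of a probability measure is at least `1`, so that bounds for it are
not affected by the truncation in `ENNReal.ofReal`. -/
theorem half_le_of_weakMoment_le (hρ : IsModerate ρ) {φ : G → ℝ} (hφ : IsSymmProb φ) {K : ℝ}
    (h : weakMoment S ρ φ ≤ ENNReal.ofReal K) : 1 / 2 ≤ K := by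
  have h1 := ofReal_tailMass_le hφ h (show (0 : ℝ) < 1 / 2 by norm_num)
  have h2 : tailMass S ρ φ (1 / 2) = 1 := by
    refine (tsum_congr fun g => indicator_of_mem ?_ _).trans hφ.hasSum.tsum_eq
    have := hρ.one_le (wordLength S g) (show (0 : ℝ) ≤ wordLength S g by positivity)
    show 1 / 2 < ρ (wordLength S g)
    linarith
  rw [h2, mul_one] at h1
  by_contra hK
  exact absurd h1 (not_le.2 ((ENNReal.ofReal_lt_ofReal_iff (by norm_num)).2 (not_le.1 hK)))

theorem mul_tailMass_le (hρ : IsModerate ρ) {φ : G → ℝ} (hφ : IsSymmProb φ) {K : ℝ}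
    (h : weakMoment S ρ φ ≤ ENNReal.ofReal K) {s : ℝ} (hs : 0 < s) :
    s * tailMass S ρ φ s ≤ K :=
  (ENNReal.ofReal_le_ofReal_iff
    (by linarith [half_le_of_weakMoment_le hρ hφ h])).1 (ofReal_tailMass_le hφ h hs)

/-- A measure with finite weak moment has small energy on functions with small energy: jumps of
length at most `λ ^ (-1/4)` are controlled by the energy `λ` of the simple random walk, and longer
jumps are rare. -/
theorem energy_le_of_weakMoment (hρ : IsModerate ρ) (n : ℕ) :
    ∃ C : ℝ, 0 < C ∧ ∀ (k : ℕ) (S : Fin k → G), Generates S → (symSet S).ncard = n →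
      ∀ (φ : G → ℝ) (K : ℝ), IsSymmProb φ → weakMoment S ρ φ ≤ ENNReal.ofReal K →
        ∀ f : G → ℝ, FinSupp f → nsq f = 1 → ∀ x : ℝ, 0 < x → x ≤ 2 → energy (unif S) f ≤ x →
          energy φ f ≤ C * K * (1 / ρ (1 / x)) := by
  obtain ⟨C₁, hC₁, hsqrt⟩ := hρ.le_sqrt
  obtain ⟨C₂, hC₂, hfour⟩ := hρ.pow_four_le
  refine ⟨2 * n * C₁ + 4 * C₂, by positivity, ?_⟩
  intro k S hS hn φ K hφ hW f hf hf1 x hx hx2 hE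
  have hK := half_le_of_weakMoment_le hρ hφ hW
  set r := Real.sqrt (Real.sqrt (1 / x)) with hr
  have hx' : 0 < 1 / x := by positivity
  have hr0 : 0 < r := Real.sqrt_pos.2 (Real.sqrt_pos.2 hx')
  have hr2 : r ^ 2 = Real.sqrt (1 / x) := Real.sq_sqrt (Real.sqrt_nonneg _)
  have hr4 : r ^ 4 = 1 / x := by
    rw [show r ^ 4 = (r ^ 2) ^ 2 by ring, hr2, Real.sq_sqrt hx'.le]
  have hρr := hρ.pos hr0.le
  have hρx := hρ.pos hx'.le
  -- the mass of the long jumps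
  set A : Set G := {g | ρ r / 2 < ρ (wordLength S g)} with hA
  have htail : tailMass S ρ φ (ρ r / 2) ≤ 2 * K / ρ r := by
    have := mul_tailMass_le hρ hφ hW (half_pos hρr)
    rw [le_div_iff₀ hρr]
    linarith
  have hbound : ∀ y, φ y * disp f y
      ≤ 2 * n * (r ^ 2 * x) * φ y + 4 * A.indicator φ y := by
    intro y
    have hφy := hφ.nonneg y
    rcases le_or_gt (wordLength S y : ℝ) r with hy | hy
    · have h1 := disp_le_wordLength hS hf y
      have h2 : disp f y ≤ 2 * n * (r ^ 2 * x) := by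
        refine h1.trans ?_
        rw [hn]
        have : (wordLength S y : ℝ) ^ 2 ≤ r ^ 2 := by gcongr
        calc (wordLength S y : ℝ) ^ 2 * (2 * n * energy (unif S) f)
            ≤ r ^ 2 * (2 * n * x) := by
              gcongr
              exact mul_nonneg (by positivity) (energy_nonneg (isSymmProb_unif S).nonneg f)
          _ = _ := by ring
      have h3 : 0 ≤ A.indicator φ y := indicator_nonneg (fun g _ => hφ.nonneg g) y
      nlinarith
    · have hyA : y ∈ A := by
        have := hρ.mono hr0.le hy.le
        show ρ r / 2 < ρ (wordLength S y)
        linarith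
      have h1 := disp_le_four hf y
      rw [hf1] at h1
      rw [indicator_of_mem hyA]
      have : 0 ≤ 2 * n * (r ^ 2 * x) * φ y := by positivity
      nlinarith
  have hs1 := hφ.hasSum.summable.mul_left (2 * n * (r ^ 2 * x))
  have hs2 := (hφ.hasSum.summable.indicator A).mul_left 4
  have hsum := (summable_mul_disp hφ.nonneg hφ.hasSum.summable hf).tsum_le_tsum hbound
    (hs1.add hs2)
  rw [hs1.tsum_add hs2, tsum_mul_left, tsum_mul_left, hφ.hasSum.tsum_eq, mul_one] at hsum
  have htail' : ∑' y, A.indicator φ y ≤ 2 * K / ρ r := htail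
  -- both terms in units of `1 / ρ (1 / x)`
  have e1 : r ^ 2 * x ≤ C₁ * (1 / ρ (1 / x)) := by
    have h1 := hsqrt (1 / x) (by rw [div_le_div_iff₀ two_pos hx]; linarith)
    rw [← hr2] at h1
    have h2 : r ^ 2 * x * r ^ 2 = 1 := by
      rw [show r ^ 2 * x * r ^ 2 = r ^ 4 * x by ring, hr4]; field_simp
    have h3 : 0 < r ^ 2 * x := by positivity
    rw [mul_one_div, le_div_iff₀ hρx]
    nlinarith
  have e2 : 1 / ρ r ≤ C₂ * (1 / ρ (1 / x)) := by
    have h1 := hfour r hr0.le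
    rw [hr4] at h1
    rw [mul_one_div, div_le_div_iff₀ hρr hρx]
    linarith
  have hu : 0 < 1 / ρ (1 / x) := by positivity
  unfold energy
  set u := 1 / ρ (1 / x)
  have e3 : n * (r ^ 2 * x) ≤ n * (C₁ * u) := by gcongr
  have e4 : 2 * K / ρ r ≤ 2 * K * (C₂ * u) := by
    rw [div_eq_mul_one_div]
    exact mul_le_mul_of_nonneg_left e2 (by linarith)
  have e5 : n * (C₁ * u) ≤ 2 * K * (n * (C₁ * u)) :=
    le_mul_of_one_le_left (by positivity) (by linarith)
  nlinarith

/-- The profile of a measure with finite weak moment is at most of order `1 / ρ(1/Λ)`. -/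
theorem profile_le_of_weakMoment (hρ : IsModerate ρ) (n : ℕ) :
    ∃ C : ℝ, 0 < C ∧ ∀ (k : ℕ) (S : Fin k → G), Generates S → (symSet S).ncard = n →
      ∀ (φ : G → ℝ) (K : ℝ), IsSymmProb φ → weakMoment S ρ φ ≤ ENNReal.ofReal K →
        ∀ v : ℝ, 1 ≤ v →
          spectralProfile φ v ≤ C * K * recipAt ρ (spectralProfile (unif S) v) := by
  obtain ⟨C, hC, hmain⟩ := energy_le_of_weakMoment (G := G) hρ n
  obtain ⟨B, hB1, hB⟩ := hρ.mul_le two_pos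
  refine ⟨C * (B * B), by positivity, ?_⟩
  intro k S hS hn φ K hφ hW v hv
  have hK := half_le_of_weakMoment_le hρ hφ hW
  have hu := isSymmProb_unif S
  have hL0 := profile_nonneg hu hv
  have hL2 := profile_le_two hu hv
  set L := spectralProfile (unif S) v with hL
  have key : ∀ x, L < x → x ≤ 4 → spectralProfile φ v ≤ C * K * (B * (1 / ρ (1 / x))) := by
    intro x hLx hx4
    obtain ⟨f, hf, hfv, hf1, hfE⟩ := exists_energy_lt hu hv hLx
    have hx : 0 < x := hL0.trans_lt hLx
    have hm : 0 < min x 2 := lt_min hx two_pos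
    have h1 := hmain k S hS hn φ K hφ hW f hf hf1 (min x 2) hm (min_le_right _ _)
      (le_min hfE.le ((energy_le_two hu hf).trans (by rw [hf1, mul_one])))
    have h2 := profile_mul_nsq_le hφ hf hfv
    rw [hf1, mul_one] at h2
    refine h2.trans (h1.trans ?_)
    have h3 : ρ (1 / x) ≤ ρ (1 / min x 2) :=
      hρ.mono (by positivity) (one_div_le_one_div_of_le hm (min_le_left _ _))
    have h4 : 1 / ρ (1 / min x 2) ≤ 1 / ρ (1 / x) :=
      one_div_le_one_div_of_le (hρ.pos (by positivity)) h3
    have h5 : 1 / ρ (1 / x) ≤ B * (1 / ρ (1 / x)) :=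
      le_mul_of_one_le_left (one_div_nonneg.2 (hρ.pos (by positivity)).le) hB1
    have : 0 ≤ C * K := mul_nonneg hC.le (by linarith)
    exact mul_le_mul_of_nonneg_left (h4.trans h5) this
  rcases hL0.eq_or_lt with h0 | h0
  · -- the bound holds for all `x > 0`, and its right-hand side tends to `0` with `x`
    rw [← h0]
    simp only [recipAt, if_true, mul_zero]
    have ht : Tendsto (fun x => C * K * (B * (1 / ρ (1 / x)))) (𝓝[>] 0)
        (𝓝 (C * K * (B * 0))) := (hρ.tendsto_recip.const_mul B).const_mul (C * K)
    rw [mul_zero, mul_zero] at ht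
    refine ge_of_tendsto ht ?_
    filter_upwards [Ioo_mem_nhdsGT (show (0 : ℝ) < 4 by norm_num)] with x hx
    exact key x (h0 ▸ hx.1) hx.2.le
  · rw [recipAt_of_pos h0]
    refine (key (2 * L) (by linarith) (by linarith)).trans ?_
    have h1 := hB (1 / (2 * L)) (by positivity)
    rw [show 2 * (1 / (2 * L)) = 1 / L by field_simp] at h1
    have hp1 := hρ.pos (show 0 ≤ 1 / L by positivity)
    have hp2 := hρ.pos (show 0 ≤ 1 / (2 * L) by positivity)
    have h2 : 1 / ρ (1 / (2 * L)) ≤ B * (1 / ρ (1 / L)) := by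
      rw [mul_one_div, div_le_div_iff₀ hp2 hp1]; linarith
    have h3 : 0 ≤ C * K * B := mul_nonneg (mul_nonneg hC.le (by linarith)) (by linarith)
    calc C * K * (B * (1 / ρ (1 / (2 * L)))) = C * K * B * (1 / ρ (1 / (2 * L))) := by ring
      _ ≤ C * K * B * (B * (1 / ρ (1 / L))) := mul_le_mul_of_nonneg_left h2 h3
      _ = _ := by ring

end Upper

/-! ### The simple random walk operator and its powers -/

section FinSupp

variable {α : Type*}

/-- The `ℓ²` inner product. -/
def ip (f g : α → ℝ) : ℝ := ∑' x, f x * g x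

theorem two_ip_le {f g : α → ℝ} (hf : FinSupp f) (hg : FinSupp g) :
    2 * ip f g ≤ nsq f + nsq g := by
  unfold ip nsq
  rw [← tsum_mul_left, ← hf.summable_sq.tsum_add hg.summable_sq]
  refine Summable.tsum_le_tsum (fun x => by nlinarith [sq_nonneg (f x - g x)]) ?_
    (hf.summable_sq.add hg.summable_sq)
  exact hf.summable_of_zero fun x hx => by simp [hx]

/-- The excess `(f - τ)₊` over a level. -/
def excess (f : α → ℝ) (τ : ℝ) : α → ℝ := fun x => max (f x - τ) 0

theorem FinSupp.excess {f : α → ℝ} (hf : FinSupp f) {τ : ℝ} (hτ : 0 ≤ τ) :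
    FinSupp (excess f τ) :=
  hf.of_zero fun x hx => by simp [Profile.excess, hx, hτ]

theorem ncard_support_excess_le {f : α → ℝ} (hf : FinSupp f) (hf0 : ∀ x, 0 ≤ f x) {τ : ℝ}
    (hτ : 0 < τ) {p : ℕ} (hp : p ≠ 0) :
    ((excess f τ).support.ncard : ℝ) * τ ^ p ≤ ∑' x, f x ^ p := by
  have hfin := hf.excess hτ.le
  rw [Set.ncard_eq_toFinset_card _ hfin, ← nsmul_eq_mul, ← Finset.sum_const]
  have hs : Summable fun x => f x ^ p := hf.summable_of_zero fun x hx => by simp [hx, hp]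
  refine le_trans (Finset.sum_le_sum fun x hx => ?_)
    (hs.sum_le_tsum hfin.toFinset fun x _ => pow_nonneg (hf0 x) p)
  have : excess f τ x ≠ 0 := by simpa using hx
  have h : τ ≤ f x := by
    by_contra! hlt
    exact this (max_eq_right (by linarith))
  gcongr

end FinSupp

section Walk

variable {G : Type*} [Group G] {k : ℕ} {S : Fin k → G}

/-- The generating set `S*` as a `Finset`. -/
def symFinset (S : Fin k → G) : Finset G := (symSet_finite S).toFinset

@[simp] theorem mem_symFinset {s : G} : s ∈ symFinset S ↔ s ∈ symSet S := by simp [symFinset]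

theorem card_symFinset (S : Fin k → G) : (symFinset S).card = (symSet S).ncard :=
  (Set.ncard_eq_toFinset_card _ (symSet_finite S)).symm

theorem card_symFinset_pos (S : Fin k → G) : (0 : ℝ) < (symFinset S).card := by
  rw [card_symFinset]; exact_mod_cast symSet_ncard_pos S

theorem one_le_card_symFinset (S : Fin k → G) : (1 : ℝ) ≤ (symFinset S).card := by
  rw [card_symFinset]; exact_mod_cast symSet_ncard_pos S

theorem sum_symFinset_inv (F : G → ℝ) : ∑ s ∈ symFinset S, F s⁻¹ = ∑ s ∈ symFinset S, F s :=
  Finset.sum_nbij' (·⁻¹) (·⁻¹) (by simpa using fun s => inv_mem_symSet)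
    (by simpa using fun s => inv_mem_symSet) (by simp) (by simp) (by simp)

/-- The operator of averaging over a right translate by a uniform element of `S*`. -/
def walk (S : Fin k → G) (f : G → ℝ) : G → ℝ :=
  fun x => (∑ s ∈ symFinset S, f (x * s)) / (symFinset S).card

theorem conv_unif (S : Fin k → G) (f : G → ℝ) : conv f (unif S) = walk S f := by
  funext x
  unfold conv walk
  rw [← tsum_translate_left (fun y => f y * unif S (y⁻¹ * x)) x, card_symFinset]
  refine Eq.trans (tsum_congr fun z => ?_) (tsum_unif_mul S fun z => f (x * z))
  rw [mul_inv_rev, inv_mul_cancel_right, (isSymmProb_unif S).symm, mul_comm]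

/-- The point mass at the identity. -/
def delta : G → ℝ := ({1} : Set G).indicator fun _ => 1

theorem convPow_unif (S : Fin k → G) (m : ℕ) : convPow (unif S) m = (walk S)^[m] delta := by
  induction m with
  | zero => rfl
  | succ m ih => rw [Function.iterate_succ_apply', ← ih, ← conv_unif]; rfl

theorem FinSupp.walk {f : G → ℝ} (hf : FinSupp f) : FinSupp (walk S f) := by
  refine (((symFinset S).finite_toSet.biUnion fun s _ => hf.translate s)).subset fun x hx => ?_
  by_contra h
  simp only [Finset.mem_coe, mem_iUnion, Function.mem_support, not_exists, not_not] at h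
  exact hx (by simp [Profile.walk, Finset.sum_eq_zero h])

theorem FinSupp.walk_iterate {f : G → ℝ} (hf : FinSupp f) (m : ℕ) :
    FinSupp ((Profile.walk S)^[m] f) := by
  induction m with
  | zero => exact hf
  | succ m ih => rw [Function.iterate_succ_apply']; exact ih.walk

theorem finSupp_delta : FinSupp (delta : G → ℝ) :=
  (finite_singleton 1).subset fun x hx => by
    by_contra h; exact hx (indicator_of_notMem h _)

theorem walk_nonneg {f : G → ℝ} (hf : ∀ x, 0 ≤ f x) (x : G) : 0 ≤ walk S f x :=
  div_nonneg (Finset.sum_nonneg fun _ _ => hf _) (Nat.cast_nonneg _)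

theorem walk_iterate_nonneg {f : G → ℝ} (hf : ∀ x, 0 ≤ f x) (m : ℕ) (x : G) :
    0 ≤ (walk S)^[m] f x := by
  induction m generalizing x with
  | zero => exact hf x
  | succ m ih => rw [Function.iterate_succ_apply']; exact walk_nonneg ih x

theorem walk_mono {f g : G → ℝ} (h : ∀ x, f x ≤ g x) (x : G) : walk S f x ≤ walk S g x :=
  div_le_div_of_nonneg_right (Finset.sum_le_sum fun _ _ => h _) (Nat.cast_nonneg _)

theorem abs_walk_iterate_le (f : G → ℝ) (m : ℕ) (x : G) :
    |(walk S)^[m] f x| ≤ (walk S)^[m] (fun y => |f y|) x := by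
  induction m generalizing x with
  | zero => exact le_rfl
  | succ m ih =>
    rw [Function.iterate_succ_apply', Function.iterate_succ_apply']
    refine le_trans ?_ (walk_mono ih x)
    unfold walk
    rw [abs_div, Nat.abs_cast]
    exact div_le_div_of_nonneg_right (Finset.abs_sum_le_sum_abs _ _) (Nat.cast_nonneg _)

theorem walk_iterate_translate_left (f : G → ℝ) (y : G) (m : ℕ) (x : G) :
    (walk S)^[m] (fun z => f (y * z)) x = (walk S)^[m] f (y * x) := by
  induction m generalizing x with
  | zero => rfl
  | succ m ih =>
    rw [Function.iterate_succ_apply', Function.iterate_succ_apply']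
    simp only [walk, ih, mul_assoc]

theorem tsum_walk {f : G → ℝ} (hf : FinSupp f) : ∑' x, walk S f x = ∑' x, f x := by
  unfold walk
  rw [tsum_div_const, Summable.tsum_finsetSum fun s _ => (hf.translate s).summable]
  simp_rw [tsum_translate]
  rw [Finset.sum_const, nsmul_eq_mul, mul_div_cancel_left₀ _ (card_symFinset_pos S).ne']

theorem tsum_walk_iterate {f : G → ℝ} (hf : FinSupp f) (m : ℕ) :
    ∑' x, (walk S)^[m] f x = ∑' x, f x := by
  induction m with
  | zero => rfl
  | succ m ih => rw [Function.iterate_succ_apply', tsum_walk (hf.walk_iterate m), ih]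

theorem ip_walk {f g : G → ℝ} (hf : FinSupp f) (hg : FinSupp g) :
    ip (walk S f) g = ip f (walk S g) := by
  unfold ip walk
  simp_rw [div_mul_eq_mul_div, mul_div_assoc', tsum_div_const, Finset.sum_mul, Finset.mul_sum]
  rw [Summable.tsum_finsetSum, Summable.tsum_finsetSum]
  · rw [← sum_symFinset_inv]
    congr 1
    refine Finset.sum_congr rfl fun s _ => ?_
    rw [← tsum_translate _ s]
    simp
  · exact fun s _ => hf.summable_of_zero fun x hx => by simp [hx]
  · exact fun s _ => hg.summable_of_zero fun x hx => by simp [hx]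

theorem ip_walk_iterate {f g : G → ℝ} (hf : FinSupp f) (hg : FinSupp g) (m : ℕ) :
    ip ((walk S)^[m] f) g = ip f ((walk S)^[m] g) := by
  induction m generalizing f with
  | zero => rfl
  | succ m ih =>
    rw [Function.iterate_succ_apply, ih hf.walk, ip_walk hf (hg.walk_iterate m),
      Function.iterate_succ_apply']

theorem ip_delta (f : G → ℝ) : ip delta f = f 1 := by
  unfold ip
  rw [tsum_eq_single 1 fun x hx => by simp [delta, hx]]
  simp [delta]

/-- The loss of `ℓ²` norm under one step of the walk controls the Dirichlet form, because the walk
is lazy. -/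
theorem energy_unif_le {f : G → ℝ} (hf : FinSupp f) :
    energy (unif S) f ≤ 2 * (symFinset S).card * (nsq f - nsq (walk S f)) := by
  set n : ℝ := ((symFinset S).card : ℝ) with hn
  have hn0 : 0 < n := card_symFinset_pos S
  have hn1 : 1 ≤ n := one_le_card_symFinset S
  have key : ∀ x, ∑ s ∈ symFinset S, (f (x * s) - f x) ^ 2
      ≤ 4 * n * (∑ s ∈ symFinset S, f (x * s) ^ 2 - n * walk S f x ^ 2) := by
    intro x
    set m := walk S f x with hm
    have hsum : ∑ s ∈ symFinset S, f (x * s) = n * m := by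
      rw [hm, walk, mul_div_cancel₀ _ hn0.ne']
    have hV : ∑ s ∈ symFinset S, (f (x * s) - m) ^ 2
        = ∑ s ∈ symFinset S, f (x * s) ^ 2 - n * m ^ 2 := by
      have : ∀ s, (f (x * s) - m) ^ 2 = f (x * s) ^ 2 - 2 * m * f (x * s) + m ^ 2 :=
        fun s => by ring
      simp_rw [this]
      rw [Finset.sum_add_distrib, Finset.sum_sub_distrib, ← Finset.mul_sum, hsum,
        Finset.sum_const, nsmul_eq_mul, ← hn]
      ring
    rw [← hV]
    set V := ∑ s ∈ symFinset S, (f (x * s) - m) ^ 2 with hVdef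
    have hone : (f x - m) ^ 2 ≤ V := by
      have := Finset.single_le_sum (f := fun s => (f (x * s) - m) ^ 2)
        (fun s _ => sq_nonneg _) (mem_symFinset.2 (one_mem_symSet S))
      simpa using this
    have hV0 : 0 ≤ V := (sq_nonneg _).trans hone
    calc ∑ s ∈ symFinset S, (f (x * s) - f x) ^ 2
        ≤ ∑ s ∈ symFinset S, (2 * (f (x * s) - m) ^ 2 + 2 * V) :=
          Finset.sum_le_sum fun s _ => by nlinarith [sq_nonneg (f (x * s) - m + (f x - m))]
      _ = 2 * V + n * (2 * V) := by
          rw [Finset.sum_add_distrib, ← Finset.mul_sum, Finset.sum_const, nsmul_eq_mul]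
      _ ≤ 4 * n * V := by nlinarith
  have hE : energy (unif S) f = (∑ s ∈ symFinset S, disp f s) / n / 2 := by
    unfold energy
    rw [tsum_unif_mul, hn, card_symFinset]
    unfold symFinset
    ring
  have hs1 : Summable fun x => ∑ s ∈ symFinset S, (f (x * s) - f x) ^ 2 :=
    summable_sum fun s _ => hf.summable_disp s
  have hs2 : Summable fun x => ∑ s ∈ symFinset S, f (x * s) ^ 2 :=
    summable_sum fun s _ => (hf.translate s).summable_sq
  have hs3 := (hf.walk (S := S)).summable_sq
  have h := hs1.tsum_le_tsum key ((hs2.sub (hs3.mul_left n)).mul_left (4 * n))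
  rw [Summable.tsum_finsetSum fun s _ => hf.summable_disp s, tsum_mul_left,
    hs2.tsum_sub (hs3.mul_left n), tsum_mul_left,
    Summable.tsum_finsetSum fun s _ => (hf.translate s).summable_sq] at h
  have e : ∀ s, ∑' x, f (x * s) ^ 2 = nsq f := fun s => nsq_translate f s
  simp_rw [e, Finset.sum_const, nsmul_eq_mul] at h
  have h' : ∑ s ∈ symFinset S, disp f s ≤ 4 * n * (n * nsq f - n * nsq (walk S f)) := h
  rw [hE, div_div, div_le_iff₀ (by positivity)]
  nlinarith

theorem nsq_walk_le {f : G → ℝ} (hf : FinSupp f) : nsq (walk S f) ≤ nsq f := by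
  have h := (energy_nonneg (isSymmProb_unif S).nonneg f).trans (energy_unif_le (S := S) hf)
  have := card_symFinset_pos S
  by_contra hlt
  nlinarith

theorem nsq_walk_iterate_antitone {f : G → ℝ} (hf : FinSupp f) :
    Antitone fun m => nsq ((walk S)^[m] f) :=
  antitone_nat_of_succ_le fun m => by
    rw [Function.iterate_succ_apply']; exact nsq_walk_le (hf.walk_iterate m)

/-- Self-adjointness of the walk moves half of the steps to the other side of the inner product. -/
theorem ip_walk_iterate_le {f : G → ℝ} (hf : FinSupp f) {j m : ℕ} (hjm : 2 * j ≤ m) :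
    ip f ((walk S)^[m] f) ≤ nsq ((walk S)^[j] f) := by
  have hanti := nsq_walk_iterate_antitone (S := S) hf
  have hj : j ≤ m - j := by omega
  have h1 : ip f ((walk S)^[m] f) = ip ((walk S)^[j] f) ((walk S)^[m - j] f) := by
    rw [ip_walk_iterate hf (hf.walk_iterate _), ← Function.iterate_add_apply]
    congr 3
    omega
  have h2 := two_ip_le (hf.walk_iterate (S := S) j) (hf.walk_iterate (S := S) (m - j))
  have h3 : nsq ((walk S)^[m - j] f) ≤ nsq ((walk S)^[j] f) := hanti hj
  rw [h1]
  linarith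

theorem isSymmProb_convPow (S : Fin k → G) (m : ℕ) : IsSymmProb (convPow (unif S) m) := by
  have hd0 : ∀ x : G, 0 ≤ delta x := fun x => indicator_nonneg (fun _ _ => zero_le_one) x
  refine ⟨fun g => ?_, ?_, fun g => ?_⟩
  · rw [convPow_unif]; exact walk_iterate_nonneg hd0 m g
  · rw [convPow_unif]
    have h := (finSupp_delta.walk_iterate (S := S) m).summable.hasSum
    rw [tsum_walk_iterate finSupp_delta] at h
    have h1 : ∑' x : G, delta x = 1 := by simpa [ip] using ip_delta (fun _ : G => (1 : ℝ))
    rwa [h1] at h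
  · rw [convPow_unif]
    have hfin : FinSupp fun z : G => delta (g⁻¹ * z) := finSupp_delta.translate_left g⁻¹
    have h1 := ip_walk_iterate (S := S) finSupp_delta hfin m
    rw [ip_delta, walk_iterate_translate_left, mul_one] at h1
    rw [← h1]
    unfold ip
    rw [tsum_eq_single g fun x hx => by
      dsimp only
      rw [show delta (g⁻¹ * x) = 0 from indicator_of_notMem (by
        rw [mem_singleton_iff, inv_mul_eq_one]; exact fun h => hx h.symm) _, mul_zero]]
    simp [delta]

theorem finSupp_convPow (S : Fin k → G) (m : ℕ) : FinSupp (convPow (unif S) m) := by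
  rw [convPow_unif]; exact finSupp_delta.walk_iterate m

theorem tsum_convPow_mul {f : G → ℝ} (hf : FinSupp f) (m : ℕ) (x : G) :
    ∑' y, convPow (unif S) m y * f (x * y) = (walk S)^[m] f x := by
  have h := ip_walk_iterate (S := S) finSupp_delta (hf.translate_left x) m
  rw [ip_delta, walk_iterate_translate_left, mul_one] at h
  rw [convPow_unif]
  exact h

theorem energy_convPow {f : G → ℝ} (hf : FinSupp f) (m : ℕ) :
    energy (convPow (unif S) m) f = nsq f - ip f ((walk S)^[m] f) := by
  have hp := isSymmProb_convPow S m
  have hps := finSupp_convPow S m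
  set φ := convPow (unif S) m
  have hd : ∀ y, disp f y = 2 * nsq f - 2 * ∑' x, f x * f (x * y) := by
    intro y
    have h1 := (hf.translate y).summable_sq
    have h2 : Summable fun x => f x * f (x * y) := hf.summable_of_zero fun x hx => by simp [hx]
    calc disp f y = ∑' x, (f (x * y) ^ 2 - 2 * (f x * f (x * y)) + f x ^ 2) :=
          tsum_congr fun x => by ring
      _ = nsq (fun x => f (x * y)) - 2 * ∑' x, f x * f (x * y) + nsq f := by
          rw [(h1.sub (h2.mul_left 2)).tsum_add hf.summable_sq, h1.tsum_sub (h2.mul_left 2),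
            tsum_mul_left]
          rfl
      _ = _ := by rw [nsq_translate]; ring
  have hswap : ∑' y, φ y * ∑' x, f x * f (x * y) = ip f ((walk S)^[m] f) := by
    have hsum : Summable fun p : G × G => φ p.1 * (f p.2 * f (p.2 * p.1)) := by
      refine FinSupp.summable ((hps.prod hf).subset fun p hp => ⟨fun h => hp ?_, fun h => hp ?_⟩)
      · simp [h]
      · simp [h]
    simp_rw [← tsum_mul_left]
    rw [← Summable.tsum_comm (f := fun y x => φ y * (f x * f (x * y))) hsum]
    refine tsum_congr fun x => ?_
    rw [← tsum_convPow_mul hf m x, ← tsum_mul_left]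
    exact tsum_congr fun y => by ring
  have hs2 : Summable fun y => φ y * (2 * ∑' x, f x * f (x * y)) :=
    hps.summable_of_zero fun y hy => by simp [hy]
  unfold energy
  simp_rw [hd, mul_sub]
  rw [(hp.hasSum.summable.mul_right _).tsum_sub hs2, tsum_mul_right, hp.hasSum.tsum_eq]
  simp_rw [show ∀ y, φ y * (2 * ∑' x, f x * f (x * y)) = 2 * (φ y * ∑' x, f x * f (x * y)) from
    fun y => by ring]
  rw [tsum_mul_left, hswap]
  ring

/-- No convolution power has much smaller energy than the simple random walk itself. -/
theorem energy_convPow_ge {f : G → ℝ} (hf : FinSupp f) {m : ℕ} (hm : 1 ≤ m) :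
    energy (unif S) f ≤ 2 * (symFinset S).card * energy (convPow (unif S) m) f := by
  have hE := energy_nonneg (isSymmProb_unif S).nonneg f
  have hn := one_le_card_symFinset S
  rcases hm.eq_or_lt with rfl | hm
  · have : convPow (unif S) 1 = unif S := by
      funext g
      show conv delta (unif S) g = unif S g
      have := ip_delta fun y : G => unif S (y⁻¹ * g)
      rw [inv_one, one_mul] at this
      exact this
    rw [this]
    nlinarith
  · rw [energy_convPow hf]
    refine (energy_unif_le hf).trans ?_
    have := ip_walk_iterate_le (S := S) hf (j := 1) (m := m) (by omega)
    rw [Function.iterate_one] at this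
    gcongr

theorem wordLength_le_of_convPow_ne_zero {m : ℕ} {g : G} (h : convPow (unif S) m g ≠ 0) :
    wordLength S g ≤ m := by
  have key : ∀ m : ℕ, ∀ g : G, (walk S)^[m] delta g ≠ 0 →
      ∃ w : List G, w.length = m ∧ (∀ σ ∈ w, σ ∈ symSet S) ∧ w.prod = g := by
    intro m
    induction m with
    | zero =>
      intro g hg
      refine ⟨[], rfl, by simp, ?_⟩
      by_contra hne
      have : delta g = 0 := indicator_of_notMem (fun h => hne (mem_singleton_iff.1 h).symm) _
      exact hg this
    | succ m ih =>
      intro g hg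
      rw [Function.iterate_succ_apply'] at hg
      have : ∃ s ∈ symFinset S, (walk S)^[m] delta (g * s) ≠ 0 := by
        by_contra! hcon
        exact hg (by simp [walk, Finset.sum_eq_zero hcon])
      obtain ⟨s, hs, hgs⟩ := this
      obtain ⟨w, hl, hw, hp⟩ := ih _ hgs
      refine ⟨w ++ [s⁻¹], by simp [hl], fun σ hσ => ?_, by simp [hp]⟩
      rcases List.mem_append.1 hσ with h | h
      · exact hw σ h
      · rw [List.mem_singleton.1 h]; exact inv_mem_symSet (mem_symFinset.1 hs)
  rw [convPow_unif] at h
  obtain ⟨w, hl, hw, hp⟩ := key m g h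
  exact hl ▸ wordLength_le hw hp

theorem energy_excess_le {φ f : G → ℝ} (hφ : IsSymmProb φ) (hf : FinSupp f) {τ : ℝ}
    (hτ : 0 ≤ τ) : energy φ (excess f τ) ≤ energy φ f :=
  energy_contraction hφ.nonneg hφ.hasSum.summable hf (hf.excess hτ) fun x y => by
    have := abs_max_sub_max_le_abs (f x - τ) (f y - τ) 0
    simpa [excess] using this

/-- After about `1 / Λ(8v)` steps, the walk started from a function on at most `v` points has lost
a definite part of its `ℓ²` norm: otherwise its energy would be small at some earlier time, and
cutting off its small values would give a function on at most `8v` points with energy below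
`Λ(8v)`. -/
theorem quarter_le_energy_convPow {f : G → ℝ} (hf : FinSupp f) {v : ℝ} (hv : 1 ≤ v)
    (hfv : (f.support.ncard : ℝ) ≤ v) (hf1 : nsq f = 1) {N : ℕ}
    (hN : ((symFinset S).card : ℝ) < spectralProfile (unif S) (8 * v) * N) {m : ℕ}
    (hm : 2 * N ≤ m) : 1 / 4 ≤ energy (convPow (unif S) m) f := by
  set n : ℝ := ((symFinset S).card : ℝ) with hn
  have hn0 : 0 < n := card_symFinset_pos S
  have hu := isSymmProb_unif S
  set g : G → ℝ := fun x => |f x| with hg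
  have hgf : FinSupp g := hf.of_zero fun x hx => by simp [hg, hx]
  have hg0 : ∀ x, 0 ≤ g x := fun x => abs_nonneg _
  have hg1 : nsq g = 1 := by rw [← hf1]; exact tsum_congr fun x => sq_abs _
  have hgs : ∑' x, g x ≤ Real.sqrt v := by
    have hsub : Function.support g ⊆ hf.toFinset := fun x hx => by
      simpa [hg] using hx
    rw [tsum_eq_sum (s := hf.toFinset) fun x hx => by
      have : f x = 0 := by simpa using hx
      simp [hg, this]]
    refine Real.le_sqrt_of_sq_le ((sq_sum_le_card_mul_sum_sq).trans ?_)
    rw [← nsq_eq_sum hsub, hg1, mul_one, ← Set.ncard_eq_toFinset_card _ hf]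
    exact hfv
  have hip : ip f ((walk S)^[m] f) ≤ ip g ((walk S)^[m] g) := by
    refine Summable.tsum_le_tsum (fun x => ?_)
      (hf.summable_of_zero fun x hx => by simp [hx])
      (hgf.summable_of_zero fun x hx => by simp [hx])
    refine (le_abs_self _).trans ?_
    rw [abs_mul]
    exact mul_le_mul_of_nonneg_left (abs_walk_iterate_le f m x) (hg0 x)
  have hanti := nsq_walk_iterate_antitone (S := S) hgf
  suffices h : nsq ((walk S)^[N] g) ≤ 3 / 4 by
    rw [energy_convPow hf, hf1]
    have := ip_walk_iterate_le (S := S) hgf hm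
    linarith
  by_contra! hlt
  have hNpos : 0 < N := by
    rcases Nat.eq_zero_or_pos N with rfl | h
    · simp at hN; linarith
    · exact h
  have hN' : (0 : ℝ) < N := by exact_mod_cast hNpos
  obtain ⟨j, hj, hdiff⟩ : ∃ j ∈ Finset.range N,
      nsq ((walk S)^[j] g) - nsq ((walk S)^[j + 1] g) ≤ 1 / (4 * N) := by
    refine Finset.exists_le_of_sum_le (Finset.nonempty_range_iff.2 hNpos.ne') ?_
    rw [Finset.sum_range_sub', Finset.sum_const, Finset.card_range, nsmul_eq_mul]
    have : (N : ℝ) * (1 / (4 * N)) = 1 / 4 := by field_simp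
    rw [this]
    have : nsq ((walk S)^[0] g) = 1 := hg1
    linarith
  set w := (walk S)^[j] g with hw
  have hwf : FinSupp w := hgf.walk_iterate j
  have hw0 : ∀ x, 0 ≤ w x := walk_iterate_nonneg hg0 j
  have hws : ∑' x, w x ≤ Real.sqrt v := (tsum_walk_iterate hgf j).trans_le hgs
  have hwn : 3 / 4 < nsq w := hlt.trans_le (hanti (Finset.mem_range.1 hj).le)
  have hwE : energy (unif S) w ≤ n / (2 * N) := by
    refine (energy_unif_le hwf).trans ?_
    rw [Function.iterate_succ_apply', ← hw] at hdiff
    calc 2 * n * (nsq w - nsq (walk S w)) ≤ 2 * n * (1 / (4 * N)) := by gcongr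
      _ = _ := by field_simp; norm_num
  set τ := 1 / (8 * Real.sqrt v) with hτ
  have hsv : 0 < Real.sqrt v := Real.sqrt_pos.2 (by linarith)
  have hsv2 : Real.sqrt v * Real.sqrt v = v := Real.mul_self_sqrt (by linarith)
  have hτ0 : 0 < τ := by positivity
  have hcard : ((excess w τ).support.ncard : ℝ) ≤ 8 * v := by
    have h := ncard_support_excess_le hwf hw0 hτ0 one_ne_zero
    simp only [pow_one] at h
    have h2 := h.trans hws
    rw [hτ, mul_one_div, div_le_iff₀ (by positivity)] at h2
    nlinarith
  have hnorm : 1 / 2 ≤ nsq (excess w τ) := by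
    have hs := hwf.summable.mul_left (2 * τ)
    have h : ∑' x, (w x ^ 2 - 2 * τ * w x) ≤ nsq (excess w τ) := by
      refine (hwf.summable_sq.sub hs).tsum_le_tsum (fun x => ?_)
        (hwf.excess hτ0.le).summable_sq
      unfold excess
      rcases le_total (w x - τ) 0 with h | h
      · rw [max_eq_right h]; nlinarith [hw0 x]
      · rw [max_eq_left h]; nlinarith
    rw [hwf.summable_sq.tsum_sub hs, tsum_mul_left] at h
    have h2 : 2 * τ * ∑' x, w x ≤ 2 * τ * Real.sqrt v := by gcongr
    have h3 : 2 * τ * Real.sqrt v = 1 / 4 := by rw [hτ]; field_simp; norm_num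
    have h4 : ∑' x, w x ^ 2 = nsq w := rfl
    linarith
  have hP := profile_mul_nsq_le hu (hwf.excess hτ0.le) hcard
  have hE := (energy_excess_le hu hwf hτ0.le).trans hwE
  have hL := profile_nonneg hu (show 1 ≤ 8 * v by linarith)
  have h1 : spectralProfile (unif S) (8 * v) * (1 / 2) ≤ n / (2 * N) :=
    (mul_le_mul_of_nonneg_left hnorm hL).trans (hP.trans hE)
  rw [le_div_iff₀ (by positivity)] at h1
  linarith

end Walk

/-! ### The profile of an infinite group has no plateaus followed by sudden drops -/

section Subgroups

variable {G : Type*} [Group G]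

/-- A finite symmetric set whose product set is less than half as large again generates a subgroup
in two steps. -/
theorem exists_subgroup_of_small_product (H H₂ : Finset G) (h1 : (1 : G) ∈ H)
    (hinv : ∀ a ∈ H, a⁻¹ ∈ H) (hmul : ∀ a ∈ H, ∀ b ∈ H, a * b ∈ H₂)
    (hcard : 2 * H₂.card < 3 * H.card) :
    ∃ K : Subgroup G, (∀ a ∈ H, a ∈ K) ∧ ∀ a ∈ K, a ∈ H₂ := by
  classical
  -- every product of two elements translates `H` to a set meeting `H` in more than half of it
  have hD : ∀ a ∈ H, ∀ b ∈ H, H.card < 2 * (H.filter fun h => (a * b)⁻¹ * h ∈ H).card := by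
    intro a ha b hb
    set A := H.image (a⁻¹ * ·)
    set B := H.image (b * ·)
    have hA : A.card = H.card := Finset.card_image_of_injective _ (mul_right_injective _)
    have hB : B.card = H.card := Finset.card_image_of_injective _ (mul_right_injective _)
    have hAB : (A ∪ B).card ≤ H₂.card := by
      refine Finset.card_le_card (Finset.union_subset ?_ ?_)
      · exact Finset.image_subset_iff.2 fun h hh => hmul _ (hinv a ha) h hh
      · exact Finset.image_subset_iff.2 fun h hh => hmul b hb h hh
    have hi := Finset.card_union_add_card_inter A B
    have hle : (A ∩ B).card ≤ (H.filter fun h => (a * b)⁻¹ * h ∈ H).card := by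
      refine Finset.card_le_card_of_injOn (a * ·) (fun z hz => ?_)
        (mul_right_injective a).injOn
      obtain ⟨hzA, hzB⟩ := Finset.mem_inter.1 hz
      obtain ⟨h, hh, rfl⟩ := Finset.mem_image.1 hzA
      obtain ⟨h', hh', he⟩ := Finset.mem_image.1 hzB
      have he : b * h' = a⁻¹ * h := he
      simp only [Finset.coe_filter, mem_ofPred_eq, mul_inv_cancel_left, mul_inv_rev]
      refine ⟨hh, ?_⟩
      rw [mul_assoc, ← he, inv_mul_cancel_left]
      exact hh'
    omega
  refine ⟨{ carrier := {x | ∃ a ∈ H, ∃ b ∈ H, x = a * b}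
            one_mem' := ⟨1, h1, 1, h1, by simp⟩
            inv_mem' := ?_
            mul_mem' := ?_ }, fun a ha => ⟨a, ha, 1, h1, by simp⟩, ?_⟩
  · rintro x y ⟨a, ha, b, hb, rfl⟩ ⟨c, hc, d, hd, rfl⟩
    have e1 := hD _ (hinv b hb) _ (hinv a ha)
    have e2 := hD c hc d hd
    obtain ⟨h, hh⟩ : ((H.filter fun h => (b⁻¹ * a⁻¹)⁻¹ * h ∈ H)
        ∩ H.filter fun h => (c * d)⁻¹ * h ∈ H).Nonempty := by
      by_contra hne
      rw [Finset.not_nonempty_iff_eq_empty] at hne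
      have hi := Finset.card_union_add_card_inter
        (H.filter fun h => (b⁻¹ * a⁻¹)⁻¹ * h ∈ H) (H.filter fun h => (c * d)⁻¹ * h ∈ H)
      rw [hne, Finset.card_empty] at hi
      have := Finset.card_le_card (Finset.union_subset
        (Finset.filter_subset (fun h => (b⁻¹ * a⁻¹)⁻¹ * h ∈ H) H)
        (Finset.filter_subset (fun h => (c * d)⁻¹ * h ∈ H) H))
      omega
    simp only [Finset.mem_inter, Finset.mem_filter] at hh
    refine ⟨_, hh.1.2, _, hinv _ hh.2.2, ?_⟩
    group
  · rintro x ⟨a, ha, b, hb, rfl⟩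
    exact ⟨_, hinv b hb, _, hinv a ha, by simp⟩
  · rintro x ⟨a, ha, b, hb, rfl⟩
    exact hmul a ha b hb

end Subgroups

section Products

variable {G : Type*} [Group G] {k : ℕ} {S : Fin k → G}

theorem tsum_inv_mul (h : G → ℝ) (x : G) : ∑' g : G, h (g⁻¹ * x) = ∑' g, h g :=
  ((Equiv.inv G).trans (Equiv.mulRight x)).tsum_eq h

theorem finite_corr {a b : G → ℝ} (ha : FinSupp a) (hb : FinSupp b) :
    FinSupp fun p : G × G => a p.2 * b (p.1⁻¹ * p.2) := by
  refine ((ha.prod hb).image fun q => (q.1 * q.2⁻¹, q.1)).subset fun p hp => ?_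
  refine ⟨(p.2, p.1⁻¹ * p.2), ⟨fun h => hp ?_, fun h => hp ?_⟩, ?_⟩
  · simp [show a p.2 = 0 from h]
  · simp [show b (p.1⁻¹ * p.2) = 0 from h]
  · simp

/-- The correlation of two functions, summed over all left translates. -/
theorem hasSum_corr {a b : G → ℝ} (ha : FinSupp a) (hb : FinSupp b) :
    HasSum (fun g => ∑' x, a x * b (g⁻¹ * x)) ((∑' x, a x) * ∑' x, b x) := by
  have hs := (finite_corr ha hb).summable
  have h := hs.prod.hasSum
  rw [Summable.tsum_comm (f := fun x g => a x * b (g⁻¹ * x)) hs.prod_symm] at h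
  simp_rw [tsum_mul_left, tsum_inv_mul, tsum_mul_right] at h
  exact h

/-- The product of a function with one of its left translates. -/
def overlap (f : G → ℝ) (g : G) : G → ℝ := fun x => f x * f (g⁻¹ * x)

theorem FinSupp.overlap {f : G → ℝ} (hf : FinSupp f) (g : G) : FinSupp (overlap f g) :=
  hf.of_zero fun x hx => by simp [Profile.overlap, hx]

theorem hasSum_nsq_overlap {f : G → ℝ} (hf : FinSupp f) :
    HasSum (fun g => nsq (overlap f g)) (nsq f ^ 2) := by
  have hf2 : FinSupp fun x => f x ^ 2 := hf.of_zero fun x hx => by simp [hx]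
  have h := hasSum_corr hf2 hf2
  rw [← sq] at h
  exact h.congr_fun fun g => tsum_congr fun x => mul_pow _ _ _

/-- On average over all left translates, the overlap has a Rayleigh quotient at most four times
that of the function. -/
theorem exists_hasSum_disp_overlap {f : G → ℝ} (hf : FinSupp f) (y : G) :
    ∃ F : G → ℝ, (∀ g, disp (overlap f g) y ≤ F g) ∧ HasSum F (4 * nsq f * disp f y) := by
  have hf2 : FinSupp fun x => f x ^ 2 := hf.of_zero fun x hx => by simp [hx]
  have hd : FinSupp fun x => (f (x * y) - f x) ^ 2 :=
    (hf.diff y).of_zero fun x hx => by simp [hx]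
  have ht : FinSupp fun x => f (x * y) ^ 2 := hf2.translate y
  have h1 := (hasSum_corr hd ht).mul_left 2
  have h2 := (hasSum_corr hf2 hd).mul_left 2
  have e1 : ∑' x, f (x * y) ^ 2 = nsq f := nsq_translate f y
  have h := h1.add h2
  rw [e1] at h
  have e2 : 2 * ((∑' x, (f (x * y) - f x) ^ 2) * nsq f)
      + 2 * ((∑' x, f x ^ 2) * ∑' x, (f (x * y) - f x) ^ 2) = 4 * nsq f * disp f y := by
    simp only [nsq, disp]
    ring
  rw [e2] at h
  refine ⟨_, fun g => ?_, h⟩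
  have s1 : Summable fun x => (f (x * y) - f x) ^ 2 * f (g⁻¹ * x * y) ^ 2 :=
    hd.summable_of_zero fun x hx => by simp [hx]
  have s2 : Summable fun x => f x ^ 2 * (f (g⁻¹ * x * y) - f (g⁻¹ * x)) ^ 2 :=
    hf2.summable_of_zero fun x hx => by simp [hx]
  rw [← tsum_mul_left, ← tsum_mul_left, ← (s1.mul_left 2).tsum_add (s2.mul_left 2)]
  refine ((hf.overlap g).summable_disp y).tsum_le_tsum (fun x => ?_)
    ((s1.mul_left 2).add (s2.mul_left 2))
  unfold overlap
  rw [← mul_assoc]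
  set a := f (x * y)
  set b := f (g⁻¹ * x * y)
  set c := f x
  set d := f (g⁻¹ * x)
  nlinarith [sq_nonneg ((a - c) * b - c * (b - d))]

theorem energy_unif_eq (S : Fin k → G) (f : G → ℝ) :
    energy (unif S) f = 1 / 2 * ((∑ s ∈ symFinset S, disp f s) / (symFinset S).card) := by
  unfold energy
  rw [tsum_unif_mul, card_symFinset]
  rfl

/-- Only finitely many left translates of a finitely supported function overlap with it. -/
theorem finSupp_overlap_param {f : G → ℝ} (hf : FinSupp f) {F : G → ℝ}
    (hF : ∀ g, overlap f g = 0 → F g = 0) : FinSupp F := by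
  refine ((finite_corr hf hf).image Prod.fst).subset fun g hg => ?_
  by_contra hne
  refine hg (hF g ?_)
  funext x
  by_contra hx
  exact hne ⟨(g, x), hx, rfl⟩

theorem tsum_energy_overlap_le {f : G → ℝ} (hf : FinSupp f) :
    ∑' g, energy (unif S) (overlap f g) ≤ 4 * nsq f * energy (unif S) f := by
  choose F hF hFs using fun y => exists_hasSum_disp_overlap hf y
  have hd : ∀ s, Summable fun g => disp (overlap f g) s := fun s =>
    (finSupp_overlap_param hf fun g hg => by simp [hg, disp]).summable
  simp_rw [energy_unif_eq]
  rw [tsum_mul_left, tsum_div_const, Summable.tsum_finsetSum fun s _ => hd s]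
  have h : ∑ s ∈ symFinset S, ∑' g, disp (overlap f g) s
      ≤ ∑ s ∈ symFinset S, 4 * nsq f * disp f s := by
    refine Finset.sum_le_sum fun s _ => ?_
    rw [← (hFs s).tsum_eq]
    exact (hd s).tsum_le_tsum (hF s) (hFs s).summable
  rw [← Finset.mul_sum] at h
  have h' := div_le_div_of_nonneg_right h (card_symFinset_pos S).le
  have e : 4 * nsq f * (1 / 2 * ((∑ s ∈ symFinset S, disp f s) / ((symFinset S).card : ℝ)))
      = 1 / 2 * (4 * nsq f * (∑ s ∈ symFinset S, disp f s) / ((symFinset S).card : ℝ)) := by ring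
  rw [e]
  exact mul_le_mul_of_nonneg_left h' (by norm_num)

/-- A bounded function on at most `w` points whose energy is far below the spectral gap of the sets
with at most `19 w / 20` points is nearly carried by a coset of a finite subgroup. -/
theorem exists_coset_of_gap {f : G → ℝ} (hf : FinSupp f) {w t L : ℝ}
    (hft : ∀ x, f x ^ 2 ≤ t ^ 2) (hcard : (f.support.ncard : ℝ) ≤ w) (hw : 0 < w)
    (htw : t ^ 2 * w ≤ 20 / 19) (hn1 : nsq f ≤ 1) (hn2 : 98 / 100 ≤ nsq f) (hL : 0 < L)
    (hgap : ∀ h : G → ℝ, FinSupp h → (h.support.ncard : ℝ) ≤ 19 / 20 * w →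
      L * nsq h ≤ energy (unif S) h)
    (hE : energy (unif S) f ≤ L / 10000) :
    ∃ (K : Subgroup G) (F : Finset G) (x₀ : G), (∀ g, g ∈ F ↔ g ∈ K) ∧
      95 / 100 < ∑ g ∈ F, f (g⁻¹ * x₀) ^ 2 := by
  classical
  set Ω := hf.toFinset with hΩ
  have hΩmem : ∀ x, x ∈ Ω ↔ f x ≠ 0 := fun x => by simp [hΩ]
  have hΩw : (Ω.card : ℝ) ≤ w := by rwa [hΩ, ← Set.ncard_eq_toFinset_card _ hf]
  set I : G → Finset G := fun g => Ω.filter fun x => g⁻¹ * x ∈ Ω with hI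
  have hIw : ∀ g, ((I g).card : ℝ) ≤ w := fun g =>
    le_trans (by exact_mod_cast Finset.card_filter_le _ _) hΩw
  have hov : ∀ g, Function.support (overlap f g) ⊆ (I g : Set G) := by
    intro g x hx
    have hx : f x * f (g⁻¹ * x) ≠ 0 := hx
    simp only [hI, Finset.coe_filter, mem_ofPred_eq, hΩmem]
    exact ⟨left_ne_zero_of_mul hx, right_ne_zero_of_mul hx⟩
  have hIfin : FinSupp fun g => ((I g).card : ℝ) := by
    refine finSupp_overlap_param hf fun g hg => ?_
    have : I g = ∅ := by
      rw [Finset.eq_empty_iff_forall_notMem]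
      intro x hx
      simp only [hI, Finset.mem_filter, hΩmem] at hx
      exact mul_ne_zero hx.1 hx.2 (congrFun hg x)
    simp [this]
  have hIsum : ∑' g, ((I g).card : ℝ) ≤ w ^ 2 := by
    have hind : FinSupp fun x => if x ∈ Ω then (1 : ℝ) else 0 :=
      Ω.finite_toSet.subset fun x hx => by
        by_contra h; exact hx (if_neg h)
    have h := (hasSum_corr hind hind).tsum_eq
    have e : ∑' x, (if x ∈ Ω then (1 : ℝ) else 0) = Ω.card := by
      rw [tsum_eq_sum (s := Ω) fun x hx => if_neg hx]
      simp
    rw [e] at h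
    have e2 : ∀ g, ∑' x, (if x ∈ Ω then (1 : ℝ) else 0) * (if g⁻¹ * x ∈ Ω then (1 : ℝ) else 0)
        = (I g).card := by
      intro g
      rw [tsum_eq_sum (s := Ω) fun x hx => by simp [hx], hI, Finset.card_filter, Nat.cast_sum]
      exact Finset.sum_congr rfl fun x hx => by simp [hx]
    simp_rw [e2] at h
    rw [h, sq]
    exact mul_le_mul hΩw hΩw (Nat.cast_nonneg _) hw.le
  -- the translates with a large overlap
  have hlevel : ∀ c : ℝ, 0 < c → {g | c * w < (I g).card}.Finite := fun c hc =>
    hIfin.subset fun g hg => ((mul_pos hc hw).trans hg).ne'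
  set H := (hlevel (19 / 20) (by norm_num)).toFinset with hH
  set H₂ := (hlevel (9 / 10) (by norm_num)).toFinset with hH₂
  have hHmem : ∀ g, g ∈ H ↔ 19 / 20 * w < (I g).card := fun g => by simp [hH]
  have hH₂mem : ∀ g, g ∈ H₂ ↔ 9 / 10 * w < (I g).card := fun g => by simp [hH₂]
  have hH₂card : (H₂.card : ℝ) * (9 / 10) ≤ w := by
    have h1 : (H₂.card : ℝ) * (9 / 10 * w) ≤ ∑ g ∈ H₂, ((I g).card : ℝ) := by
      rw [← nsmul_eq_mul, ← Finset.sum_const]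
      exact Finset.sum_le_sum fun g hg => ((hH₂mem g).1 hg).le
    have h2 := hIfin.summable.sum_le_tsum H₂ fun g _ => Nat.cast_nonneg _
    have h3 := h1.trans (h2.trans hIsum)
    by_contra! hlt
    nlinarith
  -- off `H` the overlaps have Rayleigh quotient at least `L`, while the total energy of all
  -- overlaps is at most `4 L / 10000`; hence most of the overlap mass sits on `H`
  have hNs := hasSum_nsq_overlap hf
  have hNf : FinSupp fun g => nsq (overlap f g) :=
    finSupp_overlap_param hf fun g hg => by simp [hg, nsq]
  have hEf : FinSupp fun g => energy (unif S) (overlap f g) :=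
    finSupp_overlap_param hf fun g hg => by simp [hg, energy, disp]
  have hHmass : 96 / 100 ≤ ∑ g ∈ H, nsq (overlap f g) := by
    have hpt : ∀ g, L * nsq (overlap f g) ≤ energy (unif S) (overlap f g)
        + L * (if g ∈ H then nsq (overlap f g) else 0) := by
      intro g
      have hen := energy_nonneg (isSymmProb_unif S).nonneg (overlap f g)
      by_cases hg : g ∈ H
      · simp only [if_pos hg]; linarith
      · simp only [if_neg hg, mul_zero, add_zero]
        refine hgap _ (hf.overlap g) ?_
        rw [hHmem, not_lt] at hg
        refine le_trans ?_ hg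
        have := Set.ncard_le_ncard (hov g) (Finset.finite_toSet _)
        rw [Set.ncard_coe_finset] at this
        exact_mod_cast this
    have hif : FinSupp fun g => if g ∈ H then nsq (overlap f g) else 0 :=
      hNf.of_zero fun g hg => by simp [hg]
    have h := (hNs.summable.mul_left L).tsum_le_tsum hpt
      (hEf.summable.add (hif.summable.mul_left L))
    rw [tsum_mul_left, hNs.tsum_eq, hEf.summable.tsum_add (hif.summable.mul_left L),
      tsum_mul_left, tsum_eq_sum (s := H) (fun g hg => if_neg hg),
      Finset.sum_congr rfl (fun g hg => if_pos hg)] at h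
    have hE' := tsum_energy_overlap_le (S := S) hf
    have hEb : 4 * nsq f * energy (unif S) f ≤ 4 * 1 * (L / 10000) := by
      gcongr
      exact energy_nonneg (isSymmProb_unif S).nonneg f
    have hsq : (96 / 100 + 4 / 10000 : ℝ) ≤ nsq f ^ 2 := by nlinarith
    have : L * (96 / 100) ≤ L * ∑ g ∈ H, nsq (overlap f g) := by nlinarith
    exact le_of_mul_le_mul_left this hL
  have hHcard : 86 / 100 * w ≤ H.card := by
    have hb : ∀ g ∈ H, nsq (overlap f g) ≤ t ^ 2 * t ^ 2 * w := by
      intro g _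
      rw [nsq_eq_sum (hov g)]
      calc ∑ x ∈ I g, overlap f g x ^ 2 ≤ ∑ x ∈ I g, t ^ 2 * t ^ 2 :=
            Finset.sum_le_sum fun x _ => by
              unfold overlap
              rw [mul_pow]
              exact mul_le_mul (hft _) (hft _) (sq_nonneg _) (sq_nonneg _)
        _ = (I g).card * (t ^ 2 * t ^ 2) := by rw [Finset.sum_const, nsmul_eq_mul]
        _ ≤ w * (t ^ 2 * t ^ 2) := by gcongr; exact hIw g
        _ = _ := by ring
    have h1 := hHmass.trans (Finset.sum_le_sum hb)
    rw [Finset.sum_const, nsmul_eq_mul] at h1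
    have h2 : (t ^ 2 * w) * (t ^ 2 * w) ≤ 20 / 19 * (20 / 19) := by gcongr
    have h3 : 96 / 100 * w ≤ H.card * (20 / 19 * (20 / 19)) :=
      calc 96 / 100 * w ≤ H.card * (t ^ 2 * t ^ 2 * w) * w := by gcongr
        _ = H.card * ((t ^ 2 * w) * (t ^ 2 * w)) := by ring
        _ ≤ _ := by gcongr
    nlinarith
  have hcardlt : 2 * H₂.card < 3 * H.card := by
    have : (2 * H₂.card : ℝ) < 3 * H.card := by nlinarith
    exact_mod_cast this
  have hIinv : ∀ g, (I g⁻¹).card = (I g).card := by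
    intro g
    refine Finset.card_nbij' (g * ·) (g⁻¹ * ·) ?_ ?_ ?_ ?_ <;> intro x hx <;> simp_all
  have hHinv : ∀ a ∈ H, a⁻¹ ∈ H := fun a ha => by
    rw [hHmem, hIinv]; exact (hHmem a).1 ha
  have hHne : H.Nonempty := by
    rw [← Finset.card_pos]; omega
  have hΩbig : 19 / 20 * w < Ω.card := by
    obtain ⟨g, hg⟩ := hHne
    exact ((hHmem g).1 hg).trans_le (by exact_mod_cast Finset.card_filter_le _ _)
  have hone : (1 : G) ∈ H := by
    rw [hHmem]
    have : I 1 = Ω := by simp [hI]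
    rwa [this]
  have hmul : ∀ a ∈ H, ∀ b ∈ H, a * b ∈ H₂ := by
    intro a ha b hb
    rw [hHmem] at ha hb
    rw [hH₂mem]
    -- both `Ω ∩ a⁻¹ Ω` and `Ω ∩ b Ω` fill most of `Ω`, and `a` maps their intersection into
    -- `Ω ∩ a b Ω`
    set A := Ω.filter fun x => a * x ∈ Ω
    set B := Ω.filter fun x => b⁻¹ * x ∈ Ω
    have hA : (A.card : ℝ) = (I a).card := by
      rw [← hIinv a]; simp [hI, A]
    have hAB := Finset.card_union_add_card_inter A B
    have hU : (A ∪ B).card ≤ Ω.card := Finset.card_le_card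
      (Finset.union_subset (Finset.filter_subset _ _) (Finset.filter_subset _ _))
    have hle : (A ∩ B).card ≤ (I (a * b)).card := by
      refine Finset.card_le_card_of_injOn (a * ·) (fun z hz => ?_) (mul_right_injective a).injOn
      obtain ⟨hzA, hzB⟩ := Finset.mem_inter.1 hz
      have hzA' := (Finset.mem_filter.1 hzA).2
      have hzB' := (Finset.mem_filter.1 hzB).2
      simp only [hI, Finset.coe_filter, mem_ofPred_eq]
      exact ⟨hzA', by simpa [mul_assoc] using hzB'⟩
    have hb' : 19 / 20 * w < B.card := hb
    have e1 : ((A ∪ B).card : ℝ) + (A ∩ B).card = A.card + B.card := by exact_mod_cast hAB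
    have e2 : ((A ∪ B).card : ℝ) ≤ Ω.card := by exact_mod_cast hU
    have e3 : ((A ∩ B).card : ℝ) ≤ (I (a * b)).card := by exact_mod_cast hle
    linarith
  obtain ⟨K, hHK, hKH₂⟩ := exists_subgroup_of_small_product H H₂ hone hHinv hmul hcardlt
  have hKfin : (K : Set G).Finite := H₂.finite_toSet.subset fun a ha => hKH₂ a ha
  set F := hKfin.toFinset with hFdef
  have hFmem : ∀ g, g ∈ F ↔ g ∈ K := fun g => by simp [hFdef]
  have hFmass : 96 / 100 ≤ ∑ g ∈ F, nsq (overlap f g) :=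
    hHmass.trans (Finset.sum_le_sum_of_subset_of_nonneg
      (fun g hg => (hFmem g).2 (hHK g hg)) fun g _ _ => nsq_nonneg _)
  have hswap : ∑ g ∈ F, nsq (overlap f g) = ∑' x, f x ^ 2 * ∑ g ∈ F, f (g⁻¹ * x) ^ 2 := by
    unfold nsq
    rw [← Summable.tsum_finsetSum fun g _ => (hf.overlap g).summable_sq]
    refine tsum_congr fun x => ?_
    rw [Finset.mul_sum]
    exact Finset.sum_congr rfl fun g _ => mul_pow _ _ _
  by_contra! hcon
  have hsm : ∑' x, f x ^ 2 * ∑ g ∈ F, f (g⁻¹ * x) ^ 2 ≤ ∑' x, f x ^ 2 * (95 / 100) :=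
    Summable.tsum_le_tsum
      (fun x => mul_le_mul_of_nonneg_left (hcon K F x hFmem) (sq_nonneg _))
      (hf.summable_of_zero fun x hx => by simp [hx]) (hf.summable_sq.mul_right _)
  rw [tsum_mul_right] at hsm
  have : nsq f * (95 / 100) ≤ 95 / 100 := by nlinarith
  have e : ∑' x, f x ^ 2 = nsq f := rfl
  rw [e] at hsm
  linarith

/-- A function nearly carried by a coset of a finite subgroup of an infinite group has energy
bounded below: some generator moves that coset off itself. -/
theorem le_energy_of_coset [Infinite G] (hS : Generates S) {f : G → ℝ} (hf : FinSupp f)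
    (hn1 : nsq f ≤ 1) (K : Subgroup G) (F : Finset G) (x₀ : G) (hF : ∀ g, g ∈ F ↔ g ∈ K)
    (hmass : 95 / 100 < ∑ g ∈ F, f (g⁻¹ * x₀) ^ 2) :
    2 / 10 ≤ (symFinset S).card * energy (unif S) f := by
  classical
  obtain ⟨s, hs, hsK⟩ : ∃ s ∈ symSet S, x₀ * s * x₀⁻¹ ∉ K := by
    by_contra! hcon
    have hle : Subgroup.closure (symSet S) ≤ K.comap (MulAut.conj x₀).toMonoidHom :=
      (Subgroup.closure_le _).2 fun s hs => by simpa using hcon s hs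
    rw [closure_symSet hS] at hle
    have hinj : Function.Injective fun g : G => (⟨x₀ * g * x₀⁻¹, (hF _).2 (by
        simpa using hle (Subgroup.mem_top g))⟩ : F) := by
      intro a b hab
      simpa using hab
    exact not_finite_iff_infinite.2 ‹_› (Finite.of_injective _ hinj)
  set A := F.image fun g => g⁻¹ * x₀
  set B := F.image fun g => g⁻¹ * x₀ * s
  have hAsum : ∑ x ∈ A, f x ^ 2 = ∑ g ∈ F, f (g⁻¹ * x₀) ^ 2 :=
    Finset.sum_image fun a _ b _ hab => by simpa using hab
  have hBsum : ∑ x ∈ B, f x ^ 2 = ∑ g ∈ F, f (g⁻¹ * x₀ * s) ^ 2 :=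
    Finset.sum_image fun a _ b _ hab => by simpa using hab
  have hdisj : Disjoint A B := by
    rw [Finset.disjoint_left]
    intro x hxA hxB
    obtain ⟨g, hg, rfl⟩ := Finset.mem_image.1 hxA
    obtain ⟨h, hh, he⟩ := Finset.mem_image.1 hxB
    refine hsK ?_
    have : x₀ * s * x₀⁻¹ = h * g⁻¹ := by
      have he : h⁻¹ * x₀ * s = g⁻¹ * x₀ := he
      have : x₀ * s = h * (g⁻¹ * x₀) := by rw [← he]; group
      rw [this]; group
    rw [this]
    exact K.mul_mem ((hF h).1 hh) (K.inv_mem ((hF g).1 hg))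
  have htot : ∑ x ∈ A, f x ^ 2 + ∑ x ∈ B, f x ^ 2 ≤ 1 := by
    rw [← Finset.sum_union hdisj]
    exact (hf.summable_sq.sum_le_tsum _ fun x _ => sq_nonneg _).trans hn1
  have hdisp : ∑ x ∈ A, (f (x * s) - f x) ^ 2 ≤ disp f s :=
    (hf.summable_disp s).sum_le_tsum _ fun x _ => sq_nonneg _
  have hAd : ∑ x ∈ A, (f (x * s) - f x) ^ 2
      = ∑ g ∈ F, (f (g⁻¹ * x₀ * s) - f (g⁻¹ * x₀)) ^ 2 :=
    Finset.sum_image fun a _ b _ hab => by simpa using hab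
  have hlow : ∑ g ∈ F, (1 / 2 * f (g⁻¹ * x₀) ^ 2 - f (g⁻¹ * x₀ * s) ^ 2)
      ≤ ∑ g ∈ F, (f (g⁻¹ * x₀ * s) - f (g⁻¹ * x₀)) ^ 2 :=
    Finset.sum_le_sum fun g _ => by
      nlinarith [sq_nonneg (2 * f (g⁻¹ * x₀ * s) - f (g⁻¹ * x₀))]
  rw [Finset.sum_sub_distrib, ← Finset.mul_sum] at hlow
  have hen := disp_le_energy_unif hf hs
  rw [← card_symFinset] at hen
  linarith

/-- In an infinite group the profile at `19 w / 20` is at most a constant times the profile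
at `w`. -/
theorem profile_le_of_infinite [Infinite G] (hS : Generates S) {w : ℝ} (hw : 1 ≤ 19 / 20 * w) :
    spectralProfile (unif S) (19 / 20 * w)
      ≤ 10000 * (symFinset S).card * spectralProfile (unif S) w := by
  have hu := isSymmProb_unif S
  set n : ℝ := ((symFinset S).card : ℝ) with hn
  have hn1 : 1 ≤ n := one_le_card_symFinset S
  set L := spectralProfile (unif S) (19 / 20 * w) with hLdef
  have hw0 : 0 < w := by linarith
  by_contra! hlt
  have hlt' : spectralProfile (unif S) w < L / (10000 * n) := by
    rw [lt_div_iff₀ (by positivity)]; linarith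
  obtain ⟨f₀, hf₀, hf₀w, hf₀1, hf₀E⟩ := exists_energy_lt hu (by linarith) hlt'
  have hE₀ := energy_nonneg hu.nonneg f₀
  have hL0 : 0 < L := by
    have := hE₀.trans_lt hf₀E
    by_contra! h
    exact absurd this (not_lt.2 (div_nonpos_of_nonpos_of_nonneg h (by positivity)))
  have hL2 : L ≤ 2 := profile_le_two hu hw
  set f : G → ℝ := fun x => |f₀ x| with hf
  have hff : FinSupp f := hf₀.of_zero fun x hx => by simp [hf, hx]
  have hf0 : ∀ x, 0 ≤ f x := fun x => abs_nonneg _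
  have hfn : nsq f = 1 := by rw [← hf₀1]; exact tsum_congr fun x => sq_abs _
  have hfsupp : f.support = f₀.support := by ext x; simp [hf]
  have hfE : energy (unif S) f < L / (10000 * n) :=
    (energy_contraction hu.nonneg hu.hasSum.summable hf₀ hff
      fun x y => abs_abs_sub_abs_le _ _).trans_lt hf₀E
  have hfE' : L / (10000 * n) ≤ L / 10000 :=
    div_le_div_of_nonneg_left hL0.le (by norm_num) (by linarith)
  have hgap : ∀ h : G → ℝ, FinSupp h → (h.support.ncard : ℝ) ≤ 19 / 20 * w →
      L * nsq h ≤ energy (unif S) h := fun h hh hc => profile_mul_nsq_le hu hh hc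
  -- a level above which `f` lives on at most `19 w / 20` points
  set t := Real.sqrt (20 / (19 * w)) with ht
  have ht2 : t ^ 2 = 20 / (19 * w) := Real.sq_sqrt (by positivity)
  have ht0 : 0 < t := Real.sqrt_pos.2 (by positivity)
  set e := excess f t with he
  have hef : FinSupp e := hff.excess ht0.le
  have hecard : (e.support.ncard : ℝ) ≤ 19 / 20 * w := by
    have h := ncard_support_excess_le hff hf0 ht0 two_ne_zero
    rw [ht2] at h
    have h' : (e.support.ncard : ℝ) * (20 / (19 * w)) ≤ 1 := h.trans_eq hfn
    rw [mul_div_assoc', div_le_one (by positivity)] at h'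
    linarith
  have hen : nsq e ≤ 1 / 10000 := by
    have h1 := hgap e hef hecard
    have h2 := energy_excess_le hu hff ht0.le
    have h3 : L * nsq e ≤ L * (1 / 10000) := by
      rw [mul_one_div]; linarith
    exact le_of_mul_le_mul_left h3 hL0
  set g : G → ℝ := fun x => min (f x) t with hg
  have hgf : FinSupp g := hff.of_zero fun x hx => by simp [hg, hx, ht0.le]
  have hg0 : ∀ x, 0 ≤ g x := fun x => le_min (hf0 x) ht0.le
  have hgE : energy (unif S) g ≤ energy (unif S) f :=
    energy_contraction hu.nonneg hu.hasSum.summable hff hgf fun x y => by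
      have := abs_min_sub_min_le_max (f x) t (f y) t
      simpa [hg] using this
  have hgn1 : nsq g ≤ 1 := by
    rw [← hfn]
    refine hgf.summable_sq.tsum_le_tsum (fun x => ?_) hff.summable_sq
    have : g x ≤ f x := min_le_left _ _
    have := hg0 x
    gcongr
  have hgn2 : 98 / 100 ≤ nsq g := by
    have h : nsq f ≤ ∑' x, (101 / 100 * g x ^ 2 + 101 * e x ^ 2) := by
      refine hff.summable_sq.tsum_le_tsum (fun x => ?_)
        ((hgf.summable_sq.mul_left _).add (hef.summable_sq.mul_left _))
      have : f x = g x + e x := by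
        simp only [hg, he, excess]
        rcases le_total (f x) t with h | h
        · rw [min_eq_left h, max_eq_right (by linarith)]; ring
        · rw [min_eq_right h, max_eq_left (by linarith)]; ring
      rw [this]
      nlinarith [sq_nonneg (g x - 100 * e x)]
    rw [(hgf.summable_sq.mul_left _).tsum_add (hef.summable_sq.mul_left _), tsum_mul_left,
      tsum_mul_left, hfn] at h
    have h' : 1 ≤ 101 / 100 * nsq g + 101 * nsq e := h
    linarith
  have hgcard : (g.support.ncard : ℝ) ≤ w := by
    refine le_trans ?_ hf₀w
    have : g.support ⊆ f₀.support := fun x hx => by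
      rw [← hfsupp]
      intro h
      exact hx (by simp [hg, h, ht0.le])
    exact_mod_cast Set.ncard_le_ncard this hf₀
  obtain ⟨K, F, x₀, hF, hmass⟩ := exists_coset_of_gap (S := S) hgf (w := w) (t := t)
    (fun x => by
      have : g x ≤ t := min_le_right _ _
      have := hg0 x
      gcongr) hgcard hw0 (by rw [ht2]; field_simp; rfl) hgn1 hgn2 hL0 hgap
    (by linarith)
  have hfin := le_energy_of_coset hS hgf hgn1 K F x₀ hF hmass
  rw [← hn] at hfin
  rw [lt_div_iff₀ (by positivity)] at hfE
  nlinarith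

/-- In an infinite group, enlarging the volume by a factor of `8` decreases the profile by at most a
constant factor, which depends only on the number of generators. -/
theorem exists_profile_le_eight [Infinite G] (n : ℕ) :
    ∃ C : ℝ, 0 < C ∧ ∀ (k : ℕ) (S : Fin k → G), Generates S → (symSet S).ncard = n →
      ∀ v : ℝ, 1 ≤ v → spectralProfile (unif S) v ≤ C * spectralProfile (unif S) (8 * v) := by
  refine ⟨(10000 * (n + 1)) ^ 41, by positivity, ?_⟩
  intro k S hS hn v hv
  have hu := isSymmProb_unif S
  have key : ∀ j : ℕ, spectralProfile (unif S) v
      ≤ (10000 * (n + 1)) ^ j * spectralProfile (unif S) ((20 / 19) ^ j * v) := by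
    intro j
    induction j with
    | zero => simp
    | succ j ih =>
      have h1 : 1 ≤ (20 / 19 : ℝ) ^ j * v :=
        one_le_mul_of_one_le_of_one_le (one_le_pow₀ (by norm_num)) hv
      have e : 19 / 20 * ((20 / 19 : ℝ) ^ (j + 1) * v) = (20 / 19) ^ j * v := by
        rw [pow_succ]; ring
      have h2 := profile_le_of_infinite hS (w := (20 / 19) ^ (j + 1) * v) (by rw [e]; exact h1)
      rw [e, card_symFinset, hn] at h2
      have h3 : 0 ≤ spectralProfile (unif S) ((20 / 19) ^ (j + 1) * v) :=
        profile_nonneg hu (one_le_mul_of_one_le_of_one_le (one_le_pow₀ (by norm_num)) hv)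
      refine ih.trans ?_
      rw [pow_succ (10000 * ((n : ℝ) + 1)), mul_assoc]
      refine mul_le_mul_of_nonneg_left (h2.trans ?_) (by positivity)
      exact mul_le_mul_of_nonneg_right (by linarith) h3
  refine (key 41).trans (mul_le_mul_of_nonneg_left ?_ (by positivity))
  have h8 : (8 : ℝ) ≤ (20 / 19) ^ 41 := by norm_num
  exact profile_antitone hu (by linarith) (by nlinarith)

end Products

/-! ### Finite groups -/

section FiniteGroup

variable {G : Type*} [Group G]

/-- In a finite group a function with a zero has energy bounded below, uniformly over the
generating tuples. -/
theorem exists_le_energy_of_finite [Finite G] (n : ℕ) :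
    ∃ c : ℝ, 0 < c ∧ ∀ (k : ℕ) (S : Fin k → G), Generates S → (symSet S).ncard = n →
      ∀ f : G → ℝ, nsq f = 1 → (∃ z, f z = 0) → c ≤ energy (unif S) f := by
  classical
  have := Fintype.ofFinite G
  -- the word length depends only on the set `S*`, and there are finitely many such sets
  set len : Set G × G → ℕ := fun p =>
    sInf {m : ℕ | ∃ w : List G, w.length = m ∧ (∀ σ ∈ w, σ ∈ p.1) ∧ w.prod = p.2} with hlen
  set D : ℕ := ∑ p, len p + 1 with hD
  refine ⟨1 / (Fintype.card G * (D : ℝ) ^ 2 * (2 * (n + 1))), ?_, ?_⟩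
  · have : 0 < Fintype.card G := Fintype.card_pos
    positivity
  intro k S hS hn f hf1 ⟨z, hz⟩
  have hf : FinSupp f := Set.toFinite _
  have hcard : (0 : ℝ) < Fintype.card G := by exact_mod_cast Fintype.card_pos
  obtain ⟨x, -, hx⟩ : ∃ x ∈ (Finset.univ : Finset G), 1 / (Fintype.card G : ℝ) ≤ f x ^ 2 := by
    refine Finset.exists_le_of_sum_le ⟨1, Finset.mem_univ _⟩ ?_
    rw [Finset.sum_const, nsmul_eq_mul, Finset.card_univ, mul_one_div_cancel hcard.ne',
      ← nsq_eq_sum (by simp), hf1]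
  have h1 := (hf.summable_disp (x⁻¹ * z)).le_tsum x fun _ _ => sq_nonneg _
  rw [mul_inv_cancel_left, hz, zero_sub, neg_sq] at h1
  have h2 := disp_le_wordLength hS hf (x⁻¹ * z)
  have hE := energy_nonneg (isSymmProb_unif S).nonneg f
  have h3 : (wordLength S (x⁻¹ * z) : ℝ) ≤ D := by
    have : len (symSet S, x⁻¹ * z) ≤ ∑ p, len p :=
      Finset.single_le_sum (f := len) (fun _ _ => Nat.zero_le _) (Finset.mem_univ _)
    exact_mod_cast this.trans (Nat.le_succ _)
  have h4 : disp f (x⁻¹ * z) ≤ (D : ℝ) ^ 2 * (2 * (n + 1) * energy (unif S) f) := by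
    refine h2.trans ?_
    rw [hn]
    gcongr
    linarith
  have h5 := hx.trans (h1.trans h4)
  rw [div_le_iff₀ hcard] at h5
  rw [div_le_iff₀ (by positivity)]
  linarith

end FiniteGroup

/-! ### Mixtures of the convolution powers of the simple random walk -/

section Mixture

variable {G : Type*} [Group G] {k : ℕ} {S : Fin k → G} {c : ℕ → ℝ} {ρ : ℝ → ℝ}

/-- The mixture of the convolution powers of `unif S` in which the power `m + 1` has weight
`c m`. -/
def mixture (S : Fin k → G) (c : ℕ → ℝ) : G → ℝ :=
  fun g => ∑' m : ℕ, c m * convPow (unif S) (m + 1) g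

theorem subord_eq_mixture (ψ : ℝ → ℝ) (S : Fin k → G) :
    subord ψ (unif S) = mixture S fun m => subordCoeff ψ (m + 1) := rfl

/-- The weight of the powers larger than `M`. -/
def tailWeight (c : ℕ → ℝ) (M : ℕ) : ℝ := ∑' m, c (m + M)

theorem tailWeight_eq {c : ℕ → ℝ} (hc : Summable c) (M : ℕ) :
    tailWeight c M = ∑' m, if M ≤ m then c m else 0 := by
  have hs : Summable fun m => if M ≤ m then c m else 0 :=
    (hc.indicator {m | M ≤ m}).congr fun m => by simp [indicator_apply]
  rw [← hs.sum_add_tsum_nat_add M, Finset.sum_eq_zero fun m hm => by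
    rw [if_neg (by simpa using hm)], zero_add]
  exact tsum_congr fun m => by simp

/-- Interchange of the sums over `G` and over the convolution powers. -/
theorem hasSum_mixture_mul (hc0 : ∀ m, 0 ≤ c m) (hc : Summable c) {h : G → ℝ} {B : ℝ}
    (h0 : ∀ g, 0 ≤ h g) (hB : ∀ g, h g ≤ B) :
    HasSum (fun g => mixture S c g * h g)
      (∑' m, c m * ∑' g, convPow (unif S) (m + 1) g * h g) := by
  have hP := fun m => isSymmProb_convPow S (m + 1)
  have hin : ∀ m, Summable fun g => convPow (unif S) (m + 1) g * h g := fun m =>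
    Summable.of_nonneg_of_le (fun g => mul_nonneg ((hP m).nonneg g) (h0 g))
      (fun g => mul_le_mul_of_nonneg_left (hB g) ((hP m).nonneg g))
      ((hP m).hasSum.summable.mul_right B)
  have hle : ∀ m, ∑' g, convPow (unif S) (m + 1) g * h g ≤ B := fun m => by
    have := (hin m).tsum_le_tsum
      (fun g => mul_le_mul_of_nonneg_left (hB g) ((hP m).nonneg g))
      ((hP m).hasSum.summable.mul_right B)
    rwa [tsum_mul_right, (hP m).hasSum.tsum_eq, one_mul] at this
  have hsum : Summable fun p : ℕ × G => c p.1 * (convPow (unif S) (p.1 + 1) p.2 * h p.2) := by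
    have hnn : 0 ≤ fun p : ℕ × G => c p.1 * (convPow (unif S) (p.1 + 1) p.2 * h p.2) :=
      fun p => mul_nonneg (hc0 p.1) (mul_nonneg ((hP p.1).nonneg p.2) (h0 p.2))
    refine (summable_prod_of_nonneg hnn).2 ⟨fun m => (hin m).mul_left (c m), ?_⟩
    refine Summable.of_nonneg_of_le (fun m => tsum_nonneg fun g => hnn (m, g)) (fun m => ?_)
      (hc.mul_right B)
    exact (tsum_mul_left (a := c m)).trans_le (mul_le_mul_of_nonneg_left (hle m) (hc0 m))
  have h1 := hsum.prod_symm.prod.hasSum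
  have h2 : ∀ g, ∑' m, c m * (convPow (unif S) (m + 1) g * h g) = mixture S c g * h g := by
    intro g
    unfold mixture
    rw [← tsum_mul_right]
    exact tsum_congr fun m => by ring
  have h3 : ∑' g, ∑' m, c m * (convPow (unif S) (m + 1) g * h g)
      = ∑' m, c m * ∑' g, convPow (unif S) (m + 1) g * h g := by
    rw [Summable.tsum_comm (f := fun m g => c m * (convPow (unif S) (m + 1) g * h g)) hsum]
    exact tsum_congr fun m => tsum_mul_left
  rw [← h3]
  exact h1.congr_fun fun g => (h2 g).symm

theorem isSymmProb_mixture (hc0 : ∀ m, 0 ≤ c m) (hc : HasSum c 1) :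
    IsSymmProb (mixture S c) where
  nonneg g := tsum_nonneg fun m => mul_nonneg (hc0 m) ((isSymmProb_convPow S _).nonneg g)
  hasSum := by
    have h := hasSum_mixture_mul (S := S) hc0 hc.summable (h := fun _ => 1) (B := 1)
      (fun _ => zero_le_one) fun _ => le_rfl
    simp only [mul_one, (isSymmProb_convPow S _).hasSum.tsum_eq, hc.tsum_eq] at h
    exact h
  symm g := tsum_congr fun m => by rw [(isSymmProb_convPow S _).symm]

theorem energy_mixture (hc0 : ∀ m, 0 ≤ c m) (hc : HasSum c 1) {f : G → ℝ} (hf : FinSupp f) :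
    HasSum (fun m => c m * energy (convPow (unif S) (m + 1)) f) (energy (mixture S c) f) := by
  have h := hasSum_mixture_mul (S := S) hc0 hc.summable (disp_nonneg f) (disp_le_four hf)
  have hs : Summable fun m => c m * energy (convPow (unif S) (m + 1)) f :=
    Summable.of_nonneg_of_le
      (fun m => mul_nonneg (hc0 m) (energy_nonneg (isSymmProb_convPow S _).nonneg f))
      (fun m => mul_le_mul_of_nonneg_left (energy_le_two (isSymmProb_convPow S _) hf) (hc0 m))
      (hc.summable.mul_right _)
  have e : energy (mixture S c) f = ∑' m, c m * energy (convPow (unif S) (m + 1)) f := by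
    unfold energy
    rw [h.tsum_eq, ← tsum_mul_left]
    exact tsum_congr fun m => by ring
  rw [e]
  exact hs.hasSum

/-- If the powers larger than `M` have weight at most `D / ρ(M + 1)`, then the mixture has weak
`ρ`-moment at most `D`. -/
theorem weakMoment_mixture_le (hρ : IsModerate ρ) (hc0 : ∀ m, 0 ≤ c m) (hc : HasSum c 1) {D : ℝ}
    (hD0 : 0 ≤ D) (hD : ∀ M : ℕ, tailWeight c M ≤ D / ρ (M + 1)) :
    weakMoment S ρ (mixture S c) ≤ ENNReal.ofReal D := by
  classical
  refine weakMoment_le (isSymmProb_mixture hc0 hc) fun s hs => ?_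
  have hex : ∃ M : ℕ, s < ρ (M + 1) := by
    have h1 : Tendsto (fun M : ℕ => ρ (M + 1)) atTop atTop :=
      hρ.tendsto.comp (tendsto_atTop_add_const_right _ _ tendsto_natCast_atTop_atTop)
    exact (h1.eventually_gt_atTop s).exists
  set M := Nat.find hex with hM
  have hMs : s < ρ (M + 1) := Nat.find_spec hex
  have hMlt : ∀ m < M, ρ (m + 1) ≤ s := fun m hm => not_lt.1 (Nat.find_min hex hm)
  set A : Set G := {g | s < ρ (wordLength S g)} with hA
  have hmass := hasSum_mixture_mul (S := S) hc0 hc.summable (h := A.indicator 1) (B := 1)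
    (fun g => indicator_nonneg (fun _ _ => zero_le_one) g)
    (fun g => indicator_le_self' (fun _ _ => zero_le_one) g)
  have e : tailMass S ρ (mixture S c) s = ∑' g, mixture S c g * A.indicator 1 g :=
    tsum_congr fun g => by
      by_cases hg : g ∈ A
      · rw [indicator_of_mem hg, indicator_of_mem hg]; simp
      · rw [indicator_of_notMem hg, indicator_of_notMem hg]; simp
  have hle : tailMass S ρ (mixture S c) s ≤ tailWeight c M := by
    rw [e, hmass.tsum_eq, tailWeight_eq hc.summable]
    have hs' : Summable fun m => if M ≤ m then c m else 0 :=
      (hc.summable.indicator {m | M ≤ m}).congr fun m => by simp [indicator_apply]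
    have hP := fun m => isSymmProb_convPow S (m + 1)
    have hb : ∀ m, ∑' g, convPow (unif S) (m + 1) g * A.indicator 1 g
        ≤ if M ≤ m then 1 else 0 := by
      intro m
      split_ifs with hm
      · rw [← (hP m).hasSum.tsum_eq]
        refine Summable.tsum_le_tsum (fun g => ?_)
          ((finSupp_convPow S (m + 1)).summable_of_zero fun g hg => by simp [hg])
          (hP m).hasSum.summable
        exact mul_le_of_le_one_right ((hP m).nonneg g)
          (indicator_le_self' (fun _ _ => zero_le_one) g)
      · refine le_of_eq ((tsum_congr fun g => ?_).trans tsum_zero)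
        by_cases hg : convPow (unif S) (m + 1) g = 0
        · rw [hg, zero_mul]
        · have h1 := wordLength_le_of_convPow_ne_zero hg
          have h2 : ρ (wordLength S g) ≤ ρ (m + 1) :=
            hρ.mono (Nat.cast_nonneg _) (by exact_mod_cast h1)
          rw [indicator_of_notMem (fun hgA => ?_), mul_zero]
          exact absurd (h2.trans (hMlt m (not_le.1 hm))) (not_le.2 hgA)
    refine Summable.tsum_le_tsum (fun m => ?_) ?_ hs'
    · refine (mul_le_mul_of_nonneg_left (hb m) (hc0 m)).trans_eq ?_
      split_ifs <;> simp
    · refine Summable.of_nonneg_of_le (fun m => mul_nonneg (hc0 m) (tsum_nonneg fun g =>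
        mul_nonneg ((hP m).nonneg g) (indicator_nonneg (fun _ _ => zero_le_one) g)))
        (fun m => ?_) hc.summable
      refine mul_le_of_le_one_right (hc0 m) ((hb m).trans ?_)
      split_ifs <;> norm_num
  have hρM : 0 < ρ (M + 1) := hρ.pos (by positivity)
  calc s * tailMass S ρ (mixture S c) s ≤ s * (D / ρ (M + 1)) :=
        mul_le_mul_of_nonneg_left (hle.trans (hD M)) hs.le
    _ ≤ ρ (M + 1) * (D / ρ (M + 1)) :=
        mul_le_mul_of_nonneg_right hMs.le (div_nonneg hD0 hρM.le)
    _ = D := by field_simp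

/-- If the powers larger than `M` have weight at least `d / ρ(M + 1)`, then the profile of the
mixture is at least of order `1 / ρ(1/Λ)`. -/
theorem le_profile_mixture (hρ : IsModerate ρ) (hc0 : ∀ m, 0 ≤ c m) (hc : HasSum c 1) {d : ℝ}
    (hd0 : 0 < d) (hd : ∀ M : ℕ, d / ρ (M + 1) ≤ tailWeight c M) (n : ℕ) :
    ∃ a : ℝ, 0 < a ∧ ∀ (k : ℕ) (S : Fin k → G), Generates S → (symSet S).ncard = n →
      ∀ v : ℝ, 1 ≤ v →
        a * recipAt ρ (spectralProfile (unif S) v) ≤ spectralProfile (mixture S c) v := by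
  rcases finite_or_infinite G with hfin | hinf
  · obtain ⟨b, hb, hmain⟩ := exists_le_energy_of_finite (G := G) n
    refine ⟨b / (2 * (n + 1)), by positivity, fun k S hS hn v hv => ?_⟩
    have hu := isSymmProb_unif S
    have hmix := isSymmProb_mixture (S := S) hc0 hc
    rcases le_or_gt (Nat.card G : ℝ) v with hvG | hvG
    · -- the constant function shows that the profile vanishes
      have hone : FinSupp fun _ : G => (1 : ℝ) := Set.toFinite _
      have h1 := profile_mul_nsq_le hu (v := v) hone (by
        refine le_trans ?_ hvG
        exact_mod_cast (Set.ncard_le_card _))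
      have h2 : energy (unif S) (fun _ : G => (1 : ℝ)) = 0 := by simp [energy, disp]
      have h3 : 1 ≤ nsq fun _ : G => (1 : ℝ) := by simpa using sq_le_nsq hone 1
      have h4 := profile_nonneg hu hv
      have h5 : spectralProfile (unif S) v = 0 := by
        rw [h2] at h1
        nlinarith
      rw [h5]
      simpa [recipAt] using profile_nonneg hmix hv
    · have hx : recipAt ρ (spectralProfile (unif S) v) ≤ 1 :=
        hρ.recipAt_le_one (profile_nonneg hu hv)
      refine (mul_le_of_le_one_right (by positivity) hx).trans
        (le_profile hmix hv fun f hf hfv hf1 => ?_)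
      have hz : ∃ z, f z = 0 := by
        by_contra! hne
        have : f.support = univ := Set.eq_univ_of_forall hne
        rw [this, Set.ncard_univ] at hfv
        linarith
      have hE := hmain k S hS hn f hf1 hz
      have hle : ∀ m, c m * (b / (2 * (n + 1))) ≤ c m * energy (convPow (unif S) (m + 1)) f := by
        intro m
        refine mul_le_mul_of_nonneg_left ?_ (hc0 m)
        have h1 := hE.trans (energy_convPow_ge (S := S) hf (m := m + 1) (by omega))
        rw [card_symFinset, hn] at h1
        have h2 := energy_nonneg (isSymmProb_convPow S (m + 1)).nonneg f
        rw [div_le_iff₀ (by positivity)]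
        nlinarith
      have h := hasSum_le hle (hc.mul_right _) (energy_mixture hc0 hc hf)
      rwa [one_mul] at h
  · obtain ⟨C, hC, h8⟩ := exists_profile_le_eight (G := G) n
    obtain ⟨B, hB1, hB⟩ := hρ.mul_le (A := 2 * n * C + 6) (by positivity)
    refine ⟨d / (4 * B), by positivity, fun k S hS hn v hv => ?_⟩
    have hu := isSymmProb_unif S
    have hmix := isSymmProb_mixture (S := S) hc0 hc
    have hL0 := profile_nonneg hu hv
    have hL2 := profile_le_two hu hv
    have hL8 := h8 k S hS hn v hv
    set L := spectralProfile (unif S) v with hL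
    rcases hL0.eq_or_lt with h0 | h0
    · rw [← h0]
      simpa [recipAt] using profile_nonneg hmix hv
    set N := ⌊n * C / L⌋₊ + 1 with hN
    have hNlt : n * C / L < N := by rw [hN]; push_cast; exact Nat.lt_floor_add_one _
    have hNle : (N : ℝ) ≤ n * C / L + 1 := by
      rw [hN]; push_cast
      exact add_le_add (Nat.floor_le (by positivity)) le_rfl
    have hbig : ((symFinset S).card : ℝ) < spectralProfile (unif S) (8 * v) * N := by
      rw [card_symFinset, hn]
      rw [div_lt_iff₀ h0] at hNlt
      have : (N : ℝ) * L ≤ N * (C * spectralProfile (unif S) (8 * v)) := by gcongr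
      have h2 : C * (n : ℝ) < C * (spectralProfile (unif S) (8 * v) * N) := by linarith
      exact lt_of_mul_lt_mul_left h2 hC.le
    have htail : d / (4 * B) * recipAt ρ L ≤ 1 / 4 * tailWeight c (2 * N) := by
      have h1 := hd (2 * N)
      have h2 : ρ ((2 * N : ℕ) + 1) ≤ B * ρ (1 / L) := by
        refine le_trans (hρ.mono (by positivity) ?_) (hB (1 / L) (by positivity))
        push_cast
        have e : (2 * n * C + 6) * (1 / L) = 2 * (n * C / L) + 6 / L := by ring
        have h3 : 3 ≤ 6 / L := by rw [le_div_iff₀ h0]; linarith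
        rw [e]
        linarith
      have h3 := hρ.pos (show 0 ≤ 1 / L by positivity)
      have h4 : d / (B * ρ (1 / L)) ≤ d / ρ ((2 * N : ℕ) + 1) :=
        div_le_div_of_nonneg_left hd0.le (hρ.pos (by positivity)) h2
      rw [recipAt_of_pos h0]
      calc d / (4 * B) * (1 / ρ (1 / L)) = 1 / 4 * (d / (B * ρ (1 / L))) := by field_simp
        _ ≤ _ := by linarith
    refine htail.trans (le_profile hmix hv fun f hf hfv hf1 => ?_)
    have hs' : Summable fun m => if 2 * N ≤ m then c m else 0 :=
      (hc.summable.indicator {m | 2 * N ≤ m}).congr fun m => by simp [indicator_apply]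
    rw [tailWeight_eq hc.summable, ← tsum_mul_left, ← (energy_mixture hc0 hc hf).tsum_eq]
    refine (hs'.mul_left _).tsum_le_tsum (fun m => ?_) (energy_mixture hc0 hc hf).summable
    have hnn := energy_nonneg (isSymmProb_convPow S (m + 1)).nonneg f
    split_ifs with hm
    · rw [mul_comm]
      exact mul_le_mul_of_nonneg_left
        (quarter_le_energy_convPow hf hv hfv hf1 hbig (by omega)) (hc0 m)
    · rw [mul_zero]; exact mul_nonneg (hc0 m) hnn

end Mixture

/-! ### Complete Bernstein functions and their Taylor coefficients at `1` -/

section CompleteBernstein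

/-- Lévy measures on `(0, ∞)`: the variable is almost surely positive and `min 1 u` is
integrable. -/
structure IsLevy (κ : Measure ℝ) : Prop where
  pos : ∀ᵐ u ∂κ, 0 < u
  integrable : Integrable (fun u => min 1 u) κ

variable {κ : Measure ℝ}

theorem isLevy_restrict {ν : Measure ℝ}
    (h : (∫⁻ t in Ioi (0 : ℝ), ENNReal.ofReal (min 1 t) ∂ν) < ⊤) :
    IsLevy (ν.restrict (Ioi 0)) := by
  have hpos : ∀ᵐ u ∂ν.restrict (Ioi 0), 0 < u := ae_restrict_mem measurableSet_Ioi
  refine ⟨hpos, (measurable_const.min measurable_id).aestronglyMeasurable, ?_⟩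
  rw [hasFiniteIntegral_iff_ofReal (hpos.mono fun u hu => le_min zero_le_one hu.le)]
  exact h

theorem IsLevy.sFinite (h : IsLevy κ) : SFinite κ := by
  set w : ℝ → ENNReal := fun u => ENNReal.ofReal (min 1 u) with hw
  have hwm : Measurable w := (measurable_const.min measurable_id).ennreal_ofReal
  have hfin : IsFiniteMeasure (κ.withDensity w) := by
    refine isFiniteMeasure_withDensity ?_
    have := (hasFiniteIntegral_iff_ofReal
      (h.pos.mono fun u hu => le_min zero_le_one hu.le)).1 h.integrable.2
    exact this.ne
  rw [← withDensity_inv_same (μ := κ) hwm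
    (h.pos.mono fun u hu => by simp [hw, hu]) (ae_of_all _ fun u => ENNReal.ofReal_ne_top)]
  infer_instance

theorem IsLevy.integrable_of_le (h : IsLevy κ) {f : ℝ → ℝ} (hf : AEStronglyMeasurable f κ) (C : ℝ)
    (hC : ∀ u, 0 < u → |f u| ≤ C * min 1 u) : Integrable f κ :=
  (h.integrable.const_mul C).mono' hf (h.pos.mono fun u hu => hC u hu)

theorem div_add_le_min {s u : ℝ} (hs : 0 < s) (hu : 0 < u) :
    s * u / (s + u) ≤ max 1 s * min 1 u := by
  rw [div_le_iff₀ (by positivity)]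
  have h1 : 1 ≤ max 1 s := le_max_left _ _
  have h2 : s ≤ max 1 s := le_max_right _ _
  rcases le_total 1 u with h | h
  · rw [min_eq_left h]; nlinarith
  · rw [min_eq_right h]
    have h3 := mul_le_mul_of_nonneg_right h1 (mul_pos hs hu).le
    have h4 : 0 ≤ max 1 s * (u * u) := by positivity
    nlinarith

theorem IsLevy.integrable_div (h : IsLevy κ) {s : ℝ} (hs : 0 < s) :
    Integrable (fun u => s * u / (s + u)) κ := by
  refine h.integrable_of_le (Measurable.aestronglyMeasurable (by fun_prop)) (max 1 s) fun u hu => ?_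
  rw [abs_of_nonneg (by positivity)]
  exact div_add_le_min hs hu

theorem integral_exp_neg_mul_Ioi {s : ℝ} (hs : 0 < s) :
    ∫ t in Ioi (0 : ℝ), Real.exp (-(t * s)) = 1 / s := by
  have h := integral_exp_mul_Ioi (neg_lt_zero.2 hs) 0
  rw [mul_zero, Real.exp_zero, neg_div_neg_eq] at h
  rw [← h]
  exact integral_congr_ae (ae_of_all _ fun t => by ring_nf)

theorem integrableOn_exp_neg_mul_Ioi {s : ℝ} (hs : 0 < s) :
    IntegrableOn (fun t => Real.exp (-(t * s))) (Ioi (0 : ℝ)) :=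
  Integrable.of_integral_ne_zero (by rw [integral_exp_neg_mul_Ioi hs]; positivity)

theorem integral_mul_exp_neg_mul_Ioi {s : ℝ} (hs : 0 < s) :
    ∫ t in Ioi (0 : ℝ), Real.exp (-(t * s)) * t = 1 / s ^ 2 := by
  have h := Real.integral_rpow_mul_exp_neg_mul_Ioi two_pos hs
  rw [Real.Gamma_two, mul_one, Real.rpow_two, one_div_pow] at h
  rw [← h]
  refine integral_congr_ae (ae_of_all _ fun t => ?_)
  simp only
  rw [show (2 : ℝ) - 1 = 1 by norm_num, Real.rpow_one, mul_comm t s, mul_comm]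

theorem integrableOn_mul_exp_neg_mul_Ioi {s : ℝ} (hs : 0 < s) :
    IntegrableOn (fun t => Real.exp (-(t * s)) * t) (Ioi (0 : ℝ)) :=
  Integrable.of_integral_ne_zero (by rw [integral_mul_exp_neg_mul_Ioi hs]; positivity)

/-- The Laplace transform of a Bernstein function, by Fubini's theorem. -/
theorem IsLevy.laplace (h : IsLevy κ) (a b : ℝ) {s : ℝ} (hs : 0 < s) :
    s ^ 2 * ∫ t in Ioi (0 : ℝ), Real.exp (-(t * s))
        * (a + b * t + ∫ u, (1 - Real.exp (-(t * u))) ∂κ)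
      = a * s + b + ∫ u, s * u / (s + u) ∂κ := by
  have := h.sFinite
  have hin : ∀ u, 0 < u → IntegrableOn
      (fun t => Real.exp (-(t * s)) * (1 - Real.exp (-(t * u)))) (Ioi (0 : ℝ)) ∧
      ∫ t in Ioi (0 : ℝ), Real.exp (-(t * s)) * (1 - Real.exp (-(t * u)))
        = (s * u / (s + u)) / s ^ 2 := by
    intro u hu
    have e : (fun t => Real.exp (-(t * s)) * (1 - Real.exp (-(t * u))))
        = fun t => Real.exp (-(t * s)) - Real.exp (-(t * (s + u))) := by
      funext t
      rw [mul_sub, mul_one, ← Real.exp_add]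
      ring_nf
    have h1 := integrableOn_exp_neg_mul_Ioi hs
    have h2 := integrableOn_exp_neg_mul_Ioi (add_pos hs hu)
    rw [e]
    refine ⟨h1.sub h2, ?_⟩
    rw [integral_sub h1 h2, integral_exp_neg_mul_Ioi hs, integral_exp_neg_mul_Ioi (add_pos hs hu)]
    field_simp
    ring
  have hprod : Integrable (Function.uncurry fun t u : ℝ =>
      Real.exp (-(t * s)) * (1 - Real.exp (-(t * u))))
      ((volume.restrict (Ioi (0 : ℝ))).prod κ) := by
    rw [integrable_prod_iff' (by
      refine Measurable.aestronglyMeasurable ?_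
      unfold Function.uncurry
      fun_prop)]
    refine ⟨h.pos.mono fun u hu => (hin u hu).1, ?_⟩
    refine ((h.integrable_div hs).div_const (s ^ 2)).congr (h.pos.mono fun u hu => ?_)
    dsimp only [Function.uncurry]
    rw [← (hin u hu).2]
    refine setIntegral_congr_fun measurableSet_Ioi fun t ht => ?_
    have ht : 0 < t := ht
    rw [Real.norm_of_nonneg]
    refine mul_nonneg (Real.exp_pos _).le (sub_nonneg.2 (Real.exp_le_one_iff.2 ?_))
    have := mul_pos ht hu
    linarith
  have hswap := integral_integral_swap hprod
  have hleft := hprod.integral_prod_left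
  dsimp only [Function.uncurry] at hleft
  simp_rw [integral_const_mul] at hswap hleft
  have e1 : ∫ u, (∫ t in Ioi (0 : ℝ), Real.exp (-(t * s)) * (1 - Real.exp (-(t * u)))) ∂κ
      = (∫ u, s * u / (s + u) ∂κ) / s ^ 2 := by
    rw [← integral_div]
    exact integral_congr_ae (h.pos.mono fun u hu => (hin u hu).2)
  rw [e1] at hswap
  have i1 := (integrableOn_exp_neg_mul_Ioi hs).mul_const a
  have i2 := (integrableOn_mul_exp_neg_mul_Ioi hs).mul_const b
  have e2 : ∀ t : ℝ, Real.exp (-(t * s)) * (a + b * t + ∫ u, (1 - Real.exp (-(t * u))) ∂κ)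
      = Real.exp (-(t * s)) * a + Real.exp (-(t * s)) * t * b
        + Real.exp (-(t * s)) * ∫ u, (1 - Real.exp (-(t * u))) ∂κ := fun t => by ring
  simp_rw [e2]
  have i12 : Integrable (fun t => Real.exp (-(t * s)) * a + Real.exp (-(t * s)) * t * b)
      (volume.restrict (Ioi 0)) := i1.add i2
  rw [integral_add i12 hleft, integral_add i1 i2, integral_mul_const, integral_mul_const,
    integral_exp_neg_mul_Ioi hs, integral_mul_exp_neg_mul_Ioi hs, hswap]
  field_simp

/-- The Stieltjes representation of a complete Bernstein function vanishing at `0`. -/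
theorem exists_stieltjes {ψ : ℝ → ℝ} (hψ : IsCompleteBernstein ψ)
    (h0 : Tendsto ψ (𝓝[>] 0) (𝓝 0)) :
    ∃ (a : ℝ) (κ : Measure ℝ), 0 ≤ a ∧ IsLevy κ ∧
      ∀ s, 0 < s → ψ s = a * s + ∫ u, s * u / (s + u) ∂κ := by
  obtain ⟨g, ⟨a, b, ν, ha, hb, hν, hg⟩, hψg⟩ := hψ
  have hL := isLevy_restrict hν
  have hrep : ∀ s, 0 < s → ψ s = a * s + b + ∫ u in Ioi 0, s * u / (s + u) ∂ν := by
    intro s hs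
    rw [hψg s hs, ← hL.laplace a b hs]
    congr 1
    exact setIntegral_congr_fun measurableSet_Ioi fun t ht => by
      rw [hg t ht]
  have hb0 : b = 0 := by
    refine le_antisymm (ge_of_tendsto h0 ?_) hb
    filter_upwards [self_mem_nhdsWithin] with s hs
    have hs : 0 < s := hs
    rw [hrep s hs]
    have : 0 ≤ ∫ u in Ioi 0, s * u / (s + u) ∂ν :=
      integral_nonneg_of_ae (hL.pos.mono fun u hu => by
        show 0 ≤ s * u / (s + u)
        positivity)
    have := mul_nonneg ha hs.le
    linarith
  exact ⟨a, _, ha, hL, fun s hs => by rw [hrep s hs, hb0, add_zero]⟩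

/-- The coefficients of a power series converging on `(-1, 1)` are the Taylor coefficients of its
sum. -/
theorem iteratedDeriv_div_factorial_eq {F : ℝ → ℝ} {p : ℕ → ℝ}
    (h : ∀ x, |x| < 1 → HasSum (fun n => p n * x ^ n) (F x)) (n : ℕ) :
    iteratedDeriv n F 0 / (n.factorial : ℝ) = p n := by
  have hball : HasFPowerSeriesOnBall F (FormalMultilinearSeries.ofScalars ℝ p) 0 1 := by
    refine ⟨?_, one_pos, ?_⟩
    · refine ENNReal.le_of_forall_nnreal_lt fun r hr => ?_
      have hr1 : (r : ℝ) < 1 := by exact_mod_cast hr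
      refine FormalMultilinearSeries.le_radius_of_summable_norm _ ?_
      have hs := (h r (by rwa [abs_of_nonneg r.coe_nonneg])).summable.norm
      refine hs.congr fun m => ?_
      rw [FormalMultilinearSeries.ofScalars_norm, norm_mul, norm_pow,
        Real.norm_of_nonneg r.coe_nonneg]
    · intro y hy
      have hy1 : |y| < 1 := by
        rw [Metric.mem_eball, edist_zero_right] at hy
        have : ‖y‖₊ < 1 := ENNReal.coe_lt_one_iff.1 hy
        exact_mod_cast this
      simp only [FormalMultilinearSeries.ofScalars_apply_eq, zero_add, smul_eq_mul]
      exact h y hy1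
  have h1 := hball.factorial_smul 1 n
  rw [FormalMultilinearSeries.ofScalars_apply_eq, one_pow, smul_eq_mul, mul_one, nsmul_eq_mul] at h1
  rw [iteratedDeriv_eq_iteratedFDeriv]
  have hn : (n.factorial : ℝ) ≠ 0 := by exact_mod_cast n.factorial_ne_zero
  rw [div_eq_iff hn, mul_comm]
  exact h1.symm

/-- The weights of the steps `1, 2, …` of the discrete subordinator attached to the data
`(a, κ)`. -/
def levyWeight (a : ℝ) (κ : Measure ℝ) (m : ℕ) : ℝ :=
  (if m = 0 then a else 0) + ∫ u, (u / (1 + u)) ^ 2 * (1 / (1 + u)) ^ m ∂κ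

theorem IsLevy.integrable_weight (h : IsLevy κ) (m : ℕ) :
    Integrable (fun u => (u / (1 + u)) ^ 2 * (1 / (1 + u)) ^ m) κ := by
  refine h.integrable_of_le (Measurable.aestronglyMeasurable (by fun_prop)) 1 fun u hu => ?_
  have h1 : u / (1 + u) ≤ 1 := div_le_one_of_le₀ (by linarith) (by linarith)
  have h2 : 1 / (1 + u) ≤ 1 := div_le_one_of_le₀ (by linarith) (by linarith)
  have h3 := div_add_le_min one_pos hu
  rw [one_mul, max_self] at h3
  have h4 : 0 ≤ u / (1 + u) := by positivity
  rw [abs_of_nonneg (by positivity)]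
  calc (u / (1 + u)) ^ 2 * (1 / (1 + u)) ^ m ≤ (u / (1 + u)) ^ 2 * 1 := by
        gcongr
        exact pow_le_one₀ (by positivity) h2
    _ ≤ u / (1 + u) := by nlinarith
    _ ≤ _ := h3

theorem IsLevy.levyWeight_nonneg (h : IsLevy κ) {a : ℝ} (ha : 0 ≤ a) (m : ℕ) :
    0 ≤ levyWeight a κ m := by
  refine add_nonneg (by split_ifs <;> simp [ha]) (integral_nonneg_of_ae (h.pos.mono fun u hu => ?_))
  show 0 ≤ (u / (1 + u)) ^ 2 * (1 / (1 + u)) ^ m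
  positivity

/-- The power series of `1 - ψ(1 - x)`, obtained by expanding the integrand of the Stieltjes
representation in a geometric series. -/
theorem IsLevy.hasSum_levyWeight (h : IsLevy κ) {a : ℝ} {ψ : ℝ → ℝ}
    (hψ : ∀ s, 0 < s → ψ s = a * s + ∫ u, s * u / (s + u) ∂κ) (h1 : ψ 1 = 1) {x : ℝ}
    (hx : |x| < 1) : HasSum (fun m => levyWeight a κ m * x ^ (m + 1)) (1 - ψ (1 - x)) := by
  obtain ⟨hx1, hx2⟩ := abs_lt.1 hx
  set F : ℕ → ℝ → ℝ := fun m u => (u / (1 + u)) ^ 2 * (1 / (1 + u)) ^ m * x ^ (m + 1) with hF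
  have hFint : ∀ m, Integrable (F m) κ := fun m => (h.integrable_weight m).mul_const _
  have hFnorm : ∀ m, ∫ u, ‖F m u‖ ∂κ ≤ (∫ u, (u / (1 + u)) ^ 2 * (1 / (1 + u)) ^ 0 ∂κ)
      * |x| ^ (m + 1) := by
    intro m
    rw [← integral_mul_const]
    refine integral_mono_ae (hFint m).norm ((h.integrable_weight 0).mul_const _)
      (h.pos.mono fun u hu => ?_)
    simp only [hF, norm_mul, norm_pow, Real.norm_eq_abs, sq_abs]
    have h2 : 1 / (1 + u) ≤ 1 := div_le_one_of_le₀ (by linarith) (by linarith)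
    have h3 : |1 / (1 + u)| = 1 / (1 + u) := abs_of_nonneg (by positivity)
    rw [h3, pow_zero]
    have h4 : (1 / (1 + u)) ^ m ≤ 1 := pow_le_one₀ (by positivity) h2
    gcongr
  have hgeo : Summable fun m : ℕ => |x| ^ (m + 1) :=
    (summable_geometric_of_lt_one (abs_nonneg x) hx).mul_right |x| |>.congr
      fun m => (pow_succ _ _).symm
  have hsum := hasSum_integral_of_summable_integral_norm hFint
    (Summable.of_nonneg_of_le (fun m => integral_nonneg fun u => norm_nonneg _) hFnorm
      (hgeo.mul_left _))
  have hlin : HasSum (fun m : ℕ => if m = 0 then a * x else 0) (a * x) :=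
    hasSum_ite_eq 0 (a * x)
  have htot := hlin.add hsum
  have e1 : ∀ m : ℕ, ((if m = 0 then a * x else 0) + ∫ u, F m u ∂κ)
      = levyWeight a κ m * x ^ (m + 1) := by
    intro m
    rw [levyWeight, add_mul, ← integral_mul_const]
    congr 1
    split_ifs with hm <;> simp [hm]
  have e2 : a * x + ∫ u, ∑' m, F m u ∂κ = 1 - ψ (1 - x) := by
    have i1 := h.integrable_div one_pos
    have i2 := h.integrable_div (s := 1 - x) (by linarith)
    have e3 : ∫ u, ∑' m, F m u ∂κ
        = ∫ u, (1 * u / (1 + u) - (1 - x) * u / (1 - x + u)) ∂κ := by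
      refine integral_congr_ae (h.pos.mono fun u hu => ?_)
      have hq : |1 / (1 + u) * x| < 1 := by
        rw [abs_mul, abs_of_nonneg (by positivity : 0 ≤ 1 / (1 + u))]
        have h2 : 1 / (1 + u) ≤ 1 := div_le_one_of_le₀ (by linarith) (by linarith)
        nlinarith [abs_nonneg x]
      have hg := (hasSum_geometric_of_abs_lt_one hq).mul_left ((u / (1 + u)) ^ 2 * x)
      have e4 : ∀ m, (u / (1 + u)) ^ 2 * x * (1 / (1 + u) * x) ^ m = F m u := fun m => by
        simp only [hF]; ring
      simp_rw [e4] at hg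
      show ∑' m, F m u = _
      rw [hg.tsum_eq]
      have p1 : 1 - x + u ≠ 0 := by linarith
      have p2 : 1 + u ≠ 0 := by linarith
      have p3 : 1 - 1 / (1 + u) * x = (1 - x + u) / (1 + u) := by field_simp; ring
      rw [p3]
      field_simp
      ring
    rw [e3, integral_sub i1 i2]
    have s1 := hψ 1 one_pos
    have s2 := hψ (1 - x) (by linarith)
    rw [s2]
    rw [h1] at s1
    linarith
  rw [e2] at htot
  exact htot.congr_fun fun m => (e1 m).symm

end CompleteBernstein

section Coefficients

/-- For a complete Bernstein function with `ψ(0+) = 0` and `ψ(1) = 1`, the subordination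
coefficients are the weights of a probability measure on the positive integers, whose generating
function is `1 - ψ(1 - x)`. -/
theorem subordCoeff_spec {ψ : ℝ → ℝ} (hψ : IsCompleteBernstein ψ)
    (h0 : Tendsto ψ (𝓝[>] 0) (𝓝 0)) (h1 : ψ 1 = 1) :
    (∀ m, 0 ≤ subordCoeff ψ (m + 1)) ∧ HasSum (fun m => subordCoeff ψ (m + 1)) 1 ∧
      ∀ s, 0 < s → s ≤ 1 →
        HasSum (fun m => subordCoeff ψ (m + 1) * (1 - (1 - s) ^ (m + 1))) (ψ s) := by
  obtain ⟨a, κ, ha, hκ, hrep⟩ := exists_stieltjes hψ h0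
  set c := levyWeight a κ with hc
  have hc0 : ∀ m, 0 ≤ c m := hκ.levyWeight_nonneg ha
  have hgen : ∀ x, |x| < 1 → HasSum (fun m => c m * x ^ (m + 1)) (1 - ψ (1 - x)) :=
    fun x hx => hκ.hasSum_levyWeight hrep h1 hx
  have hcoeff : ∀ m, subordCoeff ψ (m + 1) = c m := by
    intro m
    refine iteratedDeriv_div_factorial_eq (p := fun n => Nat.casesOn n 0 c) (fun x hx => ?_) (m + 1)
    rw [← hasSum_nat_add_iff' 1]
    simpa using hgen x hx
  simp_rw [hcoeff]
  have hψ0 : ∀ s, 0 < s → 0 ≤ ψ s := fun s hs => by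
    rw [hrep s hs]
    refine add_nonneg (mul_nonneg ha hs.le) (integral_nonneg_of_ae (hκ.pos.mono fun u hu => ?_))
    show 0 ≤ s * u / (s + u)
    positivity
  have hleft : Tendsto (fun x : ℝ => 1 - x) (𝓝[<] 1) (𝓝[>] 0) := by
    refine tendsto_nhdsWithin_iff.2 ⟨?_, ?_⟩
    · have : Tendsto (fun x : ℝ => 1 - x) (𝓝 1) (𝓝 (1 - 1)) := tendsto_const_nhds.sub tendsto_id
      rw [sub_self] at this
      exact this.mono_left nhdsWithin_le_nhds
    · filter_upwards [self_mem_nhdsWithin] with x hx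
      exact sub_pos.2 (show x < 1 from hx)
  have hmem : ∀ᶠ x : ℝ in 𝓝[<] 1, 0 < x ∧ x < 1 :=
    (Ioo_mem_nhdsLT (show (0 : ℝ) < 1 by norm_num))
  have hpart : ∀ M, ∑ m ∈ Finset.range M, c m ≤ 1 := by
    intro M
    have ht : Tendsto (fun x : ℝ => ∑ m ∈ Finset.range M, c m * x ^ (m + 1)) (𝓝[<] 1)
        (𝓝 (∑ m ∈ Finset.range M, c m * 1 ^ (m + 1))) :=
      (tendsto_finsetSum _ fun m _ =>
        tendsto_const_nhds.mul ((continuous_pow (m + 1)).tendsto 1)).mono_left nhdsWithin_le_nhds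
    simp only [one_pow, mul_one] at ht
    refine le_of_tendsto ht ?_
    filter_upwards [hmem] with x hx
    have hs := hgen x (by rw [abs_of_pos hx.1]; exact hx.2)
    refine (sum_le_hasSum _ (fun m _ => mul_nonneg (hc0 m) (pow_nonneg hx.1.le _)) hs).trans ?_
    have := hψ0 (1 - x) (by linarith [hx.2])
    linarith
  have hsummable : Summable c := summable_of_sum_range_le hc0 hpart
  have hle : ∑' m, c m ≤ 1 := hsummable.tsum_le_of_sum_range_le hpart
  have hge : 1 ≤ ∑' m, c m := by
    have ht : Tendsto (fun x : ℝ => 1 - ψ (1 - x)) (𝓝[<] 1) (𝓝 (1 - 0)) :=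
      tendsto_const_nhds.sub (h0.comp hleft)
    rw [sub_zero] at ht
    refine le_of_tendsto ht ?_
    filter_upwards [hmem] with x hx
    have hs := hgen x (by rw [abs_of_pos hx.1]; exact hx.2)
    rw [← hs.tsum_eq]
    exact hs.summable.tsum_le_tsum (fun m => mul_le_of_le_one_right (hc0 m)
      (pow_le_one₀ hx.1.le hx.2.le)) hsummable
  have hone : HasSum c 1 := le_antisymm hle hge ▸ hsummable.hasSum
  refine ⟨hc0, hone, fun s hs hs1 => ?_⟩
  have h2 := hone.sub (hgen (1 - s) (by rw [abs_of_nonneg (by linarith)]; linarith))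
  rw [sub_sub_cancel, sub_sub_cancel] at h2
  exact h2.congr_fun fun m => by ring

variable {ρ ψ : ℝ → ℝ} {c : ℕ → ℝ}

/-- Upper bound for the tails of the subordinator: `1 - (1 - 1/N)ⁿ ≥ 1/2` for `n ≥ N`. -/
theorem tailWeight_le (hc0 : ∀ m, 0 ≤ c m) (hc : HasSum c 1)
    (hgen : ∀ s, 0 < s → s ≤ 1 → HasSum (fun m => c m * (1 - (1 - s) ^ (m + 1))) (ψ s))
    {D : ℝ} (hD : ∀ s, 0 < s → s ≤ 1 → ψ s ≤ D / ρ (1 / s)) (M : ℕ) :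
    tailWeight c M ≤ 2 * D / ρ (M + 1) := by
  have hM : (0 : ℝ) < M + 1 := by positivity
  set s : ℝ := 1 / (M + 1) with hs
  have hs0 : 0 < s := by positivity
  have hs1 : s ≤ 1 := div_le_one_of_le₀ (by linarith [(Nat.cast_nonneg M : (0 : ℝ) ≤ M)]) hM.le
  have hψ := hD s hs0 hs1
  rw [hs, one_div_one_div, ← hs] at hψ
  have hpow : (1 - s) ^ (M + 1) ≤ 1 / 2 := by
    have h1 := Real.one_sub_le_exp_neg s
    have h2 : (1 - s) ^ (M + 1) ≤ Real.exp (-s) ^ (M + 1) :=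
      pow_le_pow_left₀ (by linarith) h1 _
    rw [← Real.exp_nat_mul] at h2
    have h3 : ((M + 1 : ℕ) : ℝ) * -s = -1 := by rw [hs]; push_cast; field_simp
    rw [h3] at h2
    have h4 := Real.exp_neg_one_lt_half
    linarith
  have h : 1 / 2 * tailWeight c M ≤ ψ s := by
    rw [tailWeight_eq hc.summable, ← tsum_mul_left, ← (hgen s hs0 hs1).tsum_eq]
    have hs' : Summable fun m => if M ≤ m then c m else 0 :=
      (hc.summable.indicator {m | M ≤ m}).congr fun m => by simp [indicator_apply]
    refine (hs'.mul_left _).tsum_le_tsum (fun m => ?_) (hgen s hs0 hs1).summable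
    split_ifs with hm
    · rw [mul_comm]
      refine mul_le_mul_of_nonneg_left ?_ (hc0 m)
      have : (1 - s) ^ (m + 1) ≤ (1 - s) ^ (M + 1) :=
        pow_le_pow_of_le_one (by linarith) (by linarith) (by omega)
      linarith
    · rw [mul_zero]
      exact mul_nonneg (hc0 m) (sub_nonneg.2 (pow_le_one₀ (by linarith) (by linarith)))
  have e : 2 * D / ρ (M + 1) = 2 * (D / ρ (M + 1)) := by ring
  rw [e]
  linarith

/-- Lower bound for the tails of the subordinator. Steps of length at most `N` contribute at most
`N s` to `ψ(s)`, which is negligible for `s = N⁻⁴`, while `ψ(N⁻⁴)` is comparable to `1 / ρ(N)`. -/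
theorem exists_le_tailWeight (hρ : IsModerate ρ) (hc0 : ∀ m, 0 ≤ c m) (hc : HasSum c 1)
    (hgen : ∀ s, 0 < s → s ≤ 1 → HasSum (fun m => c m * (1 - (1 - s) ^ (m + 1))) (ψ s))
    {d : ℝ} (hd0 : 0 < d) (hd : ∀ s, 0 < s → s ≤ 1 → d / ρ (1 / s) ≤ ψ s) :
    ∃ d' : ℝ, 0 < d' ∧ ∀ M : ℕ, d' / ρ (M + 1) ≤ tailWeight c M := by
  obtain ⟨C, hC1, hC⟩ := hρ.pow_four_le
  obtain ⟨A, hA0, hA⟩ := hρ.le_sqrt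
  have hanti : ∀ {M N : ℕ}, M ≤ N → tailWeight c N ≤ tailWeight c M := by
    intro M N hMN
    have hs' : ∀ M : ℕ, Summable fun m => if M ≤ m then c m else 0 := fun M =>
      (hc.summable.indicator {m | M ≤ m}).congr fun m => by simp [indicator_apply]
    rw [tailWeight_eq hc.summable, tailWeight_eq hc.summable]
    refine (hs' N).tsum_le_tsum (fun m => ?_) (hs' M)
    split_ifs with h1 h2 h2
    · exact le_rfl
    · omega
    · exact hc0 m
    · exact le_rfl
  set δ := d / (2 * C) with hδ
  have hδ0 : 0 < δ := by positivity
  have hlarge : ∀ M : ℕ, A / δ ≤ M → δ / ρ (M + 1) ≤ tailWeight c M := by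
    intro M hM
    set y : ℝ := M + 1 with hy
    have hy1 : 1 ≤ y := by rw [hy]; linarith [(Nat.cast_nonneg M : (0 : ℝ) ≤ M)]
    have hy0 : 0 < y := by linarith
    have hρy := hρ.pos hy0.le
    set s : ℝ := 1 / y ^ 4 with hs
    have hs0 : 0 < s := by positivity
    have hs1 : s ≤ 1 := div_le_one_of_le₀ (one_le_pow₀ hy1) (by positivity)
    have h1 := hd s hs0 hs1
    rw [hs, one_div_one_div, ← hs] at h1
    have h2 : d / (C * ρ y) ≤ d / ρ (y ^ 4) :=
      div_le_div_of_nonneg_left hd0.le (hρ.pos (by positivity)) (hC y hy0.le)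
    have hs' : Summable fun m => if M ≤ m then c m else 0 :=
      (hc.summable.indicator {m | M ≤ m}).congr fun m => by simp [indicator_apply]
    have h3 : ψ s ≤ y * s + tailWeight c M := by
      rw [tailWeight_eq hc.summable, ← (hgen s hs0 hs1).tsum_eq]
      have hsum := hc.mul_left (y * s)
      rw [mul_one] at hsum
      rw [← hsum.tsum_eq, ← hsum.summable.tsum_add hs']
      refine (hgen s hs0 hs1).summable.tsum_le_tsum (fun m => ?_) (hsum.summable.add hs')
      have hp0 : 0 ≤ (1 - s) ^ (m + 1) := pow_nonneg (by linarith) _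
      have hys : 0 ≤ y * s * c m := mul_nonneg (by positivity) (hc0 m)
      split_ifs with hm
      · nlinarith [hc0 m]
      · have hb := one_add_mul_le_pow (a := -s) (by linarith) (m + 1)
        have hmy : ((m + 1 : ℕ) : ℝ) ≤ y := by
          rw [hy]; push_cast; gcongr; omega
        have e : 1 + -s = 1 - s := by ring
        rw [e] at hb
        have hle : 1 - (1 - s) ^ (m + 1) ≤ y * s := by nlinarith
        rw [add_zero, mul_comm (y * s)]
        exact mul_le_mul_of_nonneg_left hle (hc0 m)
    have h4 : y * s ≤ δ / ρ y := by
      rw [le_div_iff₀ hρy]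
      have h5 : ρ y ≤ A * y := by
        refine (hA y (by linarith)).trans ?_
        gcongr
        exact Real.sqrt_le_iff.2 ⟨hy0.le, by nlinarith⟩
      have h6 : A ≤ δ * y := by
        rw [div_le_iff₀ hδ0] at hM
        nlinarith
      calc y * s * ρ y ≤ y * s * (A * y) := by gcongr
        _ = A / y ^ 2 := by rw [hs]; field_simp
        _ ≤ δ * y / y ^ 2 := by gcongr
        _ = δ / y := by field_simp
        _ ≤ δ := div_le_self hδ0.le hy1
    have h7 : d / (C * ρ y) = 2 * (δ / ρ y) := by rw [hδ]; field_simp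
    linarith
  obtain ⟨M₀, hM₀⟩ := exists_nat_ge (A / δ)
  have hρM₀ : 1 ≤ ρ (M₀ + 1) := hρ.one_le _ (show (0 : ℝ) ≤ M₀ + 1 by positivity)
  refine ⟨δ / ρ (M₀ + 1), by positivity, fun M => ?_⟩
  have hρM : 1 ≤ ρ (M + 1) := hρ.one_le _ (show (0 : ℝ) ≤ M + 1 by positivity)
  rcases le_total M₀ M with h | h
  · refine le_trans ?_ (hlarge M (hM₀.trans (by exact_mod_cast h)))
    gcongr
    exact div_le_self hδ0.le hρM₀
  · refine (div_le_self (by positivity) hρM).trans ((hlarge M₀ hM₀).trans (hanti h))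

end Coefficients

/-! ### Regularity of the moment function -/

section MomentFunction

variable {ρ ℓ : ℝ → ℝ}

theorem IsAdmissible.pos (h : IsAdmissible ℓ) {t : ℝ} (ht : 0 ≤ t) : 0 < ℓ t :=
  one_pos.trans_le (h.one_le t ht)

theorem IsAdmissible.mono (h : IsAdmissible ℓ) {s t : ℝ} (hs : 0 ≤ s) (hst : s ≤ t) :
    ℓ s ≤ ℓ t :=
  h.monotoneOn hs (hs.trans hst) hst

/-- The dilation allowed in `ℓ(t²) ≃ ℓ(t)` is absorbed by slow variation for large `t`. -/
theorem IsAdmissible.exists_sq_le (h : IsAdmissible ℓ) :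
    ∃ C : ℝ, 1 ≤ C ∧ ∀ t : ℝ, 0 ≤ t → ℓ (t ^ 2) ≤ C * ℓ t := by
  obtain ⟨c₁, c₂, _, _, hc₁, hc₂, _, _, hs⟩ := h.rpow_simeq 2 two_pos
  have h1 : ∀ᶠ t in atTop, ℓ (1 / c₂ * t) / ℓ t < 2 :=
    (h.slowlyVarying (1 / c₂) (by positivity)).eventually (gt_mem_nhds (by norm_num))
  obtain ⟨T, hT⟩ := eventually_atTop.1 h1
  set R := max T 0 with hR
  have hR0 : 0 ≤ R := le_max_right _ _
  refine ⟨max 1 (max (2 / c₁) (ℓ (R ^ 2))), le_max_left _ _, fun t ht => ?_⟩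
  have hℓt := h.pos ht
  rcases le_total R t with htR | htR
  · have h2 := hT t ((le_max_left _ _).trans htR)
    rw [div_lt_iff₀ hℓt] at h2
    have h3 : 0 ≤ 1 / c₂ * t := by positivity
    have h4 := (hs (1 / c₂ * t) h3).1 (show 0 ≤ c₂ * (1 / c₂ * t) by positivity)
    have e : c₂ * (1 / c₂ * t) = t := by field_simp
    simp only [e, Real.rpow_two] at h4
    calc ℓ (t ^ 2) ≤ 2 / c₁ * ℓ t := by
          rw [div_mul_eq_mul_div, le_div_iff₀ hc₁]; linarith
      _ ≤ _ := by
          gcongr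
          exact (le_max_left _ _).trans (le_max_right _ _)
  · calc ℓ (t ^ 2) ≤ ℓ (R ^ 2) := h.mono (by positivity) (by gcongr)
      _ ≤ ℓ (R ^ 2) * ℓ t :=
          le_mul_of_one_le_right (h.pos (by positivity)).le (h.one_le t ht)
      _ ≤ _ := by
          gcongr
          exact (le_max_right _ _).trans (le_max_right _ _)

/-- The tail integral `∫_t^∞ ds / ((1 + s) ℓ(s))`. -/
def tailInt (ℓ : ℝ → ℝ) (t : ℝ) : ℝ := ∫ s in Ioi t, 1 / ((1 + s) * ℓ s)

theorem IsAdmissible.integrand_pos (h : IsAdmissible ℓ) {s : ℝ} (hs : 0 ≤ s) :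
    0 < 1 / ((1 + s) * ℓ s) := by
  have := h.pos hs
  positivity

theorem IsAdmissible.integrableOn_Ioi (h : IsAdmissible ℓ) {t : ℝ} (ht : 0 ≤ t) :
    IntegrableOn (fun s => 1 / ((1 + s) * ℓ s)) (Ioi t) :=
  h.integrableOn.mono_set (Ioi_subset_Ioi ht)

theorem IsAdmissible.tailInt_pos (h : IsAdmissible ℓ) {t : ℝ} (ht : 0 ≤ t) :
    0 < tailInt ℓ t := by
  unfold tailInt
  rw [setIntegral_pos_iff_support_of_nonneg_ae
    ((ae_restrict_mem measurableSet_Ioi).mono fun s hs =>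
      (h.integrand_pos (ht.trans (le_of_lt hs))).le) (h.integrableOn_Ioi ht)]
  have : Ioi t ⊆ Function.support (fun s => 1 / ((1 + s) * ℓ s)) ∩ Ioi t := fun s hs =>
    ⟨(h.integrand_pos (ht.trans (le_of_lt hs))).ne', hs⟩
  refine lt_of_lt_of_le ?_ (measure_mono this)
  simp

theorem IsAdmissible.tailInt_anti (h : IsAdmissible ℓ) {s t : ℝ} (hs : 0 ≤ s) (hst : s ≤ t) :
    tailInt ℓ t ≤ tailInt ℓ s :=
  setIntegral_mono_set (h.integrableOn_Ioi hs)
    ((ae_restrict_mem measurableSet_Ioi).mono fun _ hu =>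
      (h.integrand_pos (hs.trans (le_of_lt hu))).le)
    (Ioi_subset_Ioi hst).eventuallyLE

theorem IsAdmissible.tendsto_tailInt (h : IsAdmissible ℓ) :
    Tendsto (tailInt ℓ) atTop (𝓝 0) := by
  have h1 := intervalIntegral_tendsto_integral_Ioi 0 h.integrableOn tendsto_id
  have h2 : Tendsto (fun t => tailInt ℓ 0 - ∫ s in (0 : ℝ)..t, 1 / ((1 + s) * ℓ s)) atTop
      (𝓝 (tailInt ℓ 0 - tailInt ℓ 0)) := tendsto_const_nhds.sub h1
  rw [sub_self] at h2
  refine h2.congr' ?_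
  filter_upwards [eventually_ge_atTop 0] with t ht
  have := intervalIntegral.integral_interval_add_Ioi (h.integrableOn_Ioi le_rfl)
    (h.integrableOn_Ioi ht)
  unfold tailInt
  linarith

/-- The substitution `s = u²` in the tail integral. -/
theorem IsAdmissible.exists_tailInt_le_sq (h : IsAdmissible ℓ) :
    ∃ C : ℝ, 1 ≤ C ∧ ∀ t : ℝ, 1 ≤ t → tailInt ℓ t ≤ C * tailInt ℓ (t ^ 2) := by
  obtain ⟨C, hC1, hC⟩ := h.exists_sq_le
  refine ⟨C, hC1, fun t ht => ?_⟩
  have ht0 : 0 ≤ t := by linarith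
  have hsub := integral_comp_rpow_Ioi_of_pos' (g := fun s => 1 / ((1 + s) * ℓ s)) two_pos
    (c := t ^ 2) (by positivity)
  have e : (t ^ 2) ^ ((2 : ℝ)⁻¹) = t := by
    rw [← Real.rpow_two, ← Real.rpow_mul ht0]; norm_num
  rw [e] at hsub
  have hint := (integrableOn_Ioi_comp_rpow_iff (fun s => 1 / ((1 + s) * ℓ s)) two_ne_zero).2
    h.integrableOn
  have hint' : IntegrableOn (fun x : ℝ => ((2 : ℝ) * x ^ ((2 : ℝ) - 1)) •
      (1 / ((1 + x ^ (2 : ℝ)) * ℓ (x ^ (2 : ℝ))))) (Ioi t) := by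
    simpa using hint.mono_set (Ioi_subset_Ioi ht0)
  unfold tailInt
  rw [← hsub, ← integral_const_mul]
  refine setIntegral_mono_on (h.integrableOn_Ioi ht0) (hint'.const_mul C) measurableSet_Ioi
    fun x hx => ?_
  have hx1 : 1 < x := lt_of_le_of_lt ht hx
  have hx0 : 0 ≤ x := by linarith
  have h1 := hC x hx0
  have p1 := h.pos hx0
  have p2 := h.pos (sq_nonneg x)
  rw [show (2 : ℝ) - 1 = 1 by norm_num, Real.rpow_one, Real.rpow_two, smul_eq_mul, mul_one_div,
    mul_div_assoc', div_le_div_iff₀ (by positivity) (by positivity), one_mul]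
  calc (1 + x ^ 2) * ℓ (x ^ 2) ≤ (1 + x ^ 2) * (C * ℓ x) := by gcongr
    _ ≤ (2 * x * (1 + x)) * (C * ℓ x) := by
        gcongr
        nlinarith
    _ = _ := by ring

/-- The two inequalities between `ρ` and the tail integral, with the dilations moved to the side of
the tail integral. -/
theorem IsMomentFunction.exists_bounds (hρ : IsMomentFunction ρ ℓ) :
    ∃ a b A B : ℝ, 0 < a ∧ 0 < b ∧ 0 < A ∧ 0 < B ∧
      (∀ t, 0 ≤ t → ρ t ≤ A * (tailInt ℓ (a * t))⁻¹) ∧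
      ∀ t, 0 ≤ t → (tailInt ℓ (b * t))⁻¹ ≤ B * ρ t := by
  obtain ⟨c₁, c₂, c₃, c₄, hc₁, hc₂, hc₃, hc₄, hs⟩ := hρ.simeq
  refine ⟨1 / c₂, 1 / c₄, 1 / c₁, c₃, by positivity, by positivity, by positivity, hc₃,
    fun t ht => ?_, fun t ht => ?_⟩
  · have h := (hs (1 / c₂ * t) (show 0 ≤ 1 / c₂ * t by positivity)).1
      (show 0 ≤ c₂ * (1 / c₂ * t) by positivity)
    have e : c₂ * (1 / c₂ * t) = t := by field_simp
    rw [e] at h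
    rw [one_div_mul_eq_div, le_div_iff₀ hc₁, mul_comm]
    exact h
  · have h := (hs (1 / c₄ * t) (show 0 ≤ 1 / c₄ * t by positivity)).2
      (show 0 ≤ c₄ * (1 / c₄ * t) by positivity)
    have e : c₄ * (1 / c₄ * t) = t := by field_simp
    rw [e] at h
    exact h

theorem IsMomentFunction.isModerate (hℓ : IsAdmissible ℓ) (hρ : IsMomentFunction ρ ℓ) :
    IsModerate ρ := by
  obtain ⟨a, b, A, B, ha, hb, hA, hB, hup, hlow⟩ := hρ.exists_bounds
  obtain ⟨C, hC1, hC⟩ := hℓ.exists_tailInt_le_sq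
  have hpos : ∀ t, 0 ≤ t → 0 < ρ t := fun t ht => one_pos.trans_le (hρ.one_le t ht)
  refine ⟨hρ.monotoneOn, hρ.one_le, ?_, ?_⟩
  · -- for large `t` the fourth power of `b t` exceeds `a t²`
    set R := 1 + 1 / b + a / b ^ 4 with hR
    have hR0 : 0 ≤ R := by positivity
    refine ⟨max (A * (C * C * B)) (ρ (R ^ 2)), fun t ht => ?_⟩
    have hρt := hpos t ht
    rcases le_total R t with htR | htR
    · have q1 : 0 ≤ 1 / b := by positivity
      have q2 : 0 ≤ a / b ^ 4 := by positivity
      have ht1 : 1 ≤ t := by linarith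
      have hy1 : 1 ≤ b * t := by
        have : 1 / b ≤ t := by linarith
        rw [div_le_iff₀ hb] at this
        linarith
      have hy4 : a * t ^ 2 ≤ ((b * t) ^ 2) ^ 2 := by
        have h1 : a / b ^ 4 ≤ t ^ 2 := by nlinarith
        rw [div_le_iff₀ (by positivity)] at h1
        calc a * t ^ 2 ≤ t ^ 2 * b ^ 4 * t ^ 2 := by gcongr
          _ = _ := by ring
      have h1 := hC (b * t) hy1
      have h2 := hC ((b * t) ^ 2) (one_le_pow₀ hy1)
      have h3 := hℓ.tailInt_anti (by positivity) hy4
      have p1 := hℓ.tailInt_pos (show 0 ≤ b * t by positivity)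
      have p2 := hℓ.tailInt_pos (show 0 ≤ a * t ^ 2 by positivity)
      have hJ : tailInt ℓ (b * t) ≤ C * C * tailInt ℓ (a * t ^ 2) := by
        have hC0 : 0 ≤ C := by linarith
        calc tailInt ℓ (b * t) ≤ C * (C * tailInt ℓ (((b * t) ^ 2) ^ 2)) :=
              h1.trans (mul_le_mul_of_nonneg_left h2 hC0)
          _ ≤ C * (C * tailInt ℓ (a * t ^ 2)) := by gcongr
          _ = _ := by ring
      have hJ' : (tailInt ℓ (a * t ^ 2))⁻¹ ≤ C * C * (tailInt ℓ (b * t))⁻¹ := by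
        rw [← div_eq_mul_inv, le_div_iff₀ p1, inv_mul_le_iff₀ p2]
        linarith
      calc ρ (t ^ 2) ≤ A * (tailInt ℓ (a * t ^ 2))⁻¹ := hup _ (by positivity)
        _ ≤ A * (C * C * (tailInt ℓ (b * t))⁻¹) := by gcongr
        _ ≤ A * (C * C * (B * ρ t)) := by
            gcongr
            exact hlow t ht
        _ = A * (C * C * B) * ρ t := by ring
        _ ≤ _ := by
            gcongr
            exact le_max_left _ _
    · calc ρ (t ^ 2) ≤ ρ (R ^ 2) :=
            hρ.monotoneOn (sq_nonneg t) (sq_nonneg R) (by gcongr)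
        _ ≤ ρ (R ^ 2) * ρ t := le_mul_of_one_le_right (hpos _ (by positivity)).le (hρ.one_le t ht)
        _ ≤ _ := by
            gcongr
            exact le_max_right _ _
  · have h1 : Tendsto (fun t => tailInt ℓ (b * t)) atTop (𝓝[>] 0) := by
      refine tendsto_nhdsWithin_iff.2
        ⟨hℓ.tendsto_tailInt.comp (tendsto_id.const_mul_atTop hb), ?_⟩
      filter_upwards [eventually_ge_atTop 0] with t ht
      exact hℓ.tailInt_pos (by positivity)
    have h2 := (tendsto_inv_nhdsGT_zero.comp h1).const_mul_atTop (inv_pos.2 hB)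
    refine tendsto_atTop_mono' _ ?_ h2
    filter_upwards [eventually_ge_atTop 0] with t ht
    rw [inv_mul_le_iff₀ hB]
    exact hlow t ht

/-- `1 / ρ` is comparable to the tail integral. -/
theorem IsMomentFunction.exists_tailInt_bounds (hℓ : IsAdmissible ℓ) (hρ : IsMomentFunction ρ ℓ) :
    ∃ d D : ℝ, 0 < d ∧ 0 < D ∧ ∀ t, 0 ≤ t → d / ρ t ≤ tailInt ℓ t ∧ tailInt ℓ t ≤ D / ρ t := by
  obtain ⟨a, b, A, B, ha, hb, hA, hB, hup, hlow⟩ := hρ.exists_bounds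
  have hm := hρ.isModerate hℓ
  obtain ⟨M, hM1, hM⟩ := hm.mul_le (inv_pos.2 hb)
  obtain ⟨N, hN1, hN⟩ := hm.mul_le ha
  refine ⟨1 / (B * M), A * N, by positivity, by positivity, fun t ht => ⟨?_, ?_⟩⟩
  · have h1 := hlow (b⁻¹ * t) (by positivity)
    rw [mul_inv_cancel_left₀ hb.ne'] at h1
    have h2 : B * ρ (b⁻¹ * t) ≤ B * (M * ρ t) := mul_le_mul_of_nonneg_left (hM t ht) hB.le
    have p := hℓ.tailInt_pos ht
    have h3 := inv_le_of_inv_le₀ p (h1.trans h2)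
    refine le_trans (le_of_eq ?_) h3
    rw [div_div, one_div]
    ring_nf
  · have h1 := hup (a⁻¹ * t) (by positivity)
    rw [mul_inv_cancel_left₀ ha.ne'] at h1
    have h2 := hN (a⁻¹ * t) (by positivity)
    rw [mul_inv_cancel_left₀ ha.ne'] at h2
    have p := hℓ.tailInt_pos ht
    rw [le_div_iff₀ (hm.pos ht)]
    have h3 : ρ t ≤ N * (A * (tailInt ℓ t)⁻¹) :=
      h2.trans (mul_le_mul_of_nonneg_left h1 (by linarith))
    calc tailInt ℓ t * ρ t ≤ tailInt ℓ t * (N * (A * (tailInt ℓ t)⁻¹)) := by gcongr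
      _ = A * N := by field_simp

end MomentFunction

/-! ### The function `∫₀^s dr / (r ℓ(1/r))` and the associated complete Bernstein functions -/

section Associated

variable {ρ ℓ ψ : ℝ → ℝ}

/-- The density `u ↦ 1 / (u ℓ(1/u))` near the origin. -/
def originDensity (ℓ : ℝ → ℝ) (u : ℝ) : ℝ := 1 / (u * ℓ (1 / u))

/-- The integral `∫₀^s dr / (r ℓ(1/r))`. -/
def originInt (ℓ : ℝ → ℝ) (s : ℝ) : ℝ := ∫ u in Ioc 0 s, originDensity ℓ u

theorem IsAdmissible.originDensity_pos (h : IsAdmissible ℓ) {u : ℝ} (hu : 0 < u) :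
    0 < originDensity ℓ u := by
  have := h.pos (show 0 ≤ 1 / u by positivity)
  unfold originDensity
  positivity

/-- The inversion `u = 1 / t` carries `dt / (t ℓ(t))` to `du / (u ℓ(1/u))`. -/
theorem IsAdmissible.originInt_spec (h : IsAdmissible ℓ) {s : ℝ} (hs : 0 < s) (hs1 : s ≤ 1) :
    IntegrableOn (originDensity ℓ) (Ioc 0 s) ∧ tailInt ℓ (1 / s) ≤ originInt ℓ s ∧
      originInt ℓ s ≤ 2 * tailInt ℓ (1 / s) := by
  have hT : 1 ≤ 1 / s := (one_le_div hs).2 hs1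
  have hcont : ContinuousOn (fun t => 1 / (t * ℓ t)) (Ioi (1 / s)) := by
    refine continuousOn_const.div (continuousOn_id.mul (h.continuousOn.mono fun t ht => ?_))
      fun t ht => ?_
    · have ht : 1 / s < t := ht
      exact (show (0 : ℝ) ≤ t by linarith)
    · have ht : 1 / s < t := ht
      have := h.pos (show 0 ≤ t by linarith)
      have : 0 < t := by linarith
      positivity
  have hle : ∀ t ∈ Ioi (1 / s), 1 / ((1 + t) * ℓ t) ≤ 1 / (t * ℓ t) ∧
      1 / (t * ℓ t) ≤ 2 * (1 / ((1 + t) * ℓ t)) := by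
    intro t ht
    have ht : 1 / s < t := ht
    have h1 : 1 < t := by linarith
    have h2 := h.pos (show 0 ≤ t by linarith)
    constructor
    · gcongr
      linarith
    · rw [mul_one_div, div_le_div_iff₀ (by positivity) (by positivity)]
      nlinarith
  have hint := h.integrableOn_Ioi (show 0 ≤ 1 / s by linarith)
  have hint' : IntegrableOn (fun t => 1 / (t * ℓ t)) (Ioi (1 / s)) := by
    refine Integrable.mono' (hint.const_mul 2)
      (hcont.aestronglyMeasurable measurableSet_Ioi)
      ((ae_restrict_mem measurableSet_Ioi).mono fun t ht => ?_)
    have ht' : 1 / s < t := ht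
    have h1 : 0 < t := by linarith
    have h2 := h.pos h1.le
    rw [Real.norm_of_nonneg (by positivity)]
    exact (hle t ht).2
  have himage : (fun u : ℝ => u⁻¹) '' Ioo 0 s = Ioi (1 / s) := by
    rw [image_inv_eq_inv, inv_Ioo_0_left hs, one_div]
  have hderiv : ∀ u ∈ Ioo 0 s, HasDerivWithinAt (fun u : ℝ => u⁻¹) (-(u ^ 2)⁻¹) (Ioo 0 s) u :=
    fun u hu => (hasDerivAt_inv hu.1.ne').hasDerivWithinAt
  have hinj : InjOn (fun u : ℝ => u⁻¹) (Ioo 0 s) := inv_injective.injOn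
  have heq : ∀ u ∈ Ioo 0 s, |(-(u ^ 2)⁻¹)| • (1 / (u⁻¹ * ℓ u⁻¹)) = originDensity ℓ u := by
    intro u hu
    have hu0 := hu.1
    have := h.pos (show 0 ≤ u⁻¹ by positivity)
    rw [abs_neg, abs_of_nonneg (by positivity), smul_eq_mul, originDensity, one_div u]
    field_simp
  have hI := integral_image_eq_integral_abs_deriv_smul measurableSet_Ioo hderiv hinj
    (fun t => 1 / (t * ℓ t))
  have hJ := integrableOn_image_iff_integrableOn_abs_deriv_smul measurableSet_Ioo hderiv hinj
    (fun t => 1 / (t * ℓ t))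
  rw [himage] at hI hJ
  have hE : originInt ℓ s = ∫ t in Ioi (1 / s), 1 / (t * ℓ t) := by
    rw [hI, originInt, integral_Ioc_eq_integral_Ioo]
    exact setIntegral_congr_fun measurableSet_Ioo fun u hu => (heq u hu).symm
  refine ⟨?_, ?_, ?_⟩
  · rw [integrableOn_Ioc_iff_integrableOn_Ioo]
    exact (hJ.1 hint').congr_fun heq measurableSet_Ioo
  · rw [hE]
    exact setIntegral_mono_on hint hint' measurableSet_Ioi fun t ht => (hle t ht).1
  · rw [hE, tailInt, ← integral_const_mul]
    exact setIntegral_mono_on hint' (hint.const_mul 2) measurableSet_Ioi fun t ht => (hle t ht).2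

theorem IsAdmissible.originInt_pos (h : IsAdmissible ℓ) {s : ℝ} (hs : 0 < s) (hs1 : s ≤ 1) :
    0 < originInt ℓ s :=
  (h.tailInt_pos (by positivity)).trans_le (h.originInt_spec hs hs1).2.1

theorem IsAdmissible.tendsto_originInt (h : IsAdmissible ℓ) :
    Tendsto (originInt ℓ) (𝓝[>] 0) (𝓝 0) := by
  have h1 : Tendsto (fun s : ℝ => 2 * tailInt ℓ (1 / s)) (𝓝[>] 0) (𝓝 (2 * 0)) := by
    simp_rw [one_div]
    exact (h.tendsto_tailInt.comp tendsto_inv_nhdsGT_zero).const_mul 2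
  rw [mul_zero] at h1
  have hmem : ∀ᶠ s : ℝ in 𝓝[>] 0, s ∈ Ioo (0 : ℝ) 1 := Ioo_mem_nhdsGT one_pos
  refine tendsto_of_tendsto_of_tendsto_of_le_of_le' tendsto_const_nhds h1 ?_ ?_
  · filter_upwards [hmem] with s hs
    exact (h.originInt_pos hs.1 hs.2.le).le
  · filter_upwards [hmem] with s hs
    exact (h.originInt_spec hs.1 hs.2.le).2.2

theorem intervalIntegral_eq_originInt {s : ℝ} (hs : 0 < s) :
    ∫ r in (0 : ℝ)..s, 1 / (r * ℓ (1 / r)) = originInt ℓ s :=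
  intervalIntegral.integral_of_le hs.le

theorem IsMomentFunction.exists_originInt_bounds (hℓ : IsAdmissible ℓ)
    (hρ : IsMomentFunction ρ ℓ) : ∃ d D : ℝ, 0 < d ∧ 0 < D ∧ ∀ s, 0 < s → s ≤ 1 →
      d / ρ (1 / s) ≤ originInt ℓ s ∧ originInt ℓ s ≤ D / ρ (1 / s) := by
  obtain ⟨d, D, hd, hD, h⟩ := hρ.exists_tailInt_bounds hℓ
  refine ⟨d, 2 * D, hd, by positivity, fun s hs hs1 => ?_⟩
  have h1 := h (1 / s) (by positivity)
  have h2 := hℓ.originInt_spec hs hs1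
  refine ⟨h1.1.trans h2.2.1, h2.2.2.trans ?_⟩
  rw [mul_div_assoc]
  linarith [h1.2]

/-- A complete Bernstein function associated with `ℓ` is comparable to `s ↦ 1 / ρ(1/s)` on `(0, 1]`:
near the origin by the asymptotics, and away from it because `s ≤ ψ(s) ≤ 1`. -/
theorem IsAssociated.exists_bounds (hψ : IsAssociated ℓ ψ) (hℓ : IsAdmissible ℓ)
    (hρ : IsMomentFunction ρ ℓ) : ∃ d D : ℝ, 0 < d ∧ 0 < D ∧ ∀ s, 0 < s → s ≤ 1 →
      d / ρ (1 / s) ≤ ψ s ∧ ψ s ≤ D / ρ (1 / s) := by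
  obtain ⟨hc0, hc, hgen⟩ := subordCoeff_spec hψ.completeBernstein hψ.map_zero hψ.map_one
  have hm := hρ.isModerate hℓ
  obtain ⟨a, A, ha, hA, hI⟩ := hρ.exists_originInt_bounds hℓ
  obtain ⟨c, hc_pos, hequiv⟩ := hψ.equivalent
  have hev : ∀ᶠ s in 𝓝[>] (0 : ℝ), c / 2 * originInt ℓ s ≤ ψ s ∧ ψ s ≤ 2 * c * originInt ℓ s := by
    have h1 := hequiv.isLittleO.def (show (0 : ℝ) < 1 / 2 by norm_num)
    have hmem : ∀ᶠ s : ℝ in 𝓝[>] 0, s ∈ Ioo (0 : ℝ) 1 := Ioo_mem_nhdsGT one_pos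
    filter_upwards [h1, hmem] with s hs hs01
    have hIp := hℓ.originInt_pos hs01.1 hs01.2.le
    simp only [Pi.sub_apply, intervalIntegral_eq_originInt hs01.1] at hs
    rw [Real.norm_eq_abs, Real.norm_of_nonneg (by positivity), abs_le] at hs
    have := mul_pos hc_pos hIp
    constructor <;> linarith [hs.1, hs.2]
  obtain ⟨δ, hδ0, hδ⟩ := mem_nhdsGT_iff_exists_Ioo_subset.1 hev
  have hδ0 : 0 < δ := hδ0
  have hψ1 : ∀ s, 0 < s → s ≤ 1 → s ≤ ψ s ∧ ψ s ≤ 1 := by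
    intro s hs hs1
    have h1 := hgen s hs hs1
    have h2 := hc.mul_right s
    rw [one_mul] at h2
    refine ⟨hasSum_le (fun m => ?_) h2 h1, hasSum_le (fun m => ?_) h1 hc⟩
    · refine mul_le_mul_of_nonneg_left ?_ (hc0 m)
      have : (1 - s) ^ (m + 1) ≤ 1 - s :=
        pow_le_of_le_one (by linarith) (by linarith) m.succ_ne_zero
      linarith
    · refine mul_le_of_le_one_right (hc0 m) ?_
      have : 0 ≤ (1 - s) ^ (m + 1) := pow_nonneg (by linarith) _
      linarith
  refine ⟨min (c / 2 * a) δ, max (2 * c * A) (ρ (1 / δ)), by positivity,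
    lt_max_of_lt_left (by positivity), fun s hs hs1 => ?_⟩
  have hρs := hm.pos (show 0 ≤ 1 / s by positivity)
  rcases lt_or_ge s δ with hsδ | hsδ
  · obtain ⟨h1, h2⟩ := hδ ⟨hs, hsδ⟩
    obtain ⟨h3, h4⟩ := hI s hs hs1
    constructor
    · calc min (c / 2 * a) δ / ρ (1 / s) ≤ c / 2 * a / ρ (1 / s) := by
            gcongr; exact min_le_left _ _
        _ = c / 2 * (a / ρ (1 / s)) := by ring
        _ ≤ c / 2 * originInt ℓ s := by gcongr
        _ ≤ _ := h1
    · calc ψ s ≤ 2 * c * originInt ℓ s := h2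
        _ ≤ 2 * c * (A / ρ (1 / s)) := by gcongr
        _ = 2 * c * A / ρ (1 / s) := by ring
        _ ≤ _ := by gcongr; exact le_max_left _ _
  · obtain ⟨h1, h2⟩ := hψ1 s hs hs1
    constructor
    · refine (div_le_self (by positivity) (hm.one_le _ (show 0 ≤ 1 / s by positivity))).trans ?_
      exact (min_le_right _ _).trans (hsδ.trans h1)
    · refine h2.trans ?_
      rw [le_div_iff₀ hρs, one_mul]
      exact (hm.mono (by positivity) (one_div_le_one_div_of_le hδ0 hsδ)).trans (le_max_right _ _)

end Associated

/-! ### Existence of an associated complete Bernstein function -/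

section Existence

variable {ℓ : ℝ → ℝ}

/-- The Stieltjes transform `∫₀¹ s / (s + u) · du / (u ℓ(1/u))`. -/
def stieltjesInt (ℓ : ℝ → ℝ) (s : ℝ) : ℝ := ∫ u in Ioc 0 1, s / (s + u) * originDensity ℓ u

/-- A Potter bound: `ℓ(1/s) ≤ A √(u/s) ℓ(1/u)` for `s ≤ u ≤ 1`. -/
theorem IsAdmissible.exists_originDensity_le (h : IsAdmissible ℓ) :
    ∃ A : ℝ, 0 ≤ A ∧ ∀ s u, 0 < s → s ≤ u → u ≤ 1 →
      originDensity ℓ u ≤ A / ℓ (1 / s) * (s ^ (-(1 / 2) : ℝ) * u ^ (-(1 / 2) : ℝ)) := by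
  obtain ⟨C, hC1, hC⟩ := h.exists_sq_le
  obtain ⟨A, hA0, hA⟩ := le_mul_self_of_sq_le (F := fun t => ℓ (t ^ 2))
    (fun x hx y _ hxy => h.mono (sq_nonneg x)
      (pow_le_pow_left₀ (zero_le_one.trans hx) hxy 2))
    (fun t _ => (h.pos (sq_nonneg t)).le) hC1 (fun t _ => hC (t ^ 2) (sq_nonneg t))
  refine ⟨C * A, by positivity, fun s u hs hsu hu1 => ?_⟩
  have hu : 0 < u := hs.trans_le hsu
  have pu := h.pos (show 0 ≤ 1 / u by positivity)
  have pus := h.pos (show 0 ≤ u / s by positivity)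
  have ps := h.pos (show 0 ≤ 1 / s by positivity)
  have h1u := h.one_le (1 / u) (show 0 ≤ 1 / u by positivity)
  have h1us := h.one_le (u / s) (show 0 ≤ u / s by positivity)
  have hsqrt : ℓ (u / s) ≤ A * Real.sqrt (u / s) := by
    have := hA (Real.sqrt (u / s)) (Real.one_le_sqrt.2 ((one_le_div hs).2 hsu))
    simpa only [Real.sq_sqrt (show 0 ≤ u / s by positivity)] using this
  have hprod : ℓ (1 / s) ≤ C * (ℓ (1 / u) * ℓ (u / s)) := by
    have e : 1 / s = 1 / u * (u / s) := by field_simp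
    have hC0 : 0 ≤ C := by linarith
    rcases le_total (1 / u) (u / s) with hle | hle
    · calc ℓ (1 / s) ≤ ℓ ((u / s) ^ 2) := by
            refine h.mono (by positivity) ?_
            rw [e, sq]; gcongr
        _ ≤ C * ℓ (u / s) := hC _ (by positivity)
        _ ≤ C * (ℓ (1 / u) * ℓ (u / s)) := by
            gcongr
            exact le_mul_of_one_le_left pus.le h1u
    · calc ℓ (1 / s) ≤ ℓ ((1 / u) ^ 2) := by
            refine h.mono (by positivity) ?_
            rw [e, sq]; gcongr
        _ ≤ C * ℓ (1 / u) := hC _ (by positivity)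
        _ ≤ C * (ℓ (1 / u) * ℓ (u / s)) := by
            gcongr
            exact le_mul_of_one_le_right pu.le h1us
  have hfin : ℓ (1 / s) ≤ C * A * Real.sqrt (u / s) * ℓ (1 / u) := by
    refine hprod.trans ?_
    have : C * (ℓ (1 / u) * ℓ (u / s)) ≤ C * (ℓ (1 / u) * (A * Real.sqrt (u / s))) := by gcongr
    linarith
  have es : s ^ (-(1 / 2) : ℝ) = (Real.sqrt s)⁻¹ := by
    rw [Real.rpow_neg hs.le, ← Real.sqrt_eq_rpow]
  have eu : u ^ (-(1 / 2) : ℝ) = (Real.sqrt u)⁻¹ := by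
    rw [Real.rpow_neg hu.le, ← Real.sqrt_eq_rpow]
  have hsu' : Real.sqrt u * Real.sqrt u = u := Real.mul_self_sqrt hu.le
  have qs : 0 < Real.sqrt s := Real.sqrt_pos.2 hs
  have qu : 0 < Real.sqrt u := Real.sqrt_pos.2 hu
  rw [es, eu, originDensity, Real.sqrt_div hu.le] at *
  have e2 : C * A / ℓ (1 / s) * ((Real.sqrt s)⁻¹ * (Real.sqrt u)⁻¹)
      = C * A * (Real.sqrt u / Real.sqrt s) / (ℓ (1 / s) * (Real.sqrt u * Real.sqrt u)) := by
    field_simp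
  rw [e2, hsu', div_le_div_iff₀ (by positivity) (by positivity), one_mul]
  calc ℓ (1 / s) * u ≤ C * A * (Real.sqrt u / Real.sqrt s) * ℓ (1 / u) * u := by gcongr
    _ = _ := by ring

theorem IsAdmissible.integrableOn_originDensity (h : IsAdmissible ℓ) {A : Set ℝ}
    (hA : A ⊆ Ioc 0 1) : IntegrableOn (originDensity ℓ) A :=
  (h.originInt_spec one_pos le_rfl).1.mono_set hA

theorem IsAdmissible.integrableOn_mul_originDensity (h : IsAdmissible ℓ) {A : Set ℝ}
    (hA : A ⊆ Ioc 0 1) (hAm : MeasurableSet A) {f : ℝ → ℝ} (hf : Measurable f)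
    (hf1 : ∀ u ∈ A, |f u| ≤ 1) : IntegrableOn (fun u => f u * originDensity ℓ u) A := by
  have hi := h.integrableOn_originDensity hA
  refine hi.mono' (hf.aestronglyMeasurable.mul hi.1) ((ae_restrict_mem hAm).mono fun u hu => ?_)
  have hp := h.originDensity_pos (hA hu).1
  rw [norm_mul, Real.norm_eq_abs, Real.norm_of_nonneg hp.le]
  exact mul_le_of_le_one_left hp.le (hf1 u hu)

theorem div_add_self_mem {s u : ℝ} (hs : 0 < s) (hu : 0 < u) :
    |s / (s + u)| ≤ 1 := by
  rw [abs_of_nonneg (by positivity)]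
  exact div_le_one_of_le₀ (by linarith) (by positivity)

/-- The Stieltjes transform differs from `∫₀^s dr / (r ℓ(1/r))` by at most a multiple of
`1 / ℓ(1/s)`. -/
theorem IsAdmissible.exists_abs_stieltjesInt_sub_le (h : IsAdmissible ℓ) :
    ∃ B : ℝ, 0 ≤ B ∧ ∀ s, 0 < s → s ≤ 1 →
      |stieltjesInt ℓ s - originInt ℓ s| ≤ B * (1 / ℓ (1 / s)) := by
  obtain ⟨A, hA0, hA⟩ := h.exists_originDensity_le
  refine ⟨max 1 (2 * A), by positivity, fun s hs hs1 => ?_⟩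
  have ps := h.pos (show 0 ≤ 1 / s by positivity)
  have hsub1 : Ioc 0 s ⊆ Ioc 0 1 := Ioc_subset_Ioc_right hs1
  have hsub2 : Ioc s 1 ⊆ Ioc 0 1 := Ioc_subset_Ioc_left hs.le
  have hfm : Measurable fun u : ℝ => s / (s + u) := by fun_prop
  have hgm : Measurable fun u : ℝ => u / (s + u) := by fun_prop
  have i1 := h.integrableOn_mul_originDensity hsub1 measurableSet_Ioc hfm
    fun u hu => div_add_self_mem hs hu.1
  have i2 := h.integrableOn_mul_originDensity hsub2 measurableSet_Ioc hfm
    fun u hu => div_add_self_mem hs (hs.trans hu.1)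
  have i3 := h.integrableOn_mul_originDensity hsub1 measurableSet_Ioc hgm fun u hu => by
    rw [add_comm]; exact div_add_self_mem hu.1 hs
  have hsplit : stieltjesInt ℓ s = (∫ u in Ioc 0 s, s / (s + u) * originDensity ℓ u)
      + ∫ u in Ioc s 1, s / (s + u) * originDensity ℓ u := by
    rw [stieltjesInt, ← Ioc_union_Ioc_eq_Ioc hs.le hs1]
    exact setIntegral_union (Ioc_disjoint_Ioc_of_le le_rfl) measurableSet_Ioc i1 i2
  have horigin : originInt ℓ s = (∫ u in Ioc 0 s, s / (s + u) * originDensity ℓ u)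
      + ∫ u in Ioc 0 s, u / (s + u) * originDensity ℓ u := by
    rw [originInt, ← integral_add i1 i3]
    refine setIntegral_congr_fun measurableSet_Ioc fun u hu => ?_
    have := hu.1
    rw [← add_mul, ← add_div, div_self (by positivity), one_mul]
  have hlow : ∫ u in Ioc 0 s, u / (s + u) * originDensity ℓ u ≤ 1 / ℓ (1 / s) := by
    have hconst : ∫ _ in Ioc 0 s, 1 / (s * ℓ (1 / s)) = 1 / ℓ (1 / s) := by
      rw [setIntegral_const, Real.volume_real_Ioc_of_le hs.le, smul_eq_mul]
      field_simp
      ring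
    rw [← hconst]
    refine setIntegral_mono_on i3 (integrableOn_const (by simp)) measurableSet_Ioc
      fun u hu => ?_
    have hu0 := hu.1
    have pu := h.pos (show 0 ≤ 1 / u by positivity)
    have hmono : ℓ (1 / s) ≤ ℓ (1 / u) :=
      h.mono (by positivity) (one_div_le_one_div_of_le hu0 hu.2)
    have e : u / (s + u) * originDensity ℓ u = 1 / ((s + u) * ℓ (1 / u)) := by
      rw [originDensity]; field_simp
    rw [e]
    gcongr
    linarith
  have hlow0 : 0 ≤ ∫ u in Ioc 0 s, u / (s + u) * originDensity ℓ u :=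
    setIntegral_nonneg measurableSet_Ioc fun u hu => by
      have := h.originDensity_pos hu.1
      have := hu.1
      positivity
  have hup0 : 0 ≤ ∫ u in Ioc s 1, s / (s + u) * originDensity ℓ u :=
    setIntegral_nonneg measurableSet_Ioc fun u hu => by
      have hu0 : 0 < u := hs.trans hu.1
      have := h.originDensity_pos hu0
      positivity
  have hup : ∫ u in Ioc s 1, s / (s + u) * originDensity ℓ u ≤ 2 * A * (1 / ℓ (1 / s)) := by
    have hr : (-(3 / 2) : ℝ) < -1 := by norm_num
    have hint := (integrableOn_Ioi_rpow_of_lt hr hs).const_mul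
      (A / ℓ (1 / s) * s ^ (1 / 2 : ℝ))
    have hval : ∫ u in Ioi s, A / ℓ (1 / s) * s ^ (1 / 2 : ℝ) * u ^ (-(3 / 2) : ℝ)
        = 2 * A * (1 / ℓ (1 / s)) := by
      rw [integral_const_mul, integral_Ioi_rpow_of_lt hr hs]
      have e : s ^ (1 / 2 : ℝ) * s ^ (-(3 / 2) + 1 : ℝ) = 1 := by
        rw [← Real.rpow_add hs]; norm_num
      calc A / ℓ (1 / s) * s ^ (1 / 2 : ℝ) * (-s ^ (-(3 / 2) + 1 : ℝ) / (-(3 / 2) + 1))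
          = 2 * A * (1 / ℓ (1 / s)) * (s ^ (1 / 2 : ℝ) * s ^ (-(3 / 2) + 1 : ℝ)) := by ring
        _ = _ := by rw [e, mul_one]
    rw [← hval]
    calc ∫ u in Ioc s 1, s / (s + u) * originDensity ℓ u
        ≤ ∫ u in Ioc s 1, A / ℓ (1 / s) * s ^ (1 / 2 : ℝ) * u ^ (-(3 / 2) : ℝ) := by
          refine setIntegral_mono_on i2 (IntegrableOn.mono_set hint Ioc_subset_Ioi_self)
            measurableSet_Ioc fun u hu => ?_
          have hu0 : 0 < u := hs.trans hu.1
          have hd := hA s u hs hu.1.le hu.2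
          have hq : s / (s + u) ≤ s / u := by gcongr; linarith
          have e1 : s ^ (1 / 2 : ℝ) = s * s ^ (-(1 / 2) : ℝ) := by
            rw [← Real.rpow_one_add' hs.le (by norm_num)]; norm_num
          have e2 : u ^ (-(3 / 2) : ℝ) = u⁻¹ * u ^ (-(1 / 2) : ℝ) := by
            rw [← Real.rpow_neg_one, ← Real.rpow_add hu0]; norm_num
          calc s / (s + u) * originDensity ℓ u
              ≤ s / u * (A / ℓ (1 / s) * (s ^ (-(1 / 2) : ℝ) * u ^ (-(1 / 2) : ℝ))) :=
                mul_le_mul hq hd (h.originDensity_pos hu0).le (by positivity)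
            _ = _ := by rw [e1, e2]; ring
      _ ≤ _ := by
          refine setIntegral_mono_set hint
            ((ae_restrict_mem measurableSet_Ioi).mono fun u hu => ?_)
            Ioc_subset_Ioi_self.eventuallyLE
          have hu0 : 0 < u := hs.trans hu
          show 0 ≤ A / ℓ (1 / s) * s ^ (1 / 2 : ℝ) * u ^ (-(3 / 2) : ℝ)
          positivity
  have hm : 0 < 1 / ℓ (1 / s) := by positivity
  have k1 := mul_le_mul_of_nonneg_right (le_max_left 1 (2 * A)) hm.le
  have k2 := mul_le_mul_of_nonneg_right (le_max_right 1 (2 * A)) hm.le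
  rw [hsplit, horigin, abs_le]
  constructor <;> linarith

/-- `∫₀^s dr / (r ℓ(1/r))` dominates `1 / ℓ(1/s)` by a logarithmic factor, because `ℓ` changes by a
bounded factor between `1/s` and `1/s²`. -/
theorem IsAdmissible.exists_log_mul_le_originInt (h : IsAdmissible ℓ) :
    ∃ C : ℝ, 0 < C ∧ ∀ s, 0 < s → s ≤ 1 →
      Real.log (1 / s) * (1 / ℓ (1 / s)) ≤ C * originInt ℓ s := by
  obtain ⟨C, hC1, hC⟩ := h.exists_sq_le
  refine ⟨C, by linarith, fun s hs hs1 => ?_⟩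
  have ps := h.pos (show 0 ≤ 1 / s by positivity)
  have ps2 := h.pos (show 0 ≤ (1 / s) ^ 2 by positivity)
  have hs2 : s ^ 2 ≤ s := by nlinarith
  have hsub : Ioc (s ^ 2) s ⊆ Ioc 0 s := Ioc_subset_Ioc_left (sq_nonneg s)
  have hi := (h.originInt_spec hs hs1).1
  have hlog : ∫ u in Ioc (s ^ 2) s, 1 / ℓ ((1 / s) ^ 2) * (1 / u)
      = 1 / ℓ ((1 / s) ^ 2) * Real.log (1 / s) := by
    rw [integral_const_mul, ← intervalIntegral.integral_of_le hs2,
      integral_one_div_of_pos (by positivity) hs]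
    congr 2
    field_simp
  have hint : IntegrableOn (fun u => 1 / ℓ ((1 / s) ^ 2) * (1 / u)) (Ioc (s ^ 2) s) := by
    refine Integrable.const_mul ?_ _
    rw [← IntegrableOn, ← intervalIntegrable_iff_integrableOn_Ioc_of_le hs2]
    refine intervalIntegral.intervalIntegrable_one_div (fun u hu => ?_) continuousOn_id
    rw [uIcc_of_le hs2] at hu
    exact (lt_of_lt_of_le (by positivity) hu.1).ne'
  have h1 : 1 / ℓ ((1 / s) ^ 2) * Real.log (1 / s) ≤ originInt ℓ s := by
    rw [← hlog]
    calc ∫ u in Ioc (s ^ 2) s, 1 / ℓ ((1 / s) ^ 2) * (1 / u)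
        ≤ ∫ u in Ioc (s ^ 2) s, originDensity ℓ u := by
          refine setIntegral_mono_on hint (hi.mono_set hsub) measurableSet_Ioc fun u hu => ?_
          have hu0 : 0 < u := (hsub hu).1
          have pu := h.pos (show 0 ≤ 1 / u by positivity)
          have hmono : ℓ (1 / u) ≤ ℓ ((1 / s) ^ 2) := by
            refine h.mono (by positivity) ?_
            rw [one_div_pow]
            exact one_div_le_one_div_of_le (by positivity) hu.1.le
          rw [originDensity, one_div_mul_one_div, mul_comm]
          gcongr
      _ ≤ originInt ℓ s := setIntegral_mono_set hi
          ((ae_restrict_mem measurableSet_Ioc).mono fun u hu => (h.originDensity_pos hu.1).le)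
          hsub.eventuallyLE
  have hlog0 : 0 ≤ Real.log (1 / s) := Real.log_nonneg ((one_le_div hs).2 hs1)
  have h2 : 1 / ℓ (1 / s) ≤ C * (1 / ℓ ((1 / s) ^ 2)) := by
    rw [mul_one_div, div_le_div_iff₀ ps ps2, one_mul]
    exact hC _ (by positivity)
  calc Real.log (1 / s) * (1 / ℓ (1 / s))
      ≤ Real.log (1 / s) * (C * (1 / ℓ ((1 / s) ^ 2))) := by gcongr
    _ = C * (1 / ℓ ((1 / s) ^ 2) * Real.log (1 / s)) := by ring
    _ ≤ _ := by gcongr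

theorem IsAdmissible.stieltjesInt_isEquivalent (h : IsAdmissible ℓ) :
    Asymptotics.IsEquivalent (𝓝[>] 0) (stieltjesInt ℓ) (originInt ℓ) := by
  obtain ⟨B, hB0, hB⟩ := h.exists_abs_stieltjesInt_sub_le
  obtain ⟨C, hC0, hC⟩ := h.exists_log_mul_le_originInt
  refine Asymptotics.IsLittleO.of_bound fun ε hε => ?_
  have hmem : ∀ᶠ s : ℝ in 𝓝[>] 0, s ∈ Ioo (0 : ℝ) 1 := Ioo_mem_nhdsGT one_pos
  have hlog : ∀ᶠ s : ℝ in 𝓝[>] 0, B * C / ε + 1 ≤ Real.log (1 / s) := by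
    simp_rw [one_div]
    exact (Real.tendsto_log_atTop.comp tendsto_inv_nhdsGT_zero).eventually_ge_atTop _
  filter_upwards [hmem, hlog] with s hs hs'
  have hI := h.originInt_pos hs.1 hs.2.le
  rw [Real.norm_of_nonneg hI.le, Real.norm_eq_abs]
  refine (hB s hs.1 hs.2.le).trans ?_
  have h1 := hC s hs.1 hs.2.le
  have h2 : 0 ≤ B * C / ε := by positivity
  have h3 : 0 < Real.log (1 / s) := by linarith
  have h4 : B * C ≤ ε * Real.log (1 / s) := by
    have h5 : B * C / ε ≤ Real.log (1 / s) := by linarith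
    rw [div_le_iff₀ hε] at h5
    linarith
  rw [← mul_le_mul_iff_right₀ h3]
  calc Real.log (1 / s) * (B * (1 / ℓ (1 / s)))
      = B * (Real.log (1 / s) * (1 / ℓ (1 / s))) := by ring
    _ ≤ B * (C * originInt ℓ s) := by gcongr
    _ = B * C * originInt ℓ s := by ring
    _ ≤ ε * Real.log (1 / s) * originInt ℓ s := by gcongr
    _ = _ := by ring

theorem IsAdmissible.stieltjesInt_pos (h : IsAdmissible ℓ) : 0 < stieltjesInt ℓ 1 := by
  have hi := h.integrableOn_mul_originDensity Subset.rfl measurableSet_Ioc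
    (show Measurable fun u : ℝ => 1 / (1 + u) by fun_prop)
    fun u hu => div_add_self_mem one_pos hu.1
  have h1 : 1 / 2 * originInt ℓ 1 ≤ stieltjesInt ℓ 1 := by
    rw [originInt, stieltjesInt, ← integral_const_mul]
    refine setIntegral_mono_on ((h.integrableOn_originDensity Subset.rfl).const_mul _) hi
      measurableSet_Ioc fun u hu => ?_
    have := (h.originDensity_pos hu.1).le
    have := hu.1
    gcongr
    linarith [hu.2]
  have := h.originInt_pos one_pos le_rfl
  linarith

/-- Multiples of the Stieltjes transform are complete Bernstein functions, up to their values off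
the positive half-line. -/
theorem IsAdmissible.exists_isCompleteBernstein (h : IsAdmissible ℓ) {θ : ℝ} (hθ : 0 < θ) :
    ∃ ψ : ℝ → ℝ, IsCompleteBernstein ψ ∧ ∀ s, 0 < s → ψ s = θ * stieltjesInt ℓ s := by
  set q : ℝ → ℝ := fun u => θ * originDensity ℓ u / u with hq
  have hi := h.integrableOn_originDensity Subset.rfl
  have hqm : AEMeasurable q (volume.restrict (Ioc 0 1)) :=
    (hi.1.aemeasurable.const_mul θ).div aemeasurable_id
  have hqm' := hqm.ennreal_ofReal
  set κ : Measure ℝ := (volume.restrict (Ioc 0 1)).withDensity fun u => ENNReal.ofReal (q u) with hκ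
  have hmem : ∀ᵐ u ∂κ, u ∈ Ioi (0 : ℝ) :=
    (withDensity_absolutelyContinuous _ _).ae_le
      ((ae_restrict_mem measurableSet_Ioc).mono fun u hu => hu.1)
  have hrestr : κ.restrict (Ioi 0) = κ := Measure.restrict_eq_self_of_ae_mem hmem
  have hlevy : (∫⁻ t in Ioi (0 : ℝ), ENNReal.ofReal (min 1 t) ∂κ) < ⊤ := by
    rw [hrestr, hκ, lintegral_withDensity_eq_lintegral_mul₀ hqm'
      (show Measurable fun t : ℝ => ENNReal.ofReal (min 1 t) by fun_prop).aemeasurable]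
    have hfin := (hasFiniteIntegral_iff_ofReal ((ae_restrict_mem measurableSet_Ioc).mono
      fun u hu => (mul_pos hθ (h.originDensity_pos hu.1)).le)).1 (hi.const_mul θ).2
    refine lt_of_le_of_lt (lintegral_mono_ae
      ((ae_restrict_mem measurableSet_Ioc).mono fun u hu => ?_)) hfin
    have hp := h.originDensity_pos hu.1
    have hu0 := hu.1
    rw [Pi.mul_apply, ← ENNReal.ofReal_mul (by simp only [hq]; positivity)]
    refine ENNReal.ofReal_le_ofReal ?_
    calc q u * min 1 u ≤ q u * u := by
          refine mul_le_mul_of_nonneg_left (min_le_right _ _) ?_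
          simp only [hq]; positivity
      _ = _ := by simp only [hq]; field_simp
  have hL := isLevy_restrict hlevy
  set g : ℝ → ℝ := fun s => 0 + 0 * s + ∫ t in Ioi (0 : ℝ), (1 - Real.exp (-(s * t))) ∂κ with hg
  refine ⟨fun s => s ^ 2 * ∫ t in Ioi (0 : ℝ), Real.exp (-(t * s)) * g t,
    ⟨g, ⟨0, 0, κ, le_rfl, le_rfl, hlevy, fun s _ => rfl⟩, fun s _ => rfl⟩, fun s hs => ?_⟩
  have hlap := hL.laplace 0 0 hs
  rw [zero_mul, zero_add, zero_add] at hlap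
  simp only [hg]
  rw [hlap, hrestr, hκ, integral_withDensity_eq_integral_toReal_smul₀ hqm'
    (ae_of_all _ fun u => ENNReal.ofReal_lt_top), stieltjesInt, ← integral_const_mul]
  refine setIntegral_congr_fun measurableSet_Ioc fun u hu => ?_
  have hp := h.originDensity_pos hu.1
  have hu0 := hu.1
  rw [ENNReal.toReal_ofReal (by simp only [hq]; positivity), smul_eq_mul]
  simp only [hq]
  field_simp

/-- An associated function is obtained by normalizing the Stieltjes transform at `1`. -/
theorem IsAdmissible.exists_isAssociated (h : IsAdmissible ℓ) : ∃ ψ : ℝ → ℝ, IsAssociated ℓ ψ := by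
  have h1 := h.stieltjesInt_pos
  set θ := (stieltjesInt ℓ 1)⁻¹ with hθ
  have hθ0 : 0 < θ := inv_pos.2 h1
  obtain ⟨ψ, hψ, hψs⟩ := h.exists_isCompleteBernstein hθ0
  have hev : (fun s => θ * stieltjesInt ℓ s) =ᶠ[𝓝[>] 0] ψ := by
    filter_upwards [self_mem_nhdsWithin] with s hs
    exact (hψs s hs).symm
  have hequiv : Asymptotics.IsEquivalent (𝓝[>] 0) ψ fun s => θ * originInt ℓ s :=
    ((Asymptotics.IsEquivalent.refl (u := fun _ => θ)).mul h.stieltjesInt_isEquivalent).congr_left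
      hev
  refine ⟨ψ, hψ, ?_, ?_, θ, hθ0, ?_⟩
  · have h2 := h.tendsto_originInt.const_mul θ
    rw [mul_zero] at h2
    exact hequiv.symm.tendsto_nhds h2
  · rw [hψs 1 one_pos, hθ, inv_mul_cancel₀ h1.ne']
  · refine hequiv.congr_right ?_
    filter_upwards [self_mem_nhdsWithin] with s hs
    rw [intervalIntegral_eq_originInt hs]

end Existence

/-! ### The extremal profile -/

section Extremal

variable {G : Type*} [Group G] {k : ℕ} {S : Fin k → G} {ρ : ℝ → ℝ} {φ : G → ℝ} {ε : ℝ}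

/-- The mixture `(1 - ε) δ_e + ε φ`. -/
def lazyMeasure (ε : ℝ) (φ : G → ℝ) : G → ℝ :=
  fun g => (1 - ε) * indicator {1} (fun _ => 1) g + ε * φ g

theorem isSymmProb_lazyMeasure (hφ : IsSymmProb φ) (hε0 : 0 ≤ ε) (hε1 : ε ≤ 1) :
    IsSymmProb (lazyMeasure ε φ) where
  nonneg g := add_nonneg (mul_nonneg (by linarith) (indicator_nonneg (fun _ _ => zero_le_one) g))
    (mul_nonneg hε0 (hφ.nonneg g))
  hasSum := by
    classical
    have h1 : HasSum (indicator ({1} : Set G) fun _ => (1 : ℝ)) 1 :=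
      (hasSum_ite_eq (1 : G) (1 : ℝ)).congr_fun fun g => by
        by_cases hg : g = 1 <;> simp [hg]
    have h := (h1.mul_left (1 - ε)).add (hφ.hasSum.mul_left ε)
    rwa [mul_one, mul_one, sub_add_cancel] at h
  symm g := by
    unfold lazyMeasure
    rw [hφ.symm]
    congr 2
    by_cases hg : g = 1 <;> simp [hg]

theorem energy_lazyMeasure (ε : ℝ) (φ f : G → ℝ) :
    energy (lazyMeasure ε φ) f = ε * energy φ f := by
  unfold energy
  rw [mul_left_comm, ← tsum_mul_left (a := ε)]
  congr 1
  refine tsum_congr fun y => ?_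
  by_cases hy : y = 1
  · simp [hy]
  · simp [lazyMeasure, hy, mul_assoc]

theorem mul_profile_le_profile_lazyMeasure (hφ : IsSymmProb φ) (hε0 : 0 < ε) (hε1 : ε ≤ 1) {v : ℝ}
    (hv : 1 ≤ v) : ε * spectralProfile φ v ≤ spectralProfile (lazyMeasure ε φ) v := by
  have h := profile_le_mul hφ (isSymmProb_lazyMeasure hφ hε0.le hε1) (inv_pos.2 hε0) hv
    fun f _ => by rw [energy_lazyMeasure, inv_mul_cancel_left₀ hε0.ne']
  rwa [← div_eq_inv_mul, le_div_iff₀ hε0, mul_comm] at h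

theorem support_unif (S : Fin k → G) : Function.support (unif S) = symSet S := by
  ext g
  by_cases hg : g ∈ symSet S
  · have := (symSet_ncard_pos S).ne'
    simp [unif_of_mem hg, hg, this]
  · simp [unif_of_notMem hg, hg]

theorem wordLength_one (S : Fin k → G) : wordLength S 1 = 0 :=
  Nat.le_zero.1 (wordLength_le (w := []) (by simp) rfl)

theorem weakMoment_lazyMeasure_le (hρ : IsModerate ρ) (hφ : IsSymmProb φ) (hε0 : 0 ≤ ε)
    (hε1 : ε ≤ 1) {C : ℝ} (hW : weakMoment S ρ φ ≤ ENNReal.ofReal C) (hC : ε * C ≤ ρ 0) :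
    weakMoment S ρ (lazyMeasure ε φ) ≤ ENNReal.ofReal (2 * ρ 0) := by
  have hl := isSymmProb_lazyMeasure hφ hε0 hε1
  have hρ0 := hρ.pos le_rfl
  refine weakMoment_le hl fun s hs => ?_
  rcases le_or_gt (ρ 0) s with h | h
  · have e : tailMass S ρ (lazyMeasure ε φ) s = ε * tailMass S ρ φ s := by
      unfold tailMass
      rw [← tsum_mul_left]
      refine tsum_congr fun g => ?_
      by_cases hg : s < ρ (wordLength S g)
      · -- the identity has length `0` and does not belong to the tail
        have hg1 : g ≠ 1 := by
          rintro rfl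
          rw [wordLength_one, Nat.cast_zero] at hg
          linarith
        simp [hg, lazyMeasure, hg1]
      · simp [hg]
    have h1 := mul_tailMass_le hρ hφ hW hs
    rw [e]
    calc s * (ε * tailMass S ρ φ s) = ε * (s * tailMass S ρ φ s) := by ring
      _ ≤ ε * C := by gcongr
      _ ≤ 2 * ρ 0 := by linarith
  · have h1 : tailMass S ρ (lazyMeasure ε φ) s ≤ 1 := by
      rw [← hl.hasSum.tsum_eq]
      exact (hl.hasSum.summable.indicator _).tsum_le_tsum
        (fun g => indicator_le_self' (fun _ _ => hl.nonneg g) g) hl.hasSum.summable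
    have h2 : s * tailMass S ρ (lazyMeasure ε φ) s ≤ s * 1 := mul_le_mul_of_nonneg_left h1 hs.le
    linarith

theorem le_extremalProfile (hφ : IsSymmProb φ)
    (hW : weakMoment S ρ φ ≤ ENNReal.ofReal (2 * ρ 0)) {v : ℝ} (hv : 1 ≤ v) :
    spectralProfile φ v ≤ extremalProfile S ρ v := by
  refine le_csSup ⟨2, ?_⟩ ⟨φ, hφ, hW, rfl⟩
  rintro _ ⟨φ', hφ', -, rfl⟩
  exact profile_le_two hφ' hv

/-- The measure attaining a given upper bound up to a constant is made lazy, so that its weak moment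
is at most `2 ρ(0)`. -/
theorem exists_extremalProfile_bounds (hρ : IsModerate ρ) (hφ : IsSymmProb φ) {a C K : ℝ}
    (ha : 0 < a) (hK : 0 < K) (hW : weakMoment S ρ φ ≤ ENNReal.ofReal K) {F : ℝ → ℝ}
    (hC : 0 < C)
    (hlow : ∀ v, 1 ≤ v → a * F v ≤ spectralProfile φ v)
    (hup : ∀ (φ : G → ℝ) (K : ℝ), IsSymmProb φ → weakMoment S ρ φ ≤ ENNReal.ofReal K →
      ∀ v, 1 ≤ v → spectralProfile φ v ≤ C * K * F v) :
    ∃ c C : ℝ, 0 < c ∧ 0 < C ∧ ∀ v, 1 ≤ v →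
      c * F v ≤ extremalProfile S ρ v ∧ extremalProfile S ρ v ≤ C * F v := by
  have hρ0 := hρ.pos le_rfl
  set ε := min 1 (ρ 0 / K) with hε
  have hε0 : 0 < ε := lt_min one_pos (by positivity)
  have hε1 : ε ≤ 1 := min_le_left _ _
  have hεK : ε * K ≤ ρ 0 := (le_div_iff₀ hK).1 (min_le_right _ _)
  have hl := isSymmProb_lazyMeasure hφ hε0.le hε1
  have hlW := weakMoment_lazyMeasure_le hρ hφ hε0.le hε1 hW hεK
  refine ⟨ε * a, C * (2 * ρ 0), by positivity, by positivity, fun v hv => ⟨?_, ?_⟩⟩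
  · calc ε * a * F v = ε * (a * F v) := by ring
      _ ≤ ε * spectralProfile φ v := by gcongr; exact hlow v hv
      _ ≤ spectralProfile (lazyMeasure ε φ) v :=
          mul_profile_le_profile_lazyMeasure hφ hε0 hε1 hv
      _ ≤ _ := le_extremalProfile hl hlW hv
  · refine csSup_le ⟨_, _, hl, hlW, rfl⟩ ?_
    rintro _ ⟨φ', hφ', hW', rfl⟩
    exact hup φ' _ hφ' hW' v hv

/-- `1 / ρ(1/Λ)` depends, up to constants, only on the class of the profile. -/
theorem recipAt_profile_le (hρ : IsModerate ρ) {φ μ : G → ℝ} (hφ : IsSymmProb φ)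
    (hφs : FinSupp φ) (hμ : IsSymmProb μ) (hμs : FinSupp μ)
    (hgen : Subgroup.closure (Function.support μ) = ⊤) :
    ∃ B : ℝ, 0 < B ∧ ∀ v, 1 ≤ v →
      recipAt ρ (spectralProfile φ v) ≤ B * recipAt ρ (spectralProfile μ v) := by
  obtain ⟨A, hA, hE⟩ := energy_le_mul_energy hφ hφs hμ hμs hgen
  obtain ⟨B, hB1, hB⟩ := hρ.recipAt_mul_le hA
  refine ⟨B, by linarith, fun v hv => ?_⟩
  exact (hρ.recipAt_mono (profile_nonneg hφ hv) (profile_le_mul hφ hμ hA hv hE)).trans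
    (hB _ (profile_nonneg hμ hv))

end Extremal

section Subordination

variable {G : Type*} [Group G] {ρ ℓ ψ : ℝ → ℝ}

/-- The subordinated measure and its profile. -/
theorem exists_subord_bounds (hℓ : IsAdmissible ℓ) (hρ : IsMomentFunction ρ ℓ)
    (hψ : IsAssociated ℓ ψ) (n : ℕ) : ∃ c C : ℝ, 0 < c ∧ 0 < C ∧
      ∀ (k : ℕ) (S : Fin k → G), Generates S → (symSet S).ncard = n →
        IsSymmProb (subord ψ (unif S)) ∧
        weakMoment S ρ (subord ψ (unif S)) ≤ ENNReal.ofReal C ∧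
        ∀ v : ℝ, 1 ≤ v →
          c * recipAt ρ (spectralProfile (unif S) v) ≤ spectralProfile (subord ψ (unif S)) v ∧
          spectralProfile (subord ψ (unif S)) v ≤ C * recipAt ρ (spectralProfile (unif S) v) := by
  have hm := hρ.isModerate hℓ
  obtain ⟨hc0, hc, hgen⟩ := subordCoeff_spec hψ.completeBernstein hψ.map_zero hψ.map_one
  obtain ⟨d, D, hd, hD, hbd⟩ := hψ.exists_bounds hℓ hρ
  have hup := tailWeight_le hc0 hc hgen fun s hs hs1 => (hbd s hs hs1).2
  obtain ⟨d', hd', hlow⟩ := exists_le_tailWeight hm hc0 hc hgen hd fun s hs hs1 => (hbd s hs hs1).1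
  obtain ⟨a, ha, hprof⟩ := le_profile_mixture (G := G) hm hc0 hc hd' hlow n
  obtain ⟨C, hC, hgeneral⟩ := profile_le_of_weakMoment (G := G) hm n
  refine ⟨a, max (2 * D) (C * (2 * D)), ha, by positivity, fun k S hS hn => ?_⟩
  rw [subord_eq_mixture]
  have hP := isSymmProb_mixture (S := S) hc0 hc
  have hW := weakMoment_mixture_le (S := S) hm hc0 hc (by positivity) hup
  refine ⟨hP, hW.trans (ENNReal.ofReal_le_ofReal (le_max_left _ _)), fun v hv =>
    ⟨hprof k S hS hn v hv, (hgeneral k S hS hn _ _ hP hW v hv).trans ?_⟩⟩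
  exact mul_le_mul_of_nonneg_right (le_max_right _ _)
    (hm.recipAt_nonneg (profile_nonneg (isSymmProb_unif S) hv))

end Subordination

end Profile

end

theorem mainTheorem3 {G : Type*} [Group G] [Group.FG G] (hG : Profile.IsAmenable G)
    (ρ ℓ : ℝ → ℝ) (hℓ : Profile.IsAdmissible ℓ) (hρ : Profile.IsMomentFunction ρ ℓ) :
    -- an associated complete Bernstein function exists
    (∃ ψ : ℝ → ℝ, Profile.IsAssociated ℓ ψ) ∧
    -- the subordinated measure has finite weak moment, and its profile is known
    (∀ ψ : ℝ → ℝ, Profile.IsAssociated ℓ ψ → ∀ n : ℕ, ∃ c C : ℝ, 0 < c ∧ 0 < C ∧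
      ∀ (k : ℕ) (S : Fin k → G), Profile.Generates S → (Profile.symSet S).ncard = n →
        Profile.IsSymmProb (Profile.subord ψ (Profile.unif S)) ∧
        Profile.weakMoment S ρ (Profile.subord ψ (Profile.unif S)) ≤ ENNReal.ofReal C ∧
        ∀ v : ℝ, 1 ≤ v →
          c * Profile.recipAt ρ (Profile.spectralProfile (Profile.unif S) v) ≤
              Profile.spectralProfile (Profile.subord ψ (Profile.unif S)) v ∧
            Profile.spectralProfile (Profile.subord ψ (Profile.unif S)) v ≤
              C * Profile.recipAt ρ (Profile.spectralProfile (Profile.unif S) v)) ∧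
    -- upper bound for every measure with finite weak moment
    (∀ n : ℕ, ∃ C : ℝ, 0 < C ∧
      ∀ (k : ℕ) (S : Fin k → G), Profile.Generates S → (Profile.symSet S).ncard = n →
        ∀ (φ : G → ℝ) (K : ℝ), Profile.IsSymmProb φ →
          Profile.weakMoment S ρ φ ≤ ENNReal.ofReal K →
          ∀ v : ℝ, 1 ≤ v →
            Profile.spectralProfile φ v ≤
              C * K * Profile.recipAt ρ (Profile.spectralProfile (Profile.unif S) v)) ∧
    -- the extremal profile, for every representative of the profile of the group
    (∀ (k : ℕ) (S : Fin k → G), Profile.Generates S →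
      ∀ μ : G → ℝ, Profile.IsSymmProb μ → (Function.support μ).Finite →
        Subgroup.closure (Function.support μ) = ⊤ →
        ∃ c C : ℝ, 0 < c ∧ 0 < C ∧ ∀ v : ℝ, 1 ≤ v →
          c * Profile.recipAt ρ (Profile.spectralProfile μ v) ≤
              Profile.extremalProfile S ρ v ∧
            Profile.extremalProfile S ρ v ≤
              C * Profile.recipAt ρ (Profile.spectralProfile μ v)) := by
  have hm := hρ.isModerate hℓ
  have hgeneral := fun n => Profile.profile_le_of_weakMoment (G := G) hm n
  refine ⟨hℓ.exists_isAssociated, fun ψ hψ n => Profile.exists_subord_bounds hℓ hρ hψ n, hgeneral,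
    fun k S hS μ hμ hμs hgen => ?_⟩
  obtain ⟨ψ, hψ⟩ := hℓ.exists_isAssociated
  obtain ⟨a, K, ha, hK, hsub⟩ := Profile.exists_subord_bounds (G := G) hℓ hρ hψ
    (Profile.symSet S).ncard
  obtain ⟨hP, hW, hprof⟩ := hsub k S hS rfl
  obtain ⟨C, hC, hup⟩ := hgeneral (Profile.symSet S).ncard
  obtain ⟨c, D, hc, hD, hext⟩ := Profile.exists_extremalProfile_bounds hm hP ha hK hW hC
    (fun v hv => (hprof v hv).1) (hup k S hS rfl)
  have hu := Profile.isSymmProb_unif S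
  have hus : Profile.FinSupp (Profile.unif S) := by
    rw [Profile.FinSupp, Profile.support_unif]
    exact Profile.symSet_finite S
  obtain ⟨A, hA, hμu⟩ := Profile.recipAt_profile_le hm hμ hμs hu hus (by
    rw [Profile.support_unif, Profile.closure_symSet hS])
  obtain ⟨B, hB, huμ⟩ := Profile.recipAt_profile_le hm hu hus hμ hμs hgen
  refine ⟨c / A, D * B, by positivity, by positivity, fun v hv => ⟨?_, ?_⟩⟩
  · refine le_trans ?_ (hext v hv).1
    rw [div_mul_eq_mul_div, div_le_iff₀ hA]
    calc c * Profile.recipAt ρ (Profile.spectralProfile μ v)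
        ≤ c * (A * Profile.recipAt ρ (Profile.spectralProfile (Profile.unif S) v)) :=
          mul_le_mul_of_nonneg_left (hμu v hv) hc.le
      _ = _ := by ring
  · refine (hext v hv).2.trans ?_
    calc D * Profile.recipAt ρ (Profile.spectralProfile (Profile.unif S) v)
        ≤ D * (B * Profile.recipAt ρ (Profile.spectralProfile μ v)) :=
          mul_le_mul_of_nonneg_left (huμ v hv) hD.le
      _ = _ := by ring
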